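/- Let $N\ge 2$ be an integer, $s\in(0,1)$, and put $$C_{N,s}=2^{2s}\pi^{-N/2}\,s\,\frac{\Gamma(\frac{N+2s}{2})}{\Gamma(1-s)},\qquad \mu_0=-2^{2s}\frac{\Gamma(\frac{N+2s}{4})^2}{\Gamma(\frac{N-2s}{4})^2},$$ and let $\omega_{N-1}$ be the surface measure of the unit sphere of $\mathbb R^N$, $B_t$ the open ball of radius $t$ centred at $0$, and $e_1=(1,0,\dots,0)$. For functions $w,v$ on $\mathbb R^N$ let $$(-\Delta)^s_{w}v(x)=C_{N,s}\lim_{\epsilon\to0^+}\int_{\mathbb R^N\setminus B_\epsilon(x)}\frac{v(x)-v(z)}{|x-z|^{N+2s}}\,w(z)\,dz ,\qquad (-\Delta)^s=(-\Delta)^s_{1},$$ whenever the truncated integrals converge absolutely and the limit exists. Let $\mu\ge\mu_0$. Then there are a unique $\tau_-\in(-N,\frac{2s-N}{2}]$ and a unique $\tau_+\in[\frac{2s-N}{2},2s)$ such that the functions $$\Phi_\mu(x)=\begin{cases}|x|^{\tau_-}&\text{if }\mu>\mu_0,\\ -|x|^{\tau_-}\ln|x|&\text{if }\mu=\mu_0,\end{cases}\qquad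 \Gamma_\mu(x)=|x|^{\tau_+}$$ belong to $C^\infty(\mathbb R^N\setminus\{0\})\cap L^1\big(\mathbb R^N,\frac{dx}{1+|x|^{N+2s}}\big)$ and satisfy $(-\Delta)^su+\frac{\mu}{|x|^{2s}}u=0$ pointwise in $\mathbb R^N\setminus\{0\}$. Define $$c_{s,\mu}=\begin{cases}\displaystyle C_{N,s}\,\omega_{N-1}\int_0^1\frac1t\int_{B_t}\frac{|z|^{\tau_-}-|z|^{\tau_+}}{|e_1-z|^{N+2s}}\,dz\,dt&\text{if }\mu>\mu_0,\\[3mm]\displaystyle C_{N,s}\,\omega_{N-1}\int_0^1\frac1t\int_{B_t}\frac{|z|^{\frac{2s-N}{2}}(-\ln|z|)}{|e_1-z|^{N+2s}}\,dz\,dt&\text{if }\mu=\mu_0.\end{cases}$$ These integrals converge absolutely and $c_{s,\mu}>0$. Moreover, for every $\xi\in C^2_c(\mathbb R^N)$, the value $(-\Delta)^s_{\Gamma_\mu}\xi(x)$ is well defined for all $x\in\mathbb R^N\setminus\{0\}$, the function $\Phi_\mu\,(-\Delta)^s_{\Gamma_\mu}\xi$ is Lebesgue integrable on $\mathbb R^N$,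 and $$\int_{\mathbb R^N}\Phi_\mu\,(-\Delta)^s_{\Gamma_\mu}\xi\,dx=c_{s,\mu}\,\xi(0).$$ -/

import Mathlib

open MeasureTheory Filter Topology Set
open scoped ContDiff

noncomputable section

namespace FracHardy

/-- The Euclidean space `ℝ^N`. -/
abbrev E (N : ℕ) : Type := EuclideanSpace ℝ (Fin N)

/-- The first coordinate vector `e₁ = (1, 0, …, 0)`. -/
def e1 (N : ℕ) : E N := WithLp.toLp 2 (fun i : Fin N => if (i : ℕ) = 0 then (1 : ℝ) else 0)

/-- The normalization constant
`C_{N,s} = 2^{2s} π^{-N/2} s Γ((N+2s)/2) / Γ(1-s)` of the fractional Laplacian. -/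
def fracConst (N : ℕ) (s : ℝ) : ℝ :=
  2 ^ (2 * s) * Real.pi ^ (-((N : ℝ) / 2)) * s * Real.Gamma (((N : ℝ) + 2 * s) / 2)
    / Real.Gamma (1 - s)

/-- The surface measure `ω_{N-1}` of the unit sphere of `ℝ^N`. -/
def sphereArea (N : ℕ) : ℝ := (volume : Measure (E N)).toSphere.real Set.univ

/-- The critical Hardy constant `μ₀ = -2^{2s} Γ((N+2s)/4)² / Γ((N-2s)/4)²`. -/
def mu0 (N : ℕ) (s : ℝ) : ℝ :=
  -(2 ^ (2 * s) * Real.Gamma (((N : ℝ) + 2 * s) / 4) ^ 2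
    / Real.Gamma (((N : ℝ) - 2 * s) / 4) ^ 2)

/-- The integrand `(v(x) - v(z)) |x - z|^{-N-2s} w(z)`. -/
def fracKernel {N : ℕ} (s : ℝ) (w v : E N → ℝ) (x z : E N) : ℝ :=
  (v x - v z) / ‖x - z‖ ^ ((N : ℝ) + 2 * s) * w z

/-- The truncation `C_{N,s} ∫_{|x-z| ≥ ε} (v(x) - v(z)) |x - z|^{-N-2s} w(z) dz`. -/
def fracTrunc {N : ℕ} (s : ℝ) (w v : E N → ℝ) (x : E N) (ε : ℝ) : ℝ :=
  fracConst N s * ∫ z in (Metric.ball x ε)ᶜ, fracKernel s w v x z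

/-- The fractional Laplacian of `v` with weight `w` is well defined at `x`, with value `L`:
all the truncated integrals converge absolutely, and they tend to `L` as `ε → 0⁺`. -/
def HasFracLap {N : ℕ} (s : ℝ) (w v : E N → ℝ) (x : E N) (L : ℝ) : Prop :=
  (∀ ε : ℝ, 0 < ε → IntegrableOn (fracKernel s w v x) (Metric.ball x ε)ᶜ) ∧
    Tendsto (fracTrunc s w v x) (𝓝[>] 0) (𝓝 L)

/-- The fractional Laplacian `(-Δ)^s_w v(x)` with weight `w`, as a principal value.
It is meaningful where `HasFracLap` holds for some value. -/
def fracLap {N : ℕ} (s : ℝ) (w v : E N → ℝ) (x : E N) : ℝ :=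
  limUnder (𝓝[>] (0 : ℝ)) (fracTrunc s w v x)

/-- `u` is a classical solution of `(-Δ)^s u + μ |x|^{-2s} u = 0` in `ℝ^N ∖ {0}` which lies in
`C^∞(ℝ^N ∖ {0}) ∩ L¹(ℝ^N, dx / (1 + |x|^{N+2s}))`. The unweighted fractional Laplacian is the
one with weight `1`. -/
def IsHardySolution {N : ℕ} (s μ : ℝ) (u : E N → ℝ) : Prop :=
  ContDiffOn ℝ ∞ u {0}ᶜ ∧
    Integrable (fun x : E N => u x / (1 + ‖x‖ ^ ((N : ℝ) + 2 * s))) ∧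
    ∀ x : E N, x ≠ 0 → HasFracLap s (fun _ => 1) u x (-(μ / ‖x‖ ^ (2 * s) * u x))

/-- `|x|^τ` if `μ ≠ μ₀`, and `-|x|^τ ln |x|` if `μ = μ₀`. -/
def PhiOf (N : ℕ) (s μ τ : ℝ) (x : E N) : ℝ :=
  if μ = mu0 N s then -(‖x‖ ^ τ * Real.log ‖x‖) else ‖x‖ ^ τ

/-- `|x|^τ`. -/
def GammaOf (N : ℕ) (τ : ℝ) (x : E N) : ℝ := ‖x‖ ^ τ

/-- The property that characterizes `τ₋(s, μ)`. -/
def IsTauMinus (N : ℕ) (s μ τ : ℝ) : Prop :=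
  τ ∈ Ioc (-(N : ℝ)) ((2 * s - N) / 2) ∧ IsHardySolution s μ (PhiOf N s μ τ)

/-- The property that characterizes `τ₊(s, μ)`. -/
def IsTauPlus (N : ℕ) (s μ τ : ℝ) : Prop :=
  τ ∈ Ico ((2 * s - N) / 2) (2 * s) ∧ IsHardySolution s μ (GammaOf N τ)

/-- `τ₋(s, μ)`: the exponent in `(-N, (2s-N)/2]` for which `Φ_μ` is a classical solution. -/
def tauMinus (N : ℕ) (s μ : ℝ) : ℝ := Classical.epsilon (IsTauMinus N s μ)

/-- `τ₊(s, μ)`: the exponent in `[(2s-N)/2, 2s)` for which `Γ_μ` is a classical solution. -/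
def tauPlus (N : ℕ) (s μ : ℝ) : ℝ := Classical.epsilon (IsTauPlus N s μ)

/-- The fundamental solution `Φ_μ`. -/
def Phi (N : ℕ) (s μ : ℝ) : E N → ℝ := PhiOf N s μ (tauMinus N s μ)

/-- The weight `Γ_μ = |x|^{τ₊(s, μ)}`. -/
def Weight (N : ℕ) (s μ : ℝ) : E N → ℝ := GammaOf N (tauPlus N s μ)

/-- The integrand of the normalization constant. -/
def normKernel (N : ℕ) (s μ : ℝ) (z : E N) : ℝ :=
  if μ = mu0 N s then
    ‖z‖ ^ ((2 * s - N) / 2) * (-Real.log ‖z‖) / ‖e1 N - z‖ ^ ((N : ℝ) + 2 * s)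
  else
    (‖z‖ ^ tauMinus N s μ - ‖z‖ ^ tauPlus N s μ) / ‖e1 N - z‖ ^ ((N : ℝ) + 2 * s)

/-- The inner integral, over the ball `B_t`, divided by `t`. -/
def normInner (N : ℕ) (s μ t : ℝ) : ℝ :=
  1 / t * ∫ z in Metric.ball (0 : E N) t, normKernel N s μ z

/-- The normalization constant `c_{s,μ}`. -/
def normConst (N : ℕ) (s μ : ℝ) : ℝ :=
  fracConst N s * sphereArea N * ∫ t in (0 : ℝ)..1, normInner N s μ t

end FracHardy

end

/-!
Throughout, `K(v) = |v|^(-N-2s)`. The proof has three parts.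

**The exponents.** Folding the outside of the unit ball onto the ball by the inversion
`y ↦ y / |y|²` turns the principal value defining `(-Δ)^s |x|^τ` at `e₁` into an absolutely
convergent integral (`RadialProfile.hasFracLap_e1`), and similarities give
`(-Δ)^s |x|^τ = λ(τ) |x|^(τ-2s)` with
`λ(τ) = C ∫_{B₁} (1 - |y|^τ) (1 - |y|^(2s-N-τ)) K(e₁ - y) dy` (`powCoeff`). The function `λ` is
symmetric about `(2s-N)/2`, strictly increasing on `(-N, (2s-N)/2]`, continuous and unbounded below
at `-N`. Its maximum is `λ((2s-N)/2) = -μ₀` (`powCoeff_critical`): the energy of `|x|^((2s-N)/2)`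
against the Gaussian `exp (-|x|²)` is computed once in polar coordinates, which produces
`λ((2s-N)/2)`, and once by writing the power as a superposition of Gaussians, which produces Gamma
functions. Hence `λ(τ) = -μ` has exactly one root `τ₋` in `(-N, (2s-N)/2]`, and `τ₊ = 2s-N-τ₋`. For
`μ = μ₀` the coefficient of the logarithmic solution vanishes at the critical exponent only
(`logCoeff_pos`).

**Reduction of the identity to a symmetric double integral.** Let `φ` be the radial profile of
`Φ_μ`. After the kernel of `(-Δ)^s_Γ ξ` is made even about `x`, all integrals converge absolutely
(`FundamentalProfile.integrable_evenPair`), and symmetrization gives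
`∫ Φ (-Δ)^s_Γ ξ = (C/2) ∬ (ξ(x) - ξ(z)) (Φ(x) Γ(z) - Φ(z) Γ(x)) K(x - z) dx dz`
(`FundamentalProfile.integral_evenPair`). The antisymmetric factor is homogeneous of degree `2s-N`
in `(x, z)`, in the logarithmic case too; this is the only place where the two cases meet, and
`FundamentalProfile` records what is needed of `φ`.

**Evaluation.** In the coordinates `x = r θ`, `z = r y` with `|θ| = 1` the double integral becomes
`∫∫∫ (ξ(r θ) - ξ(r y)) dr/r w(|y|) K(θ - y) dy dθ`, where `w(σ) = φ(1) σ^(2s-N-τ₋) - φ(σ)`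
(`wronskian`). Exchange of `θ` with the direction of `y` preserves `|y|` and `|θ - y|`, so that
averaging leaves Frullani integrals `∫ (ξ(r θ) - ξ(r |y| θ)) dr/r = ξ(0) ln |y|`. What remains is
`ξ(0) ω ∫ ln |y| w(|y|) K(e₁ - y) dy` over the whole space; by inversion this is twice the integral
over the unit ball, which is the normalization constant by Tonelli's theorem
(`FundamentalProfile.integrable_and_integral_inner`).
-/

namespace FracHardy

open scoped ENNReal

variable {N : ℕ}

/-! ### Polar coordinates, rotations and dilations -/

/-- The measure `r ^ k dr` on the half-line `(0, ∞)`. -/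
noncomputable def powMeasure (k : ℕ) : Measure ℝ :=
  (volume.restrict (Ioi 0)).withDensity fun r => ENNReal.ofReal (r ^ k)

instance (k : ℕ) : SigmaFinite (powMeasure k) :=
  SigmaFinite.withDensity_of_ne_top' (by simp)

theorem lintegral_powMeasure (k : ℕ) {f : ℝ → ℝ≥0∞} (hf : Measurable f) :
    ∫⁻ r, f r ∂powMeasure k = ∫⁻ r in Ioi 0, ENNReal.ofReal (r ^ k) * f r := by
  rw [powMeasure, lintegral_withDensity_eq_lintegral_mul _ (by fun_prop) hf]
  rfl

theorem integral_powMeasure (k : ℕ) (f : ℝ → ℝ) :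
    ∫ r, f r ∂powMeasure k = ∫ r in Ioi 0, r ^ k * f r := by
  unfold powMeasure
  rw [integral_withDensity_eq_integral_toReal_smul (by fun_prop) (by simp)]
  refine setIntegral_congr_fun measurableSet_Ioi fun r hr => ?_
  simp [ENNReal.toReal_ofReal (pow_nonneg (le_of_lt hr) k)]

theorem lintegral_polar [NeZero N] {f : E N → ℝ≥0∞} (hf : Measurable f) :
    ∫⁻ x, f x = ∫⁻ θ, ∫⁻ r, f (r • (θ : E N)) ∂powMeasure (N - 1)
      ∂(volume : Measure (E N)).toSphere := by
  have h := (volume : Measure (E N)).measurePreserving_homeomorphUnitSphereProd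
  have hd : Module.finrank ℝ (E N) = N := by simp
  rw [hd] at h
  have hm : Measurable fun p : Metric.sphere (0 : E N) 1 × Ioi (0 : ℝ) =>
      f ((p.2 : ℝ) • (p.1 : E N)) := by fun_prop
  calc ∫⁻ x, f x = ∫⁻ x in ({0}ᶜ : Set (E N)), f x := by rw [restrict_compl_singleton]
    _ = ∫⁻ x : ({0}ᶜ : Set (E N)), f x.1 ∂(volume.comap Subtype.val) :=
        (lintegral_subtype_comap (measurableSet_singleton _).compl f).symm
    _ = ∫⁻ p, f ((p.2 : ℝ) • (p.1 : E N))
          ∂((volume : Measure (E N)).toSphere.prod (Measure.volumeIoiPow (N - 1))) := by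
        rw [← h.lintegral_comp hm]
        refine lintegral_congr fun x => ?_
        congr 1
        have hx : ‖(x : E N)‖ ≠ 0 := norm_ne_zero_iff.2 x.2
        simp [smul_smul, hx]
    _ = _ := by
        rw [lintegral_prod _ hm.aemeasurable]
        refine lintegral_congr fun θ => ?_
        rw [lintegral_powMeasure _ (by fun_prop), Measure.volumeIoiPow,
          lintegral_withDensity_eq_lintegral_mul _ (by fun_prop) (by fun_prop),
          ← lintegral_subtype_comap measurableSet_Ioi]
        rfl

theorem lintegral_dilate {f : E N → ℝ≥0∞} (hf : Measurable f) {r : ℝ} (hr : 0 < r) :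
    ∫⁻ x, f x = ENNReal.ofReal (r ^ N) * ∫⁻ y, f (r • y) := by
  have h := Measure.map_addHaar_smul (volume : Measure (E N)) hr.ne'
  have h2 : ∫⁻ y, f (r • y) = ENNReal.ofReal ((r ^ N)⁻¹) * ∫⁻ x, f x := by
    rw [← lintegral_map hf (by fun_prop : Measurable fun x : E N => r • x), h]
    simp [abs_of_pos hr]
  rw [h2, ← mul_assoc, ← ENNReal.ofReal_mul (by positivity),
    mul_inv_cancel₀ (by positivity)]
  simp

/-- The coordinates `x = r θ`, `z = r y` on pairs of points: `x` is written in polar coordinates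
and `z` is measured in units of `|x|`. Kernels that are homogeneous in `(x, z)` separate in the
variables `(θ, y)` and `r`. -/
theorem map_polarPair [NeZero N] :
    Measure.map (fun p : (Metric.sphere (0 : E N) 1 × E N) × ℝ =>
        (p.2 • (p.1.1 : E N), p.2 • p.1.2))
      (((volume : Measure (E N)).toSphere.prod volume).prod (powMeasure (2 * N - 1)))
      = (volume : Measure (E N × E N)) := by
  refine Measure.ext_of_lintegral _ fun F hF => ?_
  rw [lintegral_map hF (by fun_prop), lintegral_prod _ (by fun_prop),
    lintegral_prod _ (by fun_prop), Measure.volume_eq_prod, lintegral_prod _ (by fun_prop),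
    lintegral_polar (by fun_prop)]
  refine lintegral_congr fun θ => ?_
  rw [lintegral_lintegral_swap (by fun_prop), lintegral_powMeasure _ (by fun_prop),
    lintegral_powMeasure _ (by fun_prop)]
  refine setLIntegral_congr_fun measurableSet_Ioi fun r hr => ?_
  have hN : N ≠ 0 := NeZero.ne N
  simp only
  rw [lintegral_dilate (f := fun z => F (r • (θ : E N), z)) (by fun_prop) hr, ← mul_assoc,
    ← ENNReal.ofReal_mul (pow_nonneg (le_of_lt hr) _), ← pow_add]
  congr 4
  omega

theorem lintegral_polarPair [NeZero N] {F : E N → E N → ℝ≥0∞}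
    (hF : Measurable fun p : E N × E N => F p.1 p.2) :
    ∫⁻ x, ∫⁻ z, F x z = ∫⁻ θ, (∫⁻ y, ∫⁻ r in Ioi (0 : ℝ),
        ENNReal.ofReal (r ^ (2 * N - 1)) * F (r • (θ : E N)) (r • y))
      ∂(volume : Measure (E N)).toSphere := by
  have h1 : ∫⁻ x, ∫⁻ z, F x z = ∫⁻ p : E N × E N, F p.1 p.2 := by
    rw [Measure.volume_eq_prod, lintegral_prod _ hF.aemeasurable]
  have hm : Measurable fun p : (Metric.sphere (0 : E N) 1 × E N) × ℝ =>
      F (p.2 • (p.1.1 : E N)) (p.2 • p.1.2) :=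
    hF.comp (by fun_prop : Measurable fun p : (Metric.sphere (0 : E N) 1 × E N) × ℝ =>
        (p.2 • (p.1.1 : E N), p.2 • p.1.2))
  rw [h1, ← map_polarPair, lintegral_map hF (by fun_prop), lintegral_prod _ hm.aemeasurable,
    lintegral_prod _ (by fun_prop)]
  refine lintegral_congr fun θ => lintegral_congr fun y => ?_
  rw [lintegral_powMeasure]
  exact hm.comp (by fun_prop : Measurable fun r : ℝ => ((θ, y), r))

theorem norm_e1 [NeZero N] : ‖e1 N‖ = 1 := by
  have : e1 N = EuclideanSpace.single (0 : Fin N) (1 : ℝ) := by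
    ext i
    simp only [e1, PiLp.single_apply, Fin.ext_iff, Fin.val_zero]
  rw [this]; simp

theorem e1_ne_zero [NeZero N] : e1 N ≠ 0 := by
  rw [← norm_ne_zero_iff, norm_e1]; exact one_ne_zero

theorem exists_rotation [NeZero N] {θ : E N} (hθ : ‖θ‖ = 1) :
    ∃ R : E N ≃ₗᵢ[ℝ] E N, R (e1 N) = θ :=
  ⟨_, Submodule.reflection_sub (norm_e1.trans hθ.symm)⟩

/-- Rotation invariance: the pole `θ` of a kernel in `|y|` and `|θ - y|` may be moved to `e₁`. -/
theorem lintegral_rotate [NeZero N] (F : ℝ → ℝ → ℝ≥0∞) {θ : E N} (hθ : ‖θ‖ = 1) :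
    ∫⁻ y : E N, F ‖y‖ ‖θ - y‖ = ∫⁻ y : E N, F ‖y‖ ‖e1 N - y‖ := by
  obtain ⟨R, rfl⟩ := exists_rotation hθ
  have := R.measurePreserving.lintegral_comp_emb R.toHomeomorph.measurableEmbedding
    (fun y => F ‖y‖ ‖R (e1 N) - y‖)
  rw [← this]
  simp [← map_sub]

theorem integral_rotate [NeZero N] (F : ℝ → ℝ → ℝ) {θ : E N} (hθ : ‖θ‖ = 1) :
    ∫ y : E N, F ‖y‖ ‖θ - y‖ = ∫ y : E N, F ‖y‖ ‖e1 N - y‖ := by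
  obtain ⟨R, rfl⟩ := exists_rotation hθ
  have := R.measurePreserving.integral_comp R.toHomeomorph.measurableEmbedding
    (fun y => F ‖y‖ ‖R (e1 N) - y‖)
  rw [← this]
  simp [← map_sub]

/-! ### The inversion `y ↦ y / |y|²` -/

/-- The inversion in the unit sphere. -/
noncomputable abbrev inv0 (y : E N) : E N := EuclideanGeometry.inversion (0 : E N) 1 y

/-- The open unit ball without its centre. -/
abbrev punctured (N : ℕ) : Set (E N) := {y | 0 < ‖y‖ ∧ ‖y‖ < 1}

theorem measurableSet_punctured : MeasurableSet (punctured N) :=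
  (measurableSet_lt measurable_const measurable_norm).inter
    (measurableSet_lt measurable_norm measurable_const)

theorem punctured_eq : punctured N = Metric.ball (0 : E N) 1 \ {0} := by
  ext y; simp [and_comm]

theorem punctured_ae_eq [NeZero N] : punctured N =ᵐ[volume] Metric.ball (0 : E N) 1 := by
  rw [punctured_eq]
  exact sdiff_null_ae_eq_self (measure_singleton _)

theorem norm_inv0 (y : E N) : ‖inv0 y‖ = ‖y‖⁻¹ := by
  have := EuclideanGeometry.dist_inversion_center (0 : E N) y 1
  simpa using this

theorem image_inv0 : inv0 '' punctured N = {y : E N | 1 < ‖y‖} := by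
  ext y
  constructor
  · rintro ⟨x, ⟨h0, h1⟩, rfl⟩
    simpa [norm_inv0] using (one_lt_inv₀ h0).2 h1
  · intro hy
    have hy : 1 < ‖y‖ := hy
    refine ⟨inv0 y, ⟨?_, ?_⟩, EuclideanGeometry.inversion_inversion _ one_ne_zero _⟩
    · rw [norm_inv0]; positivity
    · rw [norm_inv0]; exact inv_lt_one_of_one_lt₀ hy

theorem norm_sub_inv0 {e y : E N} (he : ‖e‖ = 1) (hy : y ≠ 0) :
    ‖e - inv0 y‖ = ‖e - y‖ / ‖y‖ := by
  have he0 : e ≠ 0 := by rw [← norm_ne_zero_iff, he]; exact one_ne_zero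
  have h := EuclideanGeometry.dist_inversion_inversion he0 hy 1
  have : EuclideanGeometry.inversion (0 : E N) 1 e = e :=
    EuclideanGeometry.inversion_of_mem_sphere (by simp [he])
  rw [this, dist_zero_right, dist_zero_right, he, dist_eq_norm, dist_eq_norm] at h
  rw [h]; ring

/-- The derivative of the inversion at `y` is a reflection scaled by `|y|⁻²`. -/
theorem abs_det_inv0 {y : E N} (hy : y ≠ 0) :
    |(((1 : ℝ) / dist y 0) ^ 2 • ((ℝ ∙ (y - 0))ᗮ.reflection : E N →L[ℝ] E N)).det|
      = (‖y‖ ^ (2 * N))⁻¹ := by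
  have h : (((1 : ℝ) / dist y 0) ^ 2 • ((ℝ ∙ (y - 0))ᗮ.reflection : E N →L[ℝ] E N)).det
      = ((1 / dist y 0) ^ 2) ^ N *
        LinearMap.det ((ℝ ∙ (y - 0))ᗮ.reflection : E N →L[ℝ] E N).toLinearMap := by
    rw [ContinuousLinearMap.det, ContinuousLinearMap.toLinearMap_smul, LinearMap.det_smul]
    simp
  have h2 : |LinearMap.det ((ℝ ∙ (y - 0))ᗮ.reflection : E N →L[ℝ] E N).toLinearMap| = 1 := by
    have := Submodule.det_reflection ((ℝ ∙ (y - 0))ᗮ)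
    have h3 : ((ℝ ∙ (y - 0))ᗮ.reflection : E N →L[ℝ] E N).toLinearMap
      = (ℝ ∙ (y - 0))ᗮ.reflection.toLinearMap := rfl
    rw [h3, this, abs_pow]; simp
  rw [h, abs_mul, h2, mul_one, ← pow_mul, abs_pow, dist_zero_right, one_div, abs_of_nonneg
    (by positivity), inv_pow]

theorem hasFDerivWithinAt_inv0 {y : E N} (hy : y ∈ punctured N) :
    HasFDerivWithinAt inv0
      (((1 : ℝ) / dist y 0) ^ 2 • ((ℝ ∙ (y - 0))ᗮ.reflection : E N →L[ℝ] E N))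
      (punctured N) y :=
  (EuclideanGeometry.hasFDerivAt_inversion (norm_pos_iff.1 hy.1)).hasFDerivWithinAt

theorem injOn_inv0 : InjOn inv0 (punctured N) :=
  (EuclideanGeometry.inversion_injective _ one_ne_zero).injOn

theorem integrableOn_outside_iff (f : E N → ℝ) :
    IntegrableOn f {y | 1 < ‖y‖} ↔
      IntegrableOn (fun y => (‖y‖ ^ (2 * N))⁻¹ * f (inv0 y)) (punctured N) := by
  rw [← image_inv0, integrableOn_image_iff_integrableOn_abs_det_fderiv_smul _
    measurableSet_punctured (fun y hy => hasFDerivWithinAt_inv0 hy) injOn_inv0]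
  refine integrableOn_congr_fun (fun y hy => ?_) measurableSet_punctured
  rw [abs_det_inv0 (norm_pos_iff.1 hy.1), smul_eq_mul]

theorem integral_outside (f : E N → ℝ) :
    ∫ y in {y | 1 < ‖y‖}, f y = ∫ y in punctured N, (‖y‖ ^ (2 * N))⁻¹ * f (inv0 y) := by
  rw [← image_inv0, integral_image_eq_integral_abs_det_fderiv_smul _
    measurableSet_punctured (fun y hy => hasFDerivWithinAt_inv0 hy) injOn_inv0]
  refine setIntegral_congr_fun measurableSet_punctured fun y hy => ?_
  rw [abs_det_inv0 (norm_pos_iff.1 hy.1), smul_eq_mul]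

theorem lintegral_outside (f : E N → ℝ≥0∞) :
    ∫⁻ y in {y | 1 < ‖y‖}, f y
      = ∫⁻ y in punctured N, ENNReal.ofReal (‖y‖ ^ (2 * N))⁻¹ * f (inv0 y) := by
  rw [← image_inv0, lintegral_image_eq_lintegral_abs_det_fderiv_mul _
    measurableSet_punctured (fun y hy => hasFDerivWithinAt_inv0 hy) injOn_inv0]
  refine setLIntegral_congr_fun measurableSet_punctured fun y hy => ?_
  rw [abs_det_inv0 (norm_pos_iff.1 hy.1)]

end FracHardy

namespace FracHardy

open scoped ENNReal

variable {N : ℕ} {s : ℝ}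

/-! ### Integrability of powers of the norm -/

theorem integrableOn_ball_rpow_norm [NeZero N] {p : ℝ} (hp : -(N : ℝ) < p) (R : ℝ) :
    IntegrableOn (fun x : E N => ‖x‖ ^ p) (Metric.ball 0 R) := by
  rcases le_or_gt R 0 with hR | hR
  · simp [Metric.ball_eq_empty.2 hR]
  rw [integrableOn_fun_norm_addHaar volume (f := fun r => r ^ p)]
  have h := (intervalIntegral.integrableOn_Ioo_rpow_iff (s := (N : ℝ) - 1 + p) hR).2 (by linarith)
  refine h.congr_fun (fun r hr => ?_) measurableSet_Ioo
  have hN : 1 ≤ N := NeZero.one_le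
  simp only [finrank_euclideanSpace, Fintype.card_fin, smul_eq_mul]
  rw [Real.rpow_add hr.1, ← Real.rpow_natCast, Nat.cast_sub hN, Nat.cast_one]

theorem integrable_rpow_norm_mul_one_add [NeZero N] {p q : ℝ} (hp : -(N : ℝ) < p)
    (hpq : p + q < -N) (hq : q ≤ 0) :
    Integrable (fun x : E N => ‖x‖ ^ p * (1 + ‖x‖) ^ q) := by
  have hm : Measurable fun x : E N => ‖x‖ ^ p * (1 + ‖x‖) ^ q := by fun_prop
  rw [integrable_fun_norm_addHaar volume (f := fun r => r ^ p * (1 + r) ^ q)]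
  have hN : 1 ≤ N := NeZero.one_le
  have key : ∀ r : ℝ, 0 < r → r ^ (Module.finrank ℝ (E N) - 1) • (r ^ p * (1 + r) ^ q)
      = r ^ ((N : ℝ) - 1 + p) * (1 + r) ^ q := by
    intro r hr
    simp only [finrank_euclideanSpace, Fintype.card_fin, smul_eq_mul]
    rw [Real.rpow_add hr, ← Real.rpow_natCast, Nat.cast_sub hN, Nat.cast_one, mul_assoc]
  rw [integrableOn_congr_fun (fun r (hr : r ∈ Ioi (0 : ℝ)) => key r hr) measurableSet_Ioi,
    ← Ioc_union_Ioi_eq_Ioi zero_le_one, integrableOn_union]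
  constructor
  · rw [integrableOn_Ioc_iff_integrableOn_Ioo]
    have h := (intervalIntegral.integrableOn_Ioo_rpow_iff (s := (N : ℝ) - 1 + p) one_pos).2
      (by linarith)
    refine Integrable.mono' h (by fun_prop) ?_
    filter_upwards [ae_restrict_mem measurableSet_Ioo] with r hr
    have hr0 : 0 < r := hr.1
    rw [Real.norm_of_nonneg (by positivity)]
    exact mul_le_of_le_one_right (by positivity)
      (Real.rpow_le_one_of_one_le_of_nonpos (by linarith) hq)
  · have h := integrableOn_Ioi_rpow_of_lt (a := (N : ℝ) - 1 + p + q) (c := 1) (by linarith) one_pos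
    refine Integrable.mono' h (by fun_prop) ?_
    filter_upwards [ae_restrict_mem measurableSet_Ioi] with r hr
    have hr0 : 0 < r := one_pos.trans hr
    rw [Real.norm_of_nonneg (by positivity), Real.rpow_add hr0 _ q]
    exact mul_le_mul_of_nonneg_left (Real.rpow_le_rpow_of_nonpos hr0 (by linarith) hq)
      (Real.rpow_nonneg hr0.le _)

theorem le_norm_sub_of_notMem_ball {x z : E N} {ε : ℝ} (hε : 0 < ε)
    (hz : z ∈ (Metric.ball x ε)ᶜ) : ε / (1 + ‖x‖ + ε) * (1 + ‖z‖) ≤ ‖x - z‖ := by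
  have h1 : ε ≤ ‖x - z‖ := by
    rw [norm_sub_rev]; simpa [dist_eq_norm] using hz
  have h2 : ‖z‖ ≤ ‖x‖ + ‖x - z‖ := by
    have := norm_sub_norm_le z x
    rw [norm_sub_rev] at this; linarith
  have h3 := norm_nonneg x
  rw [div_mul_eq_mul_div, div_le_iff₀ (by positivity)]
  nlinarith

theorem integrableOn_rpow_norm_div [NeZero N] {p κ : ℝ} (hp : -(N : ℝ) < p)
    (hpκ : p + N < κ) (hκ : 0 ≤ κ) (x : E N) {ε : ℝ} (hε : 0 < ε) :
    IntegrableOn (fun z : E N => ‖z‖ ^ p / ‖x - z‖ ^ κ) (Metric.ball x ε)ᶜ := by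
  have h := (integrable_rpow_norm_mul_one_add (N := N) (q := -κ) hp (by linarith)
    (neg_nonpos.2 hκ)).const_mul ((ε / (1 + ‖x‖ + ε)) ^ (-κ))
  refine Integrable.mono' h.integrableOn
    (by fun_prop : Measurable fun z : E N => ‖z‖ ^ p / ‖x - z‖ ^ κ).aestronglyMeasurable ?_
  filter_upwards [ae_restrict_mem measurableSet_ball.compl] with z hz
  have h1 := le_norm_sub_of_notMem_ball hε hz
  have hc : 0 < ε / (1 + ‖x‖ + ε) := by positivity
  have hz0 : 0 < 1 + ‖z‖ := by positivity
  rw [Real.norm_of_nonneg (by positivity), div_eq_mul_inv, ← Real.rpow_neg (norm_nonneg _)]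
  calc ‖z‖ ^ p * ‖x - z‖ ^ (-κ)
      ≤ ‖z‖ ^ p * (ε / (1 + ‖x‖ + ε) * (1 + ‖z‖)) ^ (-κ) := by
        gcongr ?_ * ?_
        exact Real.rpow_le_rpow_of_nonpos (by positivity) h1 (by linarith)
    _ = _ := by rw [Real.mul_rpow hc.le hz0.le]; ring

theorem integrableOn_ball_rpow_norm_sub [NeZero N] {p : ℝ} (hp : -(N : ℝ) < p) (x : E N)
    (R : ℝ) : IntegrableOn (fun z : E N => ‖x - z‖ ^ p) (Metric.ball x R) := by
  have h := (integrable_indicator_iff measurableSet_ball).2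
    (integrableOn_ball_rpow_norm (N := N) hp R)
  have h2 := h.comp_sub_left x
  rw [← integrable_indicator_iff measurableSet_ball]
  refine h2.congr (Eventually.of_forall fun z => ?_)
  simp only [indicator, Metric.mem_ball, dist_eq_norm, sub_zero, norm_sub_rev x z]

/-! ### Elementary estimates for powers -/

theorem exists_rpow_lipschitz (τ : ℝ) :
    ∃ D : ℝ, 0 ≤ D ∧ ∀ x ∈ Icc (1 / 2 : ℝ) 2, ∀ y ∈ Icc (1 / 2 : ℝ) 2,
      |x ^ τ - y ^ τ| ≤ D * |x - y| := by
  have hc : ContDiffOn ℝ 1 (fun x : ℝ => x ^ τ) (Icc (1 / 2 : ℝ) 2) := fun x hx =>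
    (Real.contDiffAt_rpow_const_of_ne (by linarith [hx.1] : x ≠ 0)).contDiffWithinAt
  obtain ⟨K, hK⟩ := hc.exists_lipschitzOnWith one_ne_zero (convex_Icc _ _) isCompact_Icc
  refine ⟨K, K.2, fun x hx y hy => ?_⟩
  simpa [Real.dist_eq] using hK.dist_le_mul x hx y hy

theorem abs_log_le_two_mul {x : ℝ} (hx : x ∈ Icc (1 / 2 : ℝ) 2) :
    |Real.log x| ≤ 2 * |1 - x| := by
  have hx0 : 0 < x := by linarith [hx.1]
  have h1 := Real.log_le_sub_one_of_pos hx0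
  have h2 := Real.one_sub_inv_le_log_of_pos hx0
  have h3 : |1 - x⁻¹| ≤ 2 * |1 - x| := by
    have : 1 - x⁻¹ = -(x⁻¹ * (1 - x)) := by field_simp; ring
    rw [this, abs_neg, abs_mul, abs_of_pos (inv_pos.2 hx0)]
    gcongr
    rw [inv_le_comm₀ hx0 two_pos]; linarith [hx.1]
  rw [abs_le]
  constructor
  · linarith [neg_abs_le (1 - x⁻¹)]
  · have := neg_abs_le (1 - x)
    have := abs_nonneg (1 - x)
    linarith

theorem abs_log_le_rpow_add_rpow {δ : ℝ} (hδ : 0 < δ) {x : ℝ} (hx : 0 < x) :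
    |Real.log x| ≤ δ⁻¹ * (x ^ δ + x ^ (-δ)) := by
  have h1 := Real.log_le_rpow_div hx.le hδ
  have h2 := Real.log_le_rpow_div (inv_pos.2 hx).le hδ
  rw [Real.log_inv, Real.inv_rpow hx.le, ← Real.rpow_neg hx.le] at h2
  have h3 : 0 < x ^ δ / δ := by positivity
  have h4 : 0 < x ^ (-δ) / δ := by positivity
  have : δ⁻¹ * (x ^ δ + x ^ (-δ)) = x ^ δ / δ + x ^ (-δ) / δ := by ring
  rw [this, abs_le]
  constructor <;> linarith

/-! ### The fractional Laplacian of a radial function at a unit vector -/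

/-- The sum of the value at `σ` of `g(1) - g` and of its Kelvin reflection. -/
noncomputable def kelvinSum (N : ℕ) (s : ℝ) (g : ℝ → ℝ) (σ : ℝ) : ℝ :=
  g 1 - g σ + σ ^ (2 * s - N) * (g 1 - g σ⁻¹)

/-- The regularity and growth of a radial profile `g` under which the fractional Laplacian of
`g(|x|)` exists at the unit vectors and is given by an absolutely convergent integral over the unit
ball. -/
structure RadialProfile (N : ℕ) (s : ℝ) (g : ℝ → ℝ) : Prop where
  measurable : Measurable g
  growth : ∃ D p q : ℝ, -(N : ℝ) < p ∧ p < 2 * s ∧ -(N : ℝ) < q ∧ q < 2 * s ∧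
    ∀ σ : ℝ, 0 < σ → |g σ| ≤ D * (σ ^ p + σ ^ q)
  lipschitz : ∃ D : ℝ, 0 ≤ D ∧ ∀ σ ∈ Icc (1 / 2 : ℝ) 2, |g 1 - g σ| ≤ D * |1 - σ|
  quadratic : ∃ D : ℝ, 0 ≤ D ∧ ∀ σ ∈ Icc (1 / 2 : ℝ) 1, |kelvinSum N s g σ| ≤ D * (1 - σ) ^ 2

theorem kappa_pos [NeZero N] (hs : 0 < s) : 1 < (N : ℝ) + 2 * s := by
  have : (1 : ℝ) ≤ N := by exact_mod_cast NeZero.one_le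
  linarith

theorem ae_ne_zero [NeZero N] : ∀ᵐ z : E N, z ≠ 0 := by
  simp [ae_iff]

namespace RadialProfile

variable [NeZero N] {g : ℝ → ℝ}

theorem integrableOn_compl_ball (hg : RadialProfile N s g) (hs : 0 < s) {ε : ℝ} (hε : 0 < ε)
    (c : ℝ) (x : E N) :
    IntegrableOn (fun z : E N => (c - g ‖z‖) / ‖x - z‖ ^ ((N : ℝ) + 2 * s))
      (Metric.ball x ε)ᶜ := by
  obtain ⟨D, p, q, hp, hp', hq, hq', hD⟩ := hg.growth
  have hm := hg.measurable
  have hκ := kappa_pos (N := N) hs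
  have hN : (1 : ℝ) ≤ N := by exact_mod_cast NeZero.one_le
  have h0 := integrableOn_rpow_norm_div (N := N) (p := 0) (κ := N + 2 * s) (by linarith)
    (by linarith) (by linarith) x hε
  have h1 := integrableOn_rpow_norm_div (κ := N + 2 * s) hp (by linarith) (by linarith)
    x hε
  have h2 := integrableOn_rpow_norm_div (κ := N + 2 * s) hq (by linarith) (by linarith)
    x hε
  refine Integrable.mono' ((h0.const_mul |c|).add ((h1.add h2).const_mul D))
    (by fun_prop : Measurable _).aestronglyMeasurable ?_
  filter_upwards [ae_restrict_of_ae ae_ne_zero] with z hz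
  have h := hD ‖z‖ (norm_pos_iff.2 hz)
  simp only [Pi.add_apply, Real.rpow_zero]
  rw [norm_div, Real.norm_of_nonneg (by positivity : 0 ≤ ‖x - z‖ ^ ((N : ℝ) + 2 * s)),
    mul_div_assoc', ← add_div, mul_div_assoc', ← add_div, mul_one]
  gcongr
  exact (norm_sub_le _ _).trans (add_le_add le_rfl h)

end RadialProfile

/-- The contribution of the outside of the unit ball to the fractional Laplacian of `g(|x|)`,
pulled back to the unit ball by inversion. -/
noncomputable def reflectedKernel (N : ℕ) (s : ℝ) (g : ℝ → ℝ) (y : E N) : ℝ :=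
  ‖y‖ ^ (2 * s - N) * (g 1 - g ‖y‖⁻¹) / ‖e1 N - y‖ ^ ((N : ℝ) + 2 * s)

/-- The Jacobian `|y|^(-2N)` of the inversion and the conformal factor of `|e₁ - y|` combine to the Kelvin
weight `|y|^(2s-N)`. -/
theorem inversion_weight [NeZero N] {y : E N} (hy : y ≠ 0) (a : ℝ) :
    (‖y‖ ^ (2 * N))⁻¹ * (a / ‖e1 N - inv0 y‖ ^ ((N : ℝ) + 2 * s))
      = ‖y‖ ^ (2 * s - N) * a / ‖e1 N - y‖ ^ ((N : ℝ) + 2 * s) := by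
  have hy0 : 0 < ‖y‖ := norm_pos_iff.2 hy
  rw [norm_sub_inv0 norm_e1 hy, Real.div_rpow (norm_nonneg _) (norm_nonneg _)]
  have : ‖y‖ ^ (2 * s - N) = (‖y‖ ^ (2 * N))⁻¹ * ‖y‖ ^ ((N : ℝ) + 2 * s) := by
    rw [← Real.rpow_natCast, ← Real.rpow_neg (norm_nonneg _), ← Real.rpow_add hy0]
    congr 1; push_cast; ring
  rw [this]
  by_cases h : ‖e1 N - y‖ ^ ((N : ℝ) + 2 * s) = 0
  · simp [h]
  · have h2 : ‖y‖ ^ ((N : ℝ) + 2 * s) ≠ 0 := by positivity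
    field_simp

theorem mem_compl_ball_e1 {ε : ℝ} {z : E N} :
    z ∈ (Metric.ball (e1 N) ε)ᶜ ↔ ε ≤ ‖e1 N - z‖ := by
  simp [dist_eq_norm, norm_sub_rev]

theorem inv0_mem_compl_ball [NeZero N] {ε : ℝ} {y : E N} (hy : y ≠ 0) :
    inv0 y ∈ (Metric.ball (e1 N) ε)ᶜ ↔ ε * ‖y‖ ≤ ‖e1 N - y‖ := by
  rw [mem_compl_ball_e1, norm_sub_inv0 norm_e1 hy, le_div_iff₀ (norm_pos_iff.2 hy)]

theorem ae_norm_ne_one [NeZero N] : ∀ᵐ z : E N, ‖z‖ ≠ 1 := by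
  have := Measure.addHaar_sphere (volume : Measure (E N)) 0 1
  rw [ae_iff]
  simpa [Metric.sphere] using this

theorem setIntegral_split_unit [NeZero N] {f : E N → ℝ} {S : Set (E N)} (hS : MeasurableSet S)
    (hf : IntegrableOn f S) :
    ∫ z in S, f z = (∫ z in punctured N, S.indicator f z) + ∫ z in {z | 1 < ‖z‖}, S.indicator f z
    := by
  have hi : Integrable (S.indicator f) := (integrable_indicator_iff hS).2 hf
  have hd : Disjoint (punctured N) {z : E N | 1 < ‖z‖} := by
    rw [Set.disjoint_left]
    intro z hz hz'
    exact absurd hz.2 (not_lt.2 (le_of_lt hz'))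
  rw [← integral_indicator hS, ← setIntegral_union hd
    (measurableSet_lt measurable_const measurable_norm) hi.integrableOn hi.integrableOn,
    ← setIntegral_univ]
  refine setIntegral_congr_set ?_
  filter_upwards [ae_norm_ne_one (N := N), ae_ne_zero (N := N)] with z h1 h0
  have h0 : 0 < ‖z‖ := norm_pos_iff.2 h0
  apply propext
  simp only [Set.univ]
  constructor
  · intro _
    rcases lt_or_gt_of_ne h1 with h | h
    · exact Or.inl ⟨h0, h⟩
    · exact Or.inr h
  · intro _; trivial

end FracHardy

namespace FracHardy

open scoped ENNReal

variable {N : ℕ} {s : ℝ}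

theorem norm_mem_Icc_of_near_e1 [NeZero N] {y : E N} (h : ‖e1 N - y‖ ≤ 1 / 2) (h1 : ‖y‖ < 1) :
    ‖y‖ ∈ Icc (1 / 2 : ℝ) 1 := by
  have := norm_sub_norm_le (e1 N) y
  rw [norm_e1] at this
  exact ⟨by linarith, h1.le⟩

theorem one_sub_norm_le [NeZero N] (y : E N) : |1 - ‖y‖| ≤ ‖e1 N - y‖ := by
  have := abs_norm_sub_norm_le (e1 N) y
  rwa [norm_e1] at this

theorem volume_shell_le [NeZero N] (x : E N) {ε : ℝ} (h0 : 0 ≤ ε) (h1 : ε ≤ 1) :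
    volume.real (Metric.ball x ε \ Metric.ball x (ε * (1 - ε)))
      ≤ N * ε ^ (N + 1) * volume.real (Metric.ball (0 : E N) 1) := by
  have hsub : Metric.ball x (ε * (1 - ε)) ⊆ Metric.ball x ε :=
    Metric.ball_subset_ball (by nlinarith)
  rw [measureReal_sdiff hsub measurableSet_ball, Measure.real, Measure.real,
    Measure.addHaar_ball _ _ h0,
    Measure.addHaar_ball _ _ (mul_nonneg h0 (by linarith)), ENNReal.toReal_mul,
    ENNReal.toReal_mul, ENNReal.toReal_ofReal (by positivity), ENNReal.toReal_ofReal
    (pow_nonneg (mul_nonneg h0 (by linarith)) _), ← sub_mul, finrank_euclideanSpace,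
    Fintype.card_fin]
  have hb := one_add_mul_le_pow (a := -ε) (by linarith) N
  have : ε ^ N - (ε * (1 - ε)) ^ N ≤ N * ε ^ (N + 1) := by
    rw [mul_pow, pow_succ]
    have := mul_le_mul_of_nonneg_left hb (pow_nonneg h0 N)
    rw [← sub_eq_add_neg] at this
    nlinarith
  exact mul_le_mul_of_nonneg_right this ENNReal.toReal_nonneg

namespace RadialProfile

variable {g : ℝ → ℝ}

theorem measurable_kelvinSum (hg : RadialProfile N s g) : Measurable (kelvinSum N s g) := by
  have hm := hg.measurable
  unfold kelvinSum
  fun_prop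

theorem indicator_outside_eq [NeZero N] (ε : ℝ) {y : E N} (hy : y ∈ punctured N) :
    (‖y‖ ^ (2 * N))⁻¹ * (Metric.ball (e1 N) ε)ᶜ.indicator
        (fun z : E N => (g 1 - g ‖z‖) / ‖e1 N - z‖ ^ ((N : ℝ) + 2 * s)) (inv0 y)
      = {y : E N | ε * ‖y‖ ≤ ‖e1 N - y‖}.indicator (reflectedKernel N s g) y := by
  have hy0 : y ≠ 0 := norm_pos_iff.1 hy.1
  have hiff := inv0_mem_compl_ball (ε := ε) hy0
  by_cases h : ε * ‖y‖ ≤ ‖e1 N - y‖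
  · rw [indicator_of_mem (hiff.2 h), indicator_of_mem (by exact h), inversion_weight hy0,
      reflectedKernel, norm_inv0]
  · rw [indicator_of_notMem (fun h' => h (hiff.1 h')), indicator_of_notMem (by exact h), mul_zero]

theorem measurableSet_reflected (ε : ℝ) : MeasurableSet {y : E N | ε * ‖y‖ ≤ ‖e1 N - y‖} :=
  measurableSet_le (by fun_prop) (by fun_prop)

variable [NeZero N]

theorem integrableOn_reflected (hg : RadialProfile N s g) (hs : 0 < s) {ε : ℝ} (hε : 0 < ε) :
    IntegrableOn ({y : E N | ε * ‖y‖ ≤ ‖e1 N - y‖}.indicator (reflectedKernel N s g))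
      (punctured N) := by
  have h := (integrable_indicator_iff measurableSet_ball.compl).2
    (hg.integrableOn_compl_ball hs hε (g 1) (e1 N))
  have h2 := (integrableOn_outside_iff _).1 (h.integrableOn (s := {y : E N | 1 < ‖y‖}))
  exact h2.congr_fun (fun y hy => indicator_outside_eq ε hy) measurableSet_punctured

theorem integrableOn_kelvinSum (hg : RadialProfile N s g) (hs0 : 0 < s) (hs1 : s < 1) :
    IntegrableOn (fun y : E N => kelvinSum N s g ‖y‖ / ‖e1 N - y‖ ^ ((N : ℝ) + 2 * s))
      (punctured N) := by
  obtain ⟨D, hD0, hD⟩ := hg.quadratic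
  have hm := hg.measurable_kelvinSum
  have hmm : Measurable fun y : E N =>
      kelvinSum N s g ‖y‖ / ‖e1 N - y‖ ^ ((N : ℝ) + 2 * s) := by fun_prop
  rw [← inter_union_sdiff (punctured N) (Metric.ball (e1 N) (1 / 2)), integrableOn_union]
  constructor
  · have h := (integrableOn_ball_rpow_norm_sub (N := N) (p := 2 - ((N : ℝ) + 2 * s))
      (by linarith) (e1 N) (1 / 2)).const_mul D
    refine Integrable.mono' (IntegrableOn.mono_set h inter_subset_right) hmm.aestronglyMeasurable ?_
    filter_upwards [ae_restrict_mem (measurableSet_punctured.inter measurableSet_ball)] with y hy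
    have hyn : ‖e1 N - y‖ < 1 / 2 := by
      have := hy.2; rwa [Metric.mem_ball, dist_eq_norm, norm_sub_rev] at this
    have hyI := norm_mem_Icc_of_near_e1 hyn.le hy.1.2
    have hpos : 0 < ‖e1 N - y‖ := lt_of_lt_of_le (abs_pos.2 (by linarith [hy.1.2]))
      (one_sub_norm_le y)
    rw [Real.rpow_sub hpos, norm_div, Real.norm_of_nonneg (by positivity : 0 ≤ ‖e1 N - y‖ ^ ((N : ℝ) + 2 * s)),
      mul_div_assoc']
    gcongr
    refine (hD _ hyI).trans ?_
    rw [Real.rpow_two, ← sq_abs (1 - ‖y‖)]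
    gcongr
    exact one_sub_norm_le y
  · have h1 := (integrable_indicator_iff measurableSet_ball.compl).2
      (hg.integrableOn_compl_ball hs0 (by norm_num : (0 : ℝ) < 1 / 2) (g 1) (e1 N))
    have h2 := hg.integrableOn_reflected hs0 (by norm_num : (0 : ℝ) < 1 / 2)
    refine (((h1.integrableOn (s := punctured N)).add h2).mono_set sdiff_subset).congr_fun
      (fun y hy => ?_) (measurableSet_punctured.diff measurableSet_ball)
    have hy2 : y ∈ (Metric.ball (e1 N) (1 / 2))ᶜ := hy.2
    have hy3 := mem_compl_ball_e1.1 hy2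
    have hy4 : 1 / 2 * ‖y‖ ≤ ‖e1 N - y‖ := by linarith [hy.1.2]
    rw [Pi.add_apply, indicator_of_mem hy2, indicator_of_mem (by exact hy4), reflectedKernel,
      ← add_div, kelvinSum]

/-- Inversion carries the outside part of the truncated integral to the region `ε|y| ≤ |e₁ - y|` of
the unit ball. Up to the shell between this region and the ball of radius `ε` about `e₁`, the
truncated integral is therefore an integral of `kelvinSum` over the unit ball. -/
theorem setIntegral_compl_ball_eq (hg : RadialProfile N s g) (hs0 : 0 < s) (hs1 : s < 1) {ε : ℝ}
    (hε : 0 < ε) :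
    ∫ z in (Metric.ball (e1 N) ε)ᶜ, (g 1 - g ‖z‖) / ‖e1 N - z‖ ^ ((N : ℝ) + 2 * s)
      = (∫ y in punctured N, (Metric.ball (e1 N) ε)ᶜ.indicator
          (fun y => kelvinSum N s g ‖y‖ / ‖e1 N - y‖ ^ ((N : ℝ) + 2 * s)) y)
        + ∫ y in punctured N, ({y : E N | ε * ‖y‖ ≤ ‖e1 N - y‖} ∩ Metric.ball (e1 N) ε).indicator
            (reflectedKernel N s g) y := by
  have h1 := (integrable_indicator_iff measurableSet_ball.compl).2
    (hg.integrableOn_compl_ball hs0 hε (g 1) (e1 N))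
  have h2 := hg.integrableOn_reflected hs0 hε
  have h3 := hg.integrableOn_kelvinSum hs0 hs1
  have h4 : IntegrableOn (({y : E N | ε * ‖y‖ ≤ ‖e1 N - y‖} ∩ Metric.ball (e1 N) ε).indicator
      (reflectedKernel N s g)) (punctured N) := by
    rw [inter_comm, ← indicator_indicator]
    exact h2.indicator measurableSet_ball
  rw [setIntegral_split_unit measurableSet_ball.compl
    (hg.integrableOn_compl_ball hs0 hε (g 1) (e1 N)), integral_outside,
    ← integral_add (h3.indicator measurableSet_ball.compl) h4,
    setIntegral_congr_fun measurableSet_punctured (fun y hy => indicator_outside_eq ε hy),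
    ← integral_add h1.integrableOn h2]
  refine setIntegral_congr_fun measurableSet_punctured fun y hy => ?_
  by_cases hy2 : y ∈ (Metric.ball (e1 N) ε)ᶜ
  · have hy3 := mem_compl_ball_e1.1 hy2
    have hy4 : ε * ‖y‖ ≤ ‖e1 N - y‖ :=
      (mul_le_of_le_one_right hε.le hy.2.le).trans hy3
    have hy5 : y ∉ {y : E N | ε * ‖y‖ ≤ ‖e1 N - y‖} ∩ Metric.ball (e1 N) ε := fun h => hy2 h.2
    simp only [indicator_of_mem hy2, indicator_of_notMem hy5]
    rw [indicator_of_mem (by exact hy4), reflectedKernel, ← add_div, kelvinSum, add_zero]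
  · simp only [indicator_of_notMem hy2, zero_add]
    have hb : y ∈ Metric.ball (e1 N) ε := by simpa using hy2
    by_cases hy4 : ε * ‖y‖ ≤ ‖e1 N - y‖
    · have hmem : y ∈ {y : E N | ε * ‖y‖ ≤ ‖e1 N - y‖} ∩ Metric.ball (e1 N) ε := ⟨hy4, hb⟩
      rw [indicator_of_mem (by exact hy4), indicator_of_mem hmem]
    · rw [indicator_of_notMem (by exact hy4), indicator_of_notMem (fun h => hy4 h.1)]

theorem exists_reflectedKernel_le (hg : RadialProfile N s g) :
    ∃ D : ℝ, 0 ≤ D ∧ ∀ y : E N, ‖y‖ ∈ Icc (1 / 2 : ℝ) 1 →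
      |reflectedKernel N s g y| ≤ D * (‖e1 N - y‖ / ‖e1 N - y‖ ^ ((N : ℝ) + 2 * s)) := by
  obtain ⟨D, hD0, hD⟩ := hg.lipschitz
  obtain ⟨D', hD0', hD'⟩ := exists_rpow_lipschitz (2 * s - N)
  refine ⟨(1 + D') * (D * 2), by positivity, fun y hy => ?_⟩
  have hy0 : 0 < ‖y‖ := by linarith [hy.1]
  have hI : ‖y‖⁻¹ ∈ Icc (1 / 2 : ℝ) 2 := by
    have h1 := one_le_inv_iff₀.2 ⟨hy0, hy.2⟩
    refine ⟨by linarith, ?_⟩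
    rw [inv_le_comm₀ hy0 two_pos]; linarith [hy.1]
  have h1 := hD _ hI
  have h2 : |1 - ‖y‖⁻¹| ≤ 2 * ‖e1 N - y‖ := by
    have : 1 - ‖y‖⁻¹ = -(‖y‖⁻¹ * (1 - ‖y‖)) := by field_simp; ring
    rw [this, abs_neg, abs_mul, abs_of_pos (inv_pos.2 hy0)]
    exact mul_le_mul hI.2 (one_sub_norm_le y) (abs_nonneg _) (by norm_num)
  have h3 : |‖y‖ ^ (2 * s - N)| ≤ 1 + D' := by
    have h := hD' ‖y‖ ⟨hy.1, by linarith [hy.2]⟩ 1 (by norm_num)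
    rw [Real.one_rpow] at h
    have h4 : |‖y‖ - 1| ≤ 1 := by rw [abs_le]; constructor <;> linarith [hy.1, hy.2]
    have h5 := abs_sub_abs_le_abs_sub (‖y‖ ^ (2 * s - N)) 1
    rw [abs_one] at h5
    nlinarith
  rw [reflectedKernel, abs_div, abs_mul,
    abs_of_nonneg (by positivity : 0 ≤ ‖e1 N - y‖ ^ ((N : ℝ) + 2 * s)), mul_div_assoc']
  refine div_le_div_of_nonneg_right ?_ (by positivity)
  calc |‖y‖ ^ (2 * s - N)| * |g 1 - g ‖y‖⁻¹| ≤ (1 + D') * (D * (2 * ‖e1 N - y‖)) := by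
        gcongr
        exact h1.trans (by gcongr)
    _ = _ := by ring

/-- The shell lies between the spheres of radii `ε (1 - ε)` and `ε` about `e₁`, so its volume is
`O(ε^(N+1))`; the integrand is `O(ε^(1-N-2s))` there, and the product `O(ε^(2-2s))` tends to zero. -/
theorem tendsto_shell (hg : RadialProfile N s g) (hs0 : 0 < s) (hs1 : s < 1) :
    Tendsto (fun ε : ℝ => ∫ y in punctured N,
      ({y : E N | ε * ‖y‖ ≤ ‖e1 N - y‖} ∩ Metric.ball (e1 N) ε).indicator
            (reflectedKernel N s g) y) (𝓝[>] 0) (𝓝 0) := by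
  obtain ⟨D, hD0, hD⟩ := hg.exists_reflectedKernel_le
  have hκ := kappa_pos (N := N) hs0
  set V := volume.real (Metric.ball (0 : E N) 1)
  have hlim : Tendsto (fun ε : ℝ => D * 2 ^ ((N : ℝ) + 2 * s - 1) * N * V * ε ^ (2 - 2 * s))
      (𝓝[>] 0) (𝓝 0) := by
    have h : Tendsto (fun ε : ℝ => ε ^ (2 - 2 * s)) (𝓝[>] 0) (𝓝 0) := by
      have := (Real.continuousAt_rpow_const 0 (2 - 2 * s) (Or.inr (by linarith))).tendsto
      rw [Real.zero_rpow (by linarith)] at this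
      exact this.mono_left nhdsWithin_le_nhds
    simpa using h.const_mul (D * 2 ^ ((N : ℝ) + 2 * s - 1) * N * V)
  refine squeeze_zero_norm' ?_ hlim
  have hIoo : Ioo (0 : ℝ) (1 / 2) ∈ 𝓝[>] (0 : ℝ) := Ioo_mem_nhdsGT (by norm_num)
  filter_upwards [hIoo] with ε hε
  have hε0 : 0 < ε := hε.1
  set A := ({y : E N | ε * ‖y‖ ≤ ‖e1 N - y‖} ∩ Metric.ball (e1 N) ε)
  have hA : MeasurableSet A := (measurableSet_reflected ε).inter measurableSet_ball
  rw [setIntegral_indicator hA]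
  have hsub : punctured N ∩ A ⊆ Metric.ball (e1 N) ε \ Metric.ball (e1 N) (ε * (1 - ε)) := by
    intro y hy
    refine ⟨hy.2.2, fun h => ?_⟩
    have h1 : ‖e1 N - y‖ < ε := by
      have := hy.2.2; rwa [Metric.mem_ball, dist_eq_norm, norm_sub_rev] at this
    have h2 : ‖e1 N - y‖ < ε * (1 - ε) := by
      rwa [Metric.mem_ball, dist_eq_norm, norm_sub_rev] at h
    have h3 := (abs_le.1 (one_sub_norm_le y)).2
    have h4 : ε * ‖y‖ ≤ ‖e1 N - y‖ := hy.2.1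
    nlinarith
  have hfin : volume (Metric.ball (e1 N) ε \ Metric.ball (e1 N) (ε * (1 - ε))) < ⊤ :=
    (measure_mono sdiff_subset).trans_lt measure_ball_lt_top
  have hbound : ∀ y ∈ punctured N ∩ A,
      ‖reflectedKernel N s g y‖ ≤ D * (ε / 2) ^ (1 - ((N : ℝ) + 2 * s)) := by
    intro y hy
    have h1 : ‖e1 N - y‖ < ε := by
      have := hy.2.2; rwa [Metric.mem_ball, dist_eq_norm, norm_sub_rev] at this
    have h4 : ε * ‖y‖ ≤ ‖e1 N - y‖ := hy.2.1
    have hI := norm_mem_Icc_of_near_e1 (by linarith [hε.2]) hy.1.2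
    have h5 : ε / 2 ≤ ‖e1 N - y‖ := by nlinarith [hI.1]
    have hpos : 0 < ‖e1 N - y‖ := by linarith
    refine (hD y hI).trans ?_
    gcongr
    rw [show ‖e1 N - y‖ / ‖e1 N - y‖ ^ ((N : ℝ) + 2 * s)
      = ‖e1 N - y‖ ^ (1 - ((N : ℝ) + 2 * s)) by rw [Real.rpow_sub hpos, Real.rpow_one]]
    exact Real.rpow_le_rpow_of_nonpos (by linarith) h5 (by linarith)
  refine (norm_setIntegral_le_of_norm_le_const ((measure_mono hsub).trans_lt hfin) hbound).trans ?_
  have hvol := (measureReal_mono hsub hfin.ne).trans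
    (volume_shell_le (e1 N) hε0.le (by linarith [hε.2]))
  calc D * (ε / 2) ^ (1 - ((N : ℝ) + 2 * s)) * volume.real (punctured N ∩ A)
      ≤ D * (ε / 2) ^ (1 - ((N : ℝ) + 2 * s)) * (N * ε ^ (N + 1) * V) := by gcongr
    _ = _ := by
        have e1 : (ε / 2) ^ (1 - ((N : ℝ) + 2 * s))
            = ε ^ (1 - ((N : ℝ) + 2 * s)) * 2 ^ ((N : ℝ) + 2 * s - 1) := by
          rw [Real.div_rpow hε0.le two_pos.le, div_eq_mul_inv, ← Real.rpow_neg two_pos.le]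
          congr 2; ring
        have e2 : ε ^ (2 - 2 * s) = ε ^ (1 - ((N : ℝ) + 2 * s)) * ε ^ (N + 1) := by
          rw [← Real.rpow_natCast, ← Real.rpow_add hε0]
          congr 1; push_cast; ring
        rw [e1, e2]; ring

/-- The fractional Laplacian of `g(|x|)` at `e₁`: folding the outside of the unit ball onto the
ball by inversion turns the principal value into an absolutely convergent integral. -/
theorem hasFracLap_e1 (hg : RadialProfile N s g) (hs0 : 0 < s) (hs1 : s < 1) :
    HasFracLap s (fun _ => 1) (fun z : E N => g ‖z‖) (e1 N)
      (fracConst N s * ∫ y in punctured N,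
        kelvinSum N s g ‖y‖ / ‖e1 N - y‖ ^ ((N : ℝ) + 2 * s)) := by
  have hk : fracKernel s (fun _ => 1) (fun z : E N => g ‖z‖) (e1 N)
      = fun z => (g 1 - g ‖z‖) / ‖e1 N - z‖ ^ ((N : ℝ) + 2 * s) := by
    funext z
    simp [fracKernel, norm_e1]
  refine ⟨fun ε hε => ?_, ?_⟩
  · rw [hk]
    exact hg.integrableOn_compl_ball hs0 hε (g 1) (e1 N)
  · unfold fracTrunc
    refine Tendsto.const_mul _ ?_
    rw [hk]
    have hlim : Tendsto (fun ε : ℝ => ∫ y in punctured N, (Metric.ball (e1 N) ε)ᶜ.indicator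
          (fun y => kelvinSum N s g ‖y‖ / ‖e1 N - y‖ ^ ((N : ℝ) + 2 * s)) y) (𝓝[>] 0)
        (𝓝 (∫ y in punctured N, kelvinSum N s g ‖y‖ / ‖e1 N - y‖ ^ ((N : ℝ) + 2 * s))) := by
      have hi := hg.integrableOn_kelvinSum hs0 hs1
      refine tendsto_integral_filter_of_dominated_convergence _ ?_ ?_ hi.norm ?_
      · exact Eventually.of_forall fun ε =>
          (hi.indicator measurableSet_ball.compl).aestronglyMeasurable
      · exact Eventually.of_forall fun ε => Eventually.of_forall fun y => norm_indicator_le_norm_self _ _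
      · filter_upwards [ae_restrict_mem measurableSet_punctured] with y hy
        have hpos : 0 < ‖e1 N - y‖ := lt_of_lt_of_le (abs_pos.2 (by linarith [hy.2]))
          (one_sub_norm_le y)
        refine tendsto_const_nhds.congr' ?_
        filter_upwards [Ioo_mem_nhdsGT hpos] with ε hε
        rw [indicator_of_mem (mem_compl_ball_e1.2 hε.2.le)]
    have := hlim.add (hg.tendsto_shell hs0 hs1)
    rw [add_zero] at this
    refine this.congr' ?_
    filter_upwards [self_mem_nhdsWithin] with ε hε
    exact (hg.setIntegral_compl_ball_eq hs0 hs1 hε).symm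

end RadialProfile

end FracHardy

namespace FracHardy

open scoped ENNReal

variable {N : ℕ} {s : ℝ}

/-! ### The fractional Laplacian of powers and of logarithmic powers -/

/-- The coefficient in `(-Δ)^s |x|^τ = powCoeff N s τ * |x|^(τ-2s)`. -/
noncomputable def powCoeff (N : ℕ) (s τ : ℝ) : ℝ :=
  fracConst N s * ∫ y in punctured N,
    (1 - ‖y‖ ^ τ) * (1 - ‖y‖ ^ (2 * s - N - τ)) / ‖e1 N - y‖ ^ ((N : ℝ) + 2 * s)

/-- The coefficient in
`(-Δ)^s (|x|^τ ln |x|) = |x|^(τ-2s) (logCoeff N s τ + powCoeff N s τ ln |x|)`. -/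
noncomputable def logCoeff (N : ℕ) (s τ : ℝ) : ℝ :=
  fracConst N s * ∫ y in punctured N,
    Real.log ‖y‖ * (‖y‖ ^ (2 * s - N - τ) - ‖y‖ ^ τ) / ‖e1 N - y‖ ^ ((N : ℝ) + 2 * s)

theorem kelvinSum_rpow (τ : ℝ) {σ : ℝ} (hσ : 0 < σ) :
    kelvinSum N s (fun r => r ^ τ) σ = (1 - σ ^ τ) * (1 - σ ^ (2 * s - N - τ)) := by
  have h1 : σ ^ (2 * s - N - τ) = σ ^ (2 * s - (N : ℝ)) * (σ⁻¹) ^ τ := by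
    rw [Real.inv_rpow hσ.le, ← Real.rpow_neg hσ.le, ← Real.rpow_add hσ]; rfl
  have h2 : σ ^ τ * (σ⁻¹) ^ τ = 1 := by
    rw [← Real.mul_rpow hσ.le (inv_pos.2 hσ).le, mul_inv_cancel₀ hσ.ne', Real.one_rpow]
  simp only [kelvinSum, Real.one_rpow]
  rw [h1]
  linear_combination (-σ ^ (2 * s - (N : ℝ))) * h2

theorem kelvinSum_rpow_log (τ : ℝ) {σ : ℝ} (hσ : 0 < σ) :
    kelvinSum N s (fun r => r ^ τ * Real.log r) σ
      = Real.log σ * (σ ^ (2 * s - N - τ) - σ ^ τ) := by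
  have h1 : σ ^ (2 * s - N - τ) = σ ^ (2 * s - (N : ℝ)) * (σ⁻¹) ^ τ := by
    rw [Real.inv_rpow hσ.le, ← Real.rpow_neg hσ.le, ← Real.rpow_add hσ]; rfl
  simp only [kelvinSum, Real.one_rpow, Real.log_one, Real.log_inv]
  rw [h1]
  ring

theorem Icc_half_one_subset {σ : ℝ} (h : σ ∈ Icc (1 / 2 : ℝ) 1) : σ ∈ Icc (1 / 2 : ℝ) 2 :=
  ⟨h.1, h.2.trans one_le_two⟩

theorem radialProfile_rpow {τ : ℝ} (h1 : -(N : ℝ) < τ) (h2 : τ < 2 * s) :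
    RadialProfile N s (fun r => r ^ τ) where
  measurable := by fun_prop
  growth := by
    refine ⟨1, τ, τ, h1, h2, h1, h2, fun σ hσ => ?_⟩
    have : 0 < σ ^ τ := by positivity
    rw [abs_of_pos this]; linarith
  lipschitz := by
    obtain ⟨D, hD0, hD⟩ := exists_rpow_lipschitz τ
    exact ⟨D, hD0, fun σ hσ => hD 1 (by norm_num) σ hσ⟩
  quadratic := by
    obtain ⟨D, hD0, hD⟩ := exists_rpow_lipschitz τ
    obtain ⟨D', hD0', hD'⟩ := exists_rpow_lipschitz (2 * s - N - τ)
    refine ⟨D * D', by positivity, fun σ hσ => ?_⟩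
    have e1 := hD 1 (by norm_num) σ (Icc_half_one_subset hσ)
    have e2 := hD' 1 (by norm_num) σ (Icc_half_one_subset hσ)
    rw [Real.one_rpow] at e1 e2
    rw [kelvinSum_rpow τ (by linarith [hσ.1]), abs_mul, ← sq_abs (1 - σ)]
    calc _ ≤ (D * |1 - σ|) * (D' * |1 - σ|) := by gcongr
      _ = _ := by ring

theorem radialProfile_rpow_log {τ : ℝ} (h1 : -(N : ℝ) < τ) (h2 : τ < 2 * s) :
    RadialProfile N s (fun r => r ^ τ * Real.log r) where
  measurable := by fun_prop
  growth := by
    obtain ⟨δ, hδ, hδ1, hδ2⟩ : ∃ δ : ℝ, 0 < δ ∧ -(N : ℝ) < τ - δ ∧ τ + δ < 2 * s := by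
      refine ⟨min (τ + N) (2 * s - τ) / 2, ?_, ?_, ?_⟩
      · have : 0 < min (τ + N) (2 * s - τ) := lt_min (by linarith) (by linarith)
        linarith
      · have := min_le_left (τ + N) (2 * s - τ); linarith
      · have := min_le_right (τ + N) (2 * s - τ); linarith
    refine ⟨δ⁻¹, τ + δ, τ - δ, by linarith, hδ2, hδ1, by linarith, fun σ hσ => ?_⟩
    rw [abs_mul, abs_of_pos (Real.rpow_pos_of_pos hσ τ), Real.rpow_add hσ, sub_eq_add_neg,
      Real.rpow_add hσ, ← mul_add, mul_left_comm]
    exact mul_le_mul_of_nonneg_left (abs_log_le_rpow_add_rpow hδ hσ)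
      (Real.rpow_pos_of_pos hσ τ).le
  lipschitz := by
    obtain ⟨D, hD0, hD⟩ := exists_rpow_lipschitz τ
    refine ⟨(1 + D) * 2, by positivity, fun σ hσ => ?_⟩
    have e1 := hD σ hσ 1 (by norm_num)
    have e2 := abs_log_le_two_mul hσ
    have e3 : |σ - 1| ≤ 1 := by rw [abs_le]; constructor <;> linarith [hσ.1, hσ.2]
    have e4 : |σ ^ τ| ≤ 1 + D := by
      have h5 := abs_sub_abs_le_abs_sub (σ ^ τ) (1 ^ τ)
      rw [Real.one_rpow, abs_one] at h5
      rw [Real.one_rpow] at e1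
      nlinarith
    simp only [Real.one_rpow, Real.log_one, mul_zero, zero_sub, abs_neg, abs_mul]
    calc _ ≤ (1 + D) * (2 * |1 - σ|) := by gcongr
      _ = _ := by ring
  quadratic := by
    obtain ⟨D, hD0, hD⟩ := exists_rpow_lipschitz τ
    obtain ⟨D', hD0', hD'⟩ := exists_rpow_lipschitz (2 * s - N - τ)
    refine ⟨2 * (D + D'), by positivity, fun σ hσ => ?_⟩
    have e1 := hD 1 (by norm_num) σ (Icc_half_one_subset hσ)
    have e2 := hD' 1 (by norm_num) σ (Icc_half_one_subset hσ)
    have e3 := abs_log_le_two_mul (Icc_half_one_subset hσ)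
    rw [Real.one_rpow] at e1 e2
    have e4 : |σ ^ (2 * s - N - τ) - σ ^ τ| ≤ (D + D') * |1 - σ| := by
      have : σ ^ (2 * s - N - τ) - σ ^ τ = (1 - σ ^ τ) - (1 - σ ^ (2 * s - N - τ)) := by ring
      rw [this, add_mul]
      exact (abs_sub _ _).trans (add_le_add e1 e2)
    rw [kelvinSum_rpow_log τ (by linarith [hσ.1]), abs_mul, ← sq_abs (1 - σ)]
    calc _ ≤ (2 * |1 - σ|) * ((D + D') * |1 - σ|) := by gcongr
      _ = _ := by ring

theorem HasFracLap.add {w u v : E N → ℝ} {x : E N} {L M : ℝ} (hu : HasFracLap s w u x L)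
    (hv : HasFracLap s w v x M) : HasFracLap s w (fun z => u z + v z) x (L + M) := by
  have hk : fracKernel s w (fun z => u z + v z) x
      = fun z => fracKernel s w u x z + fracKernel s w v x z := by
    funext z; simp only [fracKernel]; ring
  refine ⟨fun ε hε => ?_, ?_⟩
  · rw [hk]; exact (hu.1 ε hε).add (hv.1 ε hε)
  · refine (hu.2.add hv.2).congr' ?_
    filter_upwards [self_mem_nhdsWithin] with ε hε
    rw [fracTrunc, fracTrunc, fracTrunc, hk, integral_add (hu.1 ε hε) (hv.1 ε hε), mul_add]

theorem HasFracLap.const_mul {w u : E N → ℝ} {x : E N} {L : ℝ} (hu : HasFracLap s w u x L)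
    (c : ℝ) : HasFracLap s w (fun z => c * u z) x (c * L) := by
  have hk : fracKernel s w (fun z => c * u z) x = fun z => c * fracKernel s w u x z := by
    funext z; simp only [fracKernel]; ring
  refine ⟨fun ε hε => ?_, ?_⟩
  · rw [hk]; exact (hu.1 ε hε).const_mul c
  · refine (hu.2.const_mul c).congr fun ε => ?_
    rw [fracTrunc, fracTrunc, hk, integral_const_mul]; ring

theorem HasFracLap.unique {w u : E N → ℝ} {x : E N} {L M : ℝ} (h : HasFracLap s w u x L)
    (h' : HasFracLap s w u x M) : L = M :=
  tendsto_nhds_unique h.2 h'.2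

theorem mem_compl_ball_smul_iff (R : E N ≃ₗᵢ[ℝ] E N) {ρ : ℝ} (hρ : 0 < ρ) (e z : E N) (ε : ℝ) :
    ρ • R z ∈ (Metric.ball (ρ • R e) ε)ᶜ ↔ z ∈ (Metric.ball e (ε / ρ))ᶜ := by
  have : dist (ρ • R z) (ρ • R e) = ρ * dist z e := by
    rw [dist_smul₀, R.dist_map, Real.norm_of_nonneg hρ.le]
  simp only [mem_compl_iff, Metric.mem_ball, this, not_lt, div_le_iff₀' hρ]

theorem indicator_kernel_smul {w u : E N → ℝ} (R : E N ≃ₗᵢ[ℝ] E N) {ρ : ℝ} (hρ : 0 < ρ) (e : E N)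
    (ε : ℝ) (z : E N) :
    (Metric.ball (ρ • R e) ε)ᶜ.indicator (fracKernel s w u (ρ • R e)) (ρ • R z)
      = ρ ^ (-((N : ℝ) + 2 * s)) * (Metric.ball e (ε / ρ))ᶜ.indicator
        (fracKernel s (fun z => w (ρ • R z)) (fun z => u (ρ • R z)) e) z := by
  have hiff := mem_compl_ball_smul_iff R hρ e z ε
  by_cases h : z ∈ (Metric.ball e (ε / ρ))ᶜ
  · rw [indicator_of_mem (hiff.2 h), indicator_of_mem h]
    have : ‖ρ • R e - ρ • R z‖ = ρ * ‖e - z‖ := by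
      rw [← smul_sub, ← map_sub, norm_smul, R.norm_map, Real.norm_of_nonneg hρ.le]
    simp only [fracKernel]
    rw [this, Real.mul_rpow hρ.le (norm_nonneg _), Real.rpow_neg hρ.le, ← div_div, div_eq_inv_mul _
      (‖e - z‖ ^ _), div_eq_inv_mul, div_eq_inv_mul]
    ring
  · rw [indicator_of_notMem (fun h' => h (hiff.1 h')), indicator_of_notMem h, mul_zero]

/-- Covariance of the fractional Laplacian under a similarity `z ↦ ρ R z`. -/
theorem HasFracLap.of_similarity {w u : E N → ℝ} (R : E N ≃ₗᵢ[ℝ] E N) {ρ : ℝ} (hρ : 0 < ρ)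
    {e : E N} {L : ℝ}
    (h : HasFracLap s (fun z => w (ρ • R z)) (fun z => u (ρ • R z)) e L) :
    HasFracLap s w u (ρ • R e) (ρ ^ (-(2 * s)) * L) := by
  have hmp := R.measurePreserving
  have hme := R.toHomeomorph.measurableEmbedding
  refine ⟨fun ε hε => ?_, ?_⟩
  · have h1 := h.1 (ε / ρ) (div_pos hε hρ)
    rw [← integrable_indicator_iff measurableSet_ball.compl] at h1 ⊢
    rw [← integrable_comp_smul_iff volume _ hρ.ne', ← hmp.integrable_comp_emb hme]
    refine (h1.const_mul (ρ ^ (-((N : ℝ) + 2 * s)))).congr (Eventually.of_forall fun z => ?_)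
    exact (indicator_kernel_smul R hρ e ε z).symm
  · have ht : Tendsto (fun ε : ℝ => ε / ρ) (𝓝[>] 0) (𝓝[>] 0) := by
      refine tendsto_nhdsWithin_iff.2 ⟨?_, ?_⟩
      · have : Tendsto (fun ε : ℝ => ε / ρ) (𝓝 0) (𝓝 (0 / ρ)) :=
          (continuous_id.div_const ρ).tendsto 0
        rw [zero_div] at this
        exact this.mono_left nhdsWithin_le_nhds
      · filter_upwards [self_mem_nhdsWithin] with ε hε
        exact div_pos hε hρ
    refine ((h.2.comp ht).const_mul (ρ ^ (-(2 * s)))).congr fun ε => ?_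
    simp only [Function.comp, fracTrunc]
    rw [← integral_indicator measurableSet_ball.compl, ← integral_indicator measurableSet_ball.compl]
    have h2 := Measure.integral_comp_smul (volume : Measure (E N))
      ((Metric.ball (ρ • R e) ε)ᶜ.indicator (fracKernel s w u (ρ • R e))) ρ
    rw [← hmp.integral_comp hme] at h2
    simp_rw [indicator_kernel_smul R hρ e ε] at h2
    rw [integral_const_mul, finrank_euclideanSpace, Fintype.card_fin, abs_of_pos (by positivity),
      smul_eq_mul] at h2
    have h3 : ρ ^ (-(2 * s)) = ρ ^ N * ρ ^ (-((N : ℝ) + 2 * s)) := by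
      rw [← Real.rpow_natCast, ← Real.rpow_add hρ]; congr 1; ring
    rw [h3]
    have h4 : ρ ^ N ≠ 0 := by positivity
    rw [eq_inv_mul_iff_mul_eq₀ h4] at h2
    rw [← h2]; ring

theorem exists_similarity [NeZero N] {x : E N} (hx : x ≠ 0) :
    ∃ R : E N ≃ₗᵢ[ℝ] E N, ‖x‖ • R (e1 N) = x := by
  have h0 : ‖x‖ ≠ 0 := norm_ne_zero_iff.2 hx
  obtain ⟨R, hR⟩ := exists_rotation (N := N) (θ := ‖x‖⁻¹ • x) (by simp [norm_smul, h0])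
  exact ⟨R, by rw [hR, smul_smul, mul_inv_cancel₀ h0, one_smul]⟩

theorem hasFracLap_rpow_e1 [NeZero N] (hs0 : 0 < s) (hs1 : s < 1) {τ : ℝ} (h1 : -(N : ℝ) < τ)
    (h2 : τ < 2 * s) :
    HasFracLap s (fun _ => 1) (fun z : E N => ‖z‖ ^ τ) (e1 N) (powCoeff N s τ) := by
  have h := (radialProfile_rpow h1 h2).hasFracLap_e1 hs0 hs1
  rwa [setIntegral_congr_fun (g := fun y : E N =>
    (1 - ‖y‖ ^ τ) * (1 - ‖y‖ ^ (2 * s - N - τ)) / ‖e1 N - y‖ ^ ((N : ℝ) + 2 * s))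
    measurableSet_punctured (fun y hy => by simp only [kelvinSum_rpow τ hy.1])] at h

theorem hasFracLap_rpow_log_e1 [NeZero N] (hs0 : 0 < s) (hs1 : s < 1) {τ : ℝ}
    (h1 : -(N : ℝ) < τ) (h2 : τ < 2 * s) :
    HasFracLap s (fun _ => 1) (fun z : E N => ‖z‖ ^ τ * Real.log ‖z‖) (e1 N)
      (logCoeff N s τ) := by
  have h := (radialProfile_rpow_log h1 h2).hasFracLap_e1 hs0 hs1
  rwa [setIntegral_congr_fun (g := fun y : E N =>
    Real.log ‖y‖ * (‖y‖ ^ (2 * s - N - τ) - ‖y‖ ^ τ) / ‖e1 N - y‖ ^ ((N : ℝ) + 2 * s))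
    measurableSet_punctured (fun y hy => by simp only [kelvinSum_rpow_log τ hy.1])] at h

theorem hasFracLap_rpow [NeZero N] (hs0 : 0 < s) (hs1 : s < 1) {τ : ℝ} (h1 : -(N : ℝ) < τ)
    (h2 : τ < 2 * s) {x : E N} (hx : x ≠ 0) :
    HasFracLap s (fun _ => 1) (fun z : E N => ‖z‖ ^ τ) x
      (‖x‖ ^ (τ - 2 * s) * powCoeff N s τ) := by
  obtain ⟨R, hR⟩ := exists_similarity hx
  have hx0 : 0 < ‖x‖ := norm_pos_iff.2 hx
  have h := (hasFracLap_rpow_e1 hs0 hs1 h1 h2).const_mul (‖x‖ ^ τ)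
  have h3 : (fun z : E N => ‖x‖ ^ τ * ‖z‖ ^ τ) = fun z => ‖‖x‖ • R z‖ ^ τ := by
    funext z
    rw [norm_smul, R.norm_map, norm_norm, Real.mul_rpow (norm_nonneg _) (norm_nonneg _)]
  rw [h3] at h
  have h4 := HasFracLap.of_similarity (w := fun _ => 1) (u := fun z => ‖z‖ ^ τ) R hx0 h
  rw [hR, ← mul_assoc, ← Real.rpow_add hx0] at h4
  rwa [sub_eq_neg_add]

theorem hasFracLap_rpow_log [NeZero N] (hs0 : 0 < s) (hs1 : s < 1) {τ : ℝ} (h1 : -(N : ℝ) < τ)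
    (h2 : τ < 2 * s) {x : E N} (hx : x ≠ 0) :
    HasFracLap s (fun _ => 1) (fun z : E N => ‖z‖ ^ τ * Real.log ‖z‖) x
      (‖x‖ ^ (τ - 2 * s) * (logCoeff N s τ + Real.log ‖x‖ * powCoeff N s τ)) := by
  obtain ⟨R, hR⟩ := exists_similarity hx
  have hx0 : 0 < ‖x‖ := norm_pos_iff.2 hx
  have h := ((hasFracLap_rpow_log_e1 hs0 hs1 h1 h2).add
    ((hasFracLap_rpow_e1 hs0 hs1 h1 h2).const_mul (Real.log ‖x‖))).const_mul (‖x‖ ^ τ)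
  -- The two sides differ at the origin, where the power may take a junk value, so the kernels
  -- agree only almost everywhere.
  have h4 : HasFracLap s (fun _ => 1)
      (fun z => ‖‖x‖ • R z‖ ^ τ * Real.log ‖‖x‖ • R z‖) (e1 N)
      (‖x‖ ^ τ * (logCoeff N s τ + Real.log ‖x‖ * powCoeff N s τ)) := by
    have hae : ∀ᵐ z : E N, fracKernel s (fun _ => 1) (fun z : E N =>
        ‖x‖ ^ τ * (‖z‖ ^ τ * Real.log ‖z‖ + Real.log ‖x‖ * ‖z‖ ^ τ)) (e1 N) z
        = fracKernel s (fun _ => 1) (fun z : E N =>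
          ‖‖x‖ • R z‖ ^ τ * Real.log ‖‖x‖ • R z‖) (e1 N) z := by
      have hz : ∀ z : E N, z ≠ 0 → ‖x‖ ^ τ * (‖z‖ ^ τ * Real.log ‖z‖ + Real.log ‖x‖ * ‖z‖ ^ τ)
          = ‖‖x‖ • R z‖ ^ τ * Real.log ‖‖x‖ • R z‖ := by
        intro z hz
        rw [norm_smul, R.norm_map, norm_norm, Real.mul_rpow (norm_nonneg _) (norm_nonneg _),
          Real.log_mul hx0.ne' (norm_ne_zero_iff.2 hz)]
        ring
      filter_upwards [ae_ne_zero (N := N)] with z hz0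
      simp only [fracKernel]
      rw [hz z hz0, hz _ e1_ne_zero]
    refine ⟨fun ε hε => (h.1 ε hε).congr (ae_restrict_of_ae hae), h.2.congr fun ε => ?_⟩
    rw [fracTrunc, fracTrunc, integral_congr_ae (ae_restrict_of_ae hae)]
  have h5 := HasFracLap.of_similarity (w := fun _ => 1)
    (u := fun z => ‖z‖ ^ τ * Real.log ‖z‖) R hx0 h4
  rw [hR, ← mul_assoc, ← Real.rpow_add hx0] at h5
  rwa [sub_eq_neg_add]

end FracHardy

namespace FracHardy

open scoped ENNReal

variable {N : ℕ} {s : ℝ}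

/-! ### Monotonicity and range of the coefficient -/

theorem fracConst_pos (hs0 : 0 < s) (hs1 : s < 1) : 0 < fracConst N s := by
  unfold fracConst
  have h1 : 0 < Real.Gamma (((N : ℝ) + 2 * s) / 2) := Real.Gamma_pos_of_pos (by positivity)
  have h2 : 0 < Real.Gamma (1 - s) := Real.Gamma_pos_of_pos (by linarith)
  positivity

theorem setIntegral_pos_of_pos_on [NeZero N] {f : E N → ℝ} {S : Set (E N)} (hS : MeasurableSet S)
    (hvol : volume S ≠ 0) (hf : IntegrableOn f S) (hpos : ∀ y ∈ S, 0 < f y) :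
    0 < ∫ y in S, f y := by
  rw [setIntegral_pos_iff_support_of_nonneg_ae _ hf]
  · have : Function.support f ∩ S = S := inter_eq_right.2 fun y hy => (hpos y hy).ne'
    rw [this]
    exact pos_iff_ne_zero.2 hvol
  · filter_upwards [ae_restrict_mem hS] with y hy using (hpos y hy).le

theorem volume_punctured_ne_zero [NeZero N] : volume (punctured N) ≠ 0 := by
  rw [measure_congr punctured_ae_eq]
  exact (Metric.isOpen_ball.measure_pos volume ⟨0, by simp⟩).ne'

theorem norm_e1_sub_pos [NeZero N] {y : E N} (hy : y ∈ punctured N) : 0 < ‖e1 N - y‖ :=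
  lt_of_lt_of_le (abs_pos.2 (by linarith [hy.2])) (one_sub_norm_le y)

theorem powCoeff_symm (τ : ℝ) : powCoeff N s (2 * s - N - τ) = powCoeff N s τ := by
  unfold powCoeff
  congr 2
  funext y
  rw [sub_sub_cancel, mul_comm (1 - ‖y‖ ^ (2 * s - N - τ))]

theorem integrableOn_powCoeff [NeZero N] (hs0 : 0 < s) (hs1 : s < 1) {τ : ℝ}
    (h1 : -(N : ℝ) < τ) (h2 : τ < 2 * s) :
    IntegrableOn (fun y : E N => (1 - ‖y‖ ^ τ) * (1 - ‖y‖ ^ (2 * s - N - τ))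
      / ‖e1 N - y‖ ^ ((N : ℝ) + 2 * s)) (punctured N) :=
  ((radialProfile_rpow h1 h2).integrableOn_kelvinSum hs0 hs1).congr_fun
    (fun y hy => by simp only [kelvinSum_rpow τ hy.1]) measurableSet_punctured

theorem integrableOn_logCoeff [NeZero N] (hs0 : 0 < s) (hs1 : s < 1) {τ : ℝ}
    (h1 : -(N : ℝ) < τ) (h2 : τ < 2 * s) :
    IntegrableOn (fun y : E N => Real.log ‖y‖ * (‖y‖ ^ (2 * s - N - τ) - ‖y‖ ^ τ)
      / ‖e1 N - y‖ ^ ((N : ℝ) + 2 * s)) (punctured N) :=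
  ((radialProfile_rpow_log h1 h2).integrableOn_kelvinSum hs0 hs1).congr_fun
    (fun y hy => by simp only [kelvinSum_rpow_log τ hy.1]) measurableSet_punctured

/-- `(1 - r^τ) (1 - r^(c-τ)) = 1 + r^c - (r^τ + r^(c-τ))` increases in `τ` up to the symmetry
point `c / 2`. -/
theorem one_sub_rpow_mul_lt {r : ℝ} (h0 : 0 < r) (h1 : r < 1) {c τ τ' : ℝ} (hτ : τ < τ')
    (hc : τ' ≤ c / 2) : (1 - r ^ τ) * (1 - r ^ (c - τ)) < (1 - r ^ τ') * (1 - r ^ (c - τ')) := by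
  have e1 : r ^ τ' = r ^ τ * r ^ (τ' - τ) := by rw [← Real.rpow_add h0]; congr 1; ring
  have e2 : r ^ (c - τ) = r ^ (c - τ') * r ^ (τ' - τ) := by
    rw [← Real.rpow_add h0]; congr 1; ring
  have e3 : r ^ (c - τ') < r ^ τ := Real.rpow_lt_rpow_of_exponent_gt h0 h1 (by linarith)
  have e4 : r ^ (τ' - τ) < 1 := Real.rpow_lt_one h0.le h1 (by linarith)
  rw [e1, e2]
  nlinarith [mul_pos (sub_pos.2 e3) (sub_pos.2 e4)]

theorem powCoeff_lt [NeZero N] (hs0 : 0 < s) (hs1 : s < 1) {τ τ' : ℝ} (h1 : -(N : ℝ) < τ)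
    (hτ : τ < τ') (h2 : τ' ≤ (2 * s - N) / 2) : powCoeff N s τ < powCoeff N s τ' := by
  have hN : (1 : ℝ) ≤ N := by exact_mod_cast NeZero.one_le
  have i1 := integrableOn_powCoeff hs0 hs1 h1 (by linarith)
  have i2 := integrableOn_powCoeff (N := N) (τ := τ') hs0 hs1 (by linarith) (by linarith)
  unfold powCoeff
  refine mul_lt_mul_of_pos_left ?_ (fracConst_pos hs0 hs1)
  rw [← sub_pos, ← integral_sub i2 i1]
  refine setIntegral_pos_of_pos_on measurableSet_punctured volume_punctured_ne_zero (i2.sub i1)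
    fun y hy => ?_
  have := norm_e1_sub_pos hy
  rw [← sub_div]
  exact div_pos (sub_pos.2 (one_sub_rpow_mul_lt hy.1 hy.2 hτ h2)) (by positivity)

theorem powCoeff_injOn [NeZero N] (hs0 : 0 < s) (hs1 : s < 1) {τ τ' : ℝ} (h1 : -(N : ℝ) < τ)
    (h1' : -(N : ℝ) < τ') (h2 : τ ≤ (2 * s - N) / 2) (h2' : τ' ≤ (2 * s - N) / 2)
    (h : powCoeff N s τ = powCoeff N s τ') : τ = τ' := by
  rcases lt_trichotomy τ τ' with h3 | h3 | h3
  · exact absurd h (powCoeff_lt hs0 hs1 h1 h3 h2').ne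
  · exact h3
  · exact absurd h (powCoeff_lt hs0 hs1 h1' h3 h2).ne'

theorem logCoeff_critical : logCoeff N s ((2 * s - N) / 2) = 0 := by
  unfold logCoeff
  have : 2 * s - (N : ℝ) - (2 * s - N) / 2 = (2 * s - N) / 2 := by ring
  simp [this]

/-- The logarithmic coefficient vanishes only at the critical exponent. This is what makes `τ₋` unique
for `μ = μ₀`. -/
theorem logCoeff_pos [NeZero N] (hs0 : 0 < s) (hs1 : s < 1) {τ : ℝ} (h1 : -(N : ℝ) < τ)
    (h2 : τ < (2 * s - N) / 2) : 0 < logCoeff N s τ := by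
  have hN : (1 : ℝ) ≤ N := by exact_mod_cast NeZero.one_le
  refine mul_pos (fracConst_pos hs0 hs1) (setIntegral_pos_of_pos_on measurableSet_punctured
    volume_punctured_ne_zero (integrableOn_logCoeff hs0 hs1 h1 (by linarith)) fun y hy => ?_)
  have := norm_e1_sub_pos hy
  refine div_pos (mul_pos_of_neg_of_neg (Real.log_neg hy.1 hy.2) ?_) (by positivity)
  rw [sub_neg]
  exact Real.rpow_lt_rpow_of_exponent_gt hy.1 hy.2 (by linarith)

/-- Concavity holds for the integrand, by convexity of `t ↦ r^t`; it is used for continuity. -/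
theorem concaveOn_powCoeff [NeZero N] (hs0 : 0 < s) (hs1 : s < 1) :
    ConcaveOn ℝ (Ioo (-(N : ℝ)) (2 * s)) (powCoeff N s) := by
  refine ⟨convex_Ioo _ _, fun τ hτ τ' hτ' a b ha hb hab => ?_⟩
  have hc := (convex_Ioo (-(N : ℝ)) (2 * s)) hτ hτ' ha hb hab
  have i1 := integrableOn_powCoeff hs0 hs1 hτ.1 hτ.2
  have i2 := integrableOn_powCoeff hs0 hs1 hτ'.1 hτ'.2
  have i3 := integrableOn_powCoeff hs0 hs1 hc.1 hc.2
  simp only [smul_eq_mul] at *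
  unfold powCoeff
  rw [mul_left_comm a, mul_left_comm b, ← mul_add, ← integral_const_mul, ← integral_const_mul,
    ← integral_add (i1.const_mul a) (i2.const_mul b)]
  refine mul_le_mul_of_nonneg_left ?_ (fracConst_pos hs0 hs1).le
  refine setIntegral_mono_on ((i1.const_mul a).add (i2.const_mul b)) i3 measurableSet_punctured
    fun y hy => ?_
  rw [mul_div_assoc', mul_div_assoc', ← add_div]
  gcongr
  have key : ∀ t : ℝ, (1 - ‖y‖ ^ t) * (1 - ‖y‖ ^ (2 * s - N - t))
      = 1 + ‖y‖ ^ (2 * s - (N : ℝ)) - (‖y‖ ^ t + ‖y‖ ^ (2 * s - N - t)) := by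
    intro t
    have : ‖y‖ ^ (2 * s - (N : ℝ)) = ‖y‖ ^ t * ‖y‖ ^ (2 * s - N - t) := by
      rw [← Real.rpow_add hy.1]; congr 1; ring
    rw [this]; ring
  have c1 := (convexOn_rpow_left hy.1).2 (mem_univ τ) (mem_univ τ') ha hb hab
  have c2 := (convexOn_rpow_left hy.1).2 (mem_univ (2 * s - N - τ)) (mem_univ (2 * s - N - τ'))
    ha hb hab
  simp only [smul_eq_mul] at c1 c2
  have e : a * (2 * s - N - τ) + b * (2 * s - N - τ') = 2 * s - N - (a * τ + b * τ') := by
    linear_combination (2 * s - (N : ℝ)) * hab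
  rw [e] at c2
  rw [key, key, key]
  have : a * (1 + ‖y‖ ^ (2 * s - (N : ℝ))) + b * (1 + ‖y‖ ^ (2 * s - (N : ℝ)))
      = 1 + ‖y‖ ^ (2 * s - (N : ℝ)) := by rw [← add_mul, hab, one_mul]
  nlinarith

theorem continuousOn_powCoeff [NeZero N] (hs0 : 0 < s) (hs1 : s < 1) :
    ContinuousOn (powCoeff N s) (Ioo (-(N : ℝ)) (2 * s)) :=
  (concaveOn_powCoeff hs0 hs1).continuousOn isOpen_Ioo

theorem setIntegral_ball_rpow_norm [NeZero N] {τ : ℝ} (h1 : -(N : ℝ) < τ) {R : ℝ} (hR : 0 < R) :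
    ∫ x in Metric.ball (0 : E N) R, ‖x‖ ^ τ
      = N * volume.real (Metric.ball (0 : E N) 1) * (R ^ ((N : ℝ) + τ) / (N + τ)) := by
  have hN : 1 ≤ N := NeZero.one_le
  have h := integral_fun_norm_addHaar (volume : Measure (E N)) ((Iio R).indicator fun r => r ^ τ)
  have e1 : ∀ x : E N, (Iio R).indicator (fun r => r ^ τ) ‖x‖
      = (Metric.ball (0 : E N) R).indicator (fun x => ‖x‖ ^ τ) x := by
    intro x; simp [indicator]
  simp_rw [e1] at h
  rw [integral_indicator measurableSet_ball] at h
  rw [h]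
  simp only [finrank_euclideanSpace, Fintype.card_fin, nsmul_eq_mul, smul_eq_mul, ← mul_assoc]
  congr 1
  have e2 : ∫ y in Ioi (0 : ℝ), y ^ (N - 1) * (Iio R).indicator (fun r => r ^ τ) y
      = ∫ y in Ioi (0 : ℝ), (Iio R).indicator (fun r => r ^ ((N : ℝ) + τ - 1)) y := by
    refine setIntegral_congr_fun measurableSet_Ioi fun y hy => ?_
    have hy : 0 < y := hy
    by_cases hyR : y ∈ Iio R
    · simp only [indicator_of_mem hyR]
      rw [← Real.rpow_natCast, ← Real.rpow_add hy, Nat.cast_sub hN, Nat.cast_one]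
      congr 1; ring
    · simp only [indicator_of_notMem hyR, mul_zero]
  rw [e2, setIntegral_indicator measurableSet_Iio, Ioi_inter_Iio, ← integral_Ioc_eq_integral_Ioo,
    ← intervalIntegral.integral_of_le hR.le, integral_rpow (Or.inl (by linarith)),
    sub_add_cancel, Real.zero_rpow (by linarith), sub_zero]

/-- The coefficient is unbounded below as the exponent tends to `-N`. -/
theorem exists_powCoeff_le [NeZero N] (hs0 : 0 < s) (hs1 : s < 1) (M : ℝ) :
    ∃ τ : ℝ, -(N : ℝ) < τ ∧ τ < (2 * s - N) / 2 ∧ powCoeff N s τ ≤ M := by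
  have hN : (1 : ℝ) ≤ N := by exact_mod_cast NeZero.one_le
  set V := volume.real (Metric.ball (0 : E N) 1) with hV
  have hVpos : 0 < V := ENNReal.toReal_pos
    (Metric.isOpen_ball.measure_pos volume ⟨0, by simp⟩).ne' measure_ball_lt_top.ne
  set W := volume.real (Metric.ball (0 : E N) (1 / 2)) with hW
  set q : ℝ := (1 - (1 / 2) ^ s) * ((3 / 2) ^ ((N : ℝ) + 2 * s))⁻¹ with hq
  have hq0 : 0 < q := mul_pos (sub_pos.2 (Real.rpow_lt_one (by norm_num) (by norm_num) hs0))
    (by positivity)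
  have hC := fracConst_pos (N := N) hs0 hs1
  -- The lower bound `N * V * 2⁻¹ / η - W` for the integral of `|x|^τ - 1` over the ball of radius
  -- `1/2`, with `η = N + τ ≤ 1`, is arbitrarily large.
  set T : ℝ := |M| / (fracConst N s * q) + W with hT
  have hT0 : 0 ≤ T := add_nonneg (by positivity) measureReal_nonneg
  set η : ℝ := min (s / 2) (N * V * 2⁻¹ / (T + 1)) with hη
  have hη0 : 0 < η := lt_min (by linarith) (by positivity)
  have hη1 : η ≤ s / 2 := min_le_left _ _
  have hη2 : η * T ≤ N * V * 2⁻¹ := by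
    have h := min_le_right (s / 2) (N * V * 2⁻¹ / (T + 1))
    rw [← hη, le_div_iff₀ (by linarith)] at h
    nlinarith
  have h1 : -(N : ℝ) < η - N := by linarith
  have h2 : η - N < (2 * s - N) / 2 := by linarith
  refine ⟨η - N, h1, h2, ?_⟩
  have hi := integrableOn_powCoeff (N := N) (τ := η - N) hs0 hs1 h1 (by linarith)
  have hb : s ≤ 2 * s - N - (η - N) := by linarith
  have hsub : punctured N ∩ Metric.ball 0 (1 / 2) ⊆ punctured N := inter_subset_left
  have hmeas : MeasurableSet (punctured N ∩ Metric.ball 0 (1 / 2)) :=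
    measurableSet_punctured.inter measurableSet_ball
  have hae : (punctured N ∩ Metric.ball 0 (1 / 2) : Set (E N)) =ᵐ[volume] Metric.ball 0 (1 / 2) := by
    have := (punctured_ae_eq (N := N)).inter (ae_eq_refl (Metric.ball (0 : E N) (1 / 2)))
    rwa [inter_eq_right.2 (Metric.ball_subset_ball (by norm_num : (1 / 2 : ℝ) ≤ 1))] at this
  have hle1 : ∀ y ∈ punctured N, 1 ≤ ‖y‖ ^ (η - N) := fun y hy =>
    Real.one_le_rpow_of_pos_of_le_one_of_nonpos hy.1 hy.2.le (by linarith)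
  have hle2 : ∀ y ∈ punctured N, ‖y‖ ^ (2 * s - N - (η - N)) ≤ 1 := fun y hy =>
    Real.rpow_le_one hy.1.le hy.2.le (by linarith)
  have hpow : IntegrableOn (fun y : E N => q * (‖y‖ ^ (η - N) - 1)) (Metric.ball 0 (1 / 2)) :=
    (((integrableOn_ball_rpow_norm (N := N) h1 (1 / 2)).sub
      (integrableOn_const measure_ball_lt_top.ne)).const_mul q)
  have step : ∫ y in Metric.ball (0 : E N) (1 / 2), q * (‖y‖ ^ (η - N) - 1)
      ≤ ∫ y in punctured N, -((1 - ‖y‖ ^ (η - N)) * (1 - ‖y‖ ^ (2 * s - N - (η - N)))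
        / ‖e1 N - y‖ ^ ((N : ℝ) + 2 * s)) := by
    rw [← setIntegral_congr_set hae]
    refine (setIntegral_mono_on (hpow.mono_set inter_subset_right)
      (hi.neg.mono_set hsub) hmeas fun y hy => ?_).trans
      (setIntegral_mono_set hi.neg ?_ hsub.eventuallyLE)
    · have a1 := hle1 y hy.1
      have hy2 : ‖y‖ < 1 / 2 := by simpa using hy.2
      have a2 : ‖y‖ ^ (2 * s - N - (η - N)) ≤ (1 / 2) ^ s :=
        (Real.rpow_le_rpow_of_exponent_ge hy.1.1 hy.1.2.le hb).trans
          (Real.rpow_le_rpow hy.1.1.le hy2.le hs0.le)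
      have a3 : ‖e1 N - y‖ ≤ 3 / 2 := by
        have := norm_sub_le (e1 N) y
        rw [norm_e1] at this; linarith
      have a4 : ((3 / 2 : ℝ) ^ ((N : ℝ) + 2 * s))⁻¹ ≤ (‖e1 N - y‖ ^ ((N : ℝ) + 2 * s))⁻¹ := by
        have := norm_e1_sub_pos hy.1
        gcongr
      have a5 : (1 / 2 : ℝ) ^ s ≤ 1 := Real.rpow_le_one (by norm_num) (by norm_num) hs0.le
      calc q * (‖y‖ ^ (η - N) - 1)
          = (‖y‖ ^ (η - N) - 1) * (1 - (1 / 2) ^ s) * ((3 / 2) ^ ((N : ℝ) + 2 * s))⁻¹ := by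
            rw [hq]; ring
        _ ≤ (‖y‖ ^ (η - N) - 1) * (1 - ‖y‖ ^ (2 * s - N - (η - N)))
            * (‖e1 N - y‖ ^ ((N : ℝ) + 2 * s))⁻¹ := by
            gcongr
            · exact mul_nonneg (by linarith) (by linarith)
        _ = _ := by rw [Pi.neg_apply, div_eq_mul_inv]; ring
    · filter_upwards [ae_restrict_mem measurableSet_punctured] with y hy
      have a1 := hle1 y hy
      have a2 := hle2 y hy
      simp only [Pi.zero_apply, Pi.neg_apply]
      rw [← neg_div]
      exact div_nonneg (by nlinarith) (by positivity)
  rw [integral_neg, integral_const_mul, integral_sub (integrableOn_ball_rpow_norm (N := N) h1 _)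
    (integrableOn_const measure_ball_lt_top.ne), setIntegral_ball_rpow_norm h1 (by norm_num),
    setIntegral_const, smul_eq_mul, mul_one, ← hV, ← hW] at step
  have h3 : (N : ℝ) * V * 2⁻¹ / η ≤ N * V * ((1 / 2) ^ ((N : ℝ) + (η - N)) / (N + (η - N))) := by
    rw [add_sub_cancel, mul_div_assoc]
    gcongr
    have := Real.rpow_le_rpow_of_exponent_ge (x := 1 / 2) (by norm_num) (by norm_num)
      (by linarith : η ≤ 1)
    rw [Real.rpow_one] at this
    linarith
  have h4 : T ≤ N * V * 2⁻¹ / η := by rw [le_div_iff₀ hη0]; linarith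
  have h5 : |M| / (fracConst N s * q)
      ≤ N * V * ((1 / 2) ^ ((N : ℝ) + (η - N)) / (N + (η - N))) - W := by linarith
  rw [div_le_iff₀ (by positivity)] at h5
  unfold powCoeff
  have h6 := mul_le_mul_of_nonneg_left step hC.le
  have h7 := neg_abs_le M
  nlinarith

/-- By the intermediate value theorem the coefficient attains every value below the one at the
critical exponent. -/
theorem exists_powCoeff_eq [NeZero N] (hs0 : 0 < s) (hs1 : s < 1) {M : ℝ}
    (hM : M ≤ powCoeff N s ((2 * s - N) / 2)) :
    ∃ τ : ℝ, -(N : ℝ) < τ ∧ τ ≤ (2 * s - N) / 2 ∧ powCoeff N s τ = M := by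
  have hN : (1 : ℝ) ≤ N := by exact_mod_cast NeZero.one_le
  obtain ⟨τ, h1, h2, h3⟩ := exists_powCoeff_le (N := N) hs0 hs1 M
  have hcont : ContinuousOn (powCoeff N s) (Icc τ ((2 * s - N) / 2)) :=
    (continuousOn_powCoeff hs0 hs1).mono fun x hx => ⟨by linarith [hx.1], by linarith [hx.2]⟩
  obtain ⟨x, hx, hx2⟩ := intermediate_value_Icc h2.le hcont ⟨h3, hM⟩
  exact ⟨x, by linarith [hx.1], hx.2, hx2⟩

end FracHardy

namespace FracHardy

open scoped ENNReal

variable {N : ℕ} {s : ℝ}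

/-! ### One-dimensional Gamma and Beta integrals -/

theorem setLIntegral_ofReal {α : Type*} [MeasurableSpace α] {μ : Measure α} {S : Set α}
    (hS : MeasurableSet S) {f : α → ℝ} (hf : IntegrableOn f S μ) (hnn : ∀ x ∈ S, 0 ≤ f x) :
    ∫⁻ x in S, ENNReal.ofReal (f x) ∂μ = ENNReal.ofReal (∫ x in S, f x ∂μ) :=
  (ofReal_integral_eq_lintegral_ofReal hf ((ae_restrict_mem hS).mono fun x hx => hnn x hx)).symm

theorem integrableOn_rpow_mul_exp {a r : ℝ} (ha : 0 < a) (hr : 0 < r) :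
    IntegrableOn (fun t => t ^ (a - 1) * Real.exp (-(r * t))) (Ioi 0) := by
  refine Integrable.of_integral_ne_zero ?_
  rw [Real.integral_rpow_mul_exp_neg_mul_Ioi ha hr]
  have := Real.Gamma_pos_of_pos ha
  positivity

theorem lintegral_rpow_mul_exp {a r : ℝ} (ha : 0 < a) (hr : 0 < r) :
    ∫⁻ t in Ioi (0 : ℝ), ENNReal.ofReal (t ^ (a - 1) * Real.exp (-(r * t)))
      = ENNReal.ofReal (r ^ (-a) * Real.Gamma a) := by
  rw [setLIntegral_ofReal measurableSet_Ioi (integrableOn_rpow_mul_exp ha hr),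
    Real.integral_rpow_mul_exp_neg_mul_Ioi ha hr, one_div, Real.inv_rpow hr.le,
    Real.rpow_neg hr.le]
  intro t ht
  have ht : 0 < t := ht
  positivity

theorem integrableOn_rpow_mul_gauss {m b : ℝ} (hm : 0 < m) (hb : 0 < b) :
    IntegrableOn (fun r : ℝ => r ^ (m - 1) * Real.exp (-(b * r ^ 2))) (Ioi 0) := by
  refine (integrableOn_rpow_mul_exp_neg_mul_sq hb (by linarith : -1 < m - 1)).congr_fun
    (fun r _ => ?_) measurableSet_Ioi
  simp only [neg_mul]

theorem integral_rpow_mul_gauss {m b : ℝ} (hm : 0 < m) (hb : 0 < b) :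
    ∫ r in Ioi (0 : ℝ), r ^ (m - 1) * Real.exp (-(b * r ^ 2))
      = b ^ (-(m / 2)) * (Real.Gamma (m / 2) / 2) := by
  have h := integral_rpow_mul_exp_neg_mul_rpow (p := 2) (q := m - 1) (b := b) two_pos
    (by linarith) hb
  simp only [Real.rpow_two, neg_mul, sub_add_cancel] at h
  rw [h, neg_div]; ring

/-- The Beta integral `∫₀^∞ t^(p-1) (1+t)^(-p-q) dt = Γ(p) Γ(q) / Γ(p+q)`. -/
theorem lintegral_beta {p q : ℝ} (hp : 0 < p) (hq : 0 < q) :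
    ENNReal.ofReal (Real.Gamma (p + q)) *
      ∫⁻ t in Ioi (0 : ℝ), ENNReal.ofReal (t ^ (p - 1) * (t + 1) ^ (-(p + q)))
      = ENNReal.ofReal (Real.Gamma p * Real.Gamma q) := by
  have hG : 0 < Real.Gamma (p + q) := Real.Gamma_pos_of_pos (by linarith)
  have hGp : 0 < Real.Gamma p := Real.Gamma_pos_of_pos hp
  have hGq : 0 < Real.Gamma q := Real.Gamma_pos_of_pos hq
  rw [← lintegral_const_mul _ (by fun_prop)]
  have e1 : ∀ t ∈ Ioi (0 : ℝ), ENNReal.ofReal (Real.Gamma (p + q)) *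
      ENNReal.ofReal (t ^ (p - 1) * (t + 1) ^ (-(p + q)))
      = ∫⁻ u in Ioi (0 : ℝ), ENNReal.ofReal (t ^ (p - 1)) *
        ENNReal.ofReal (u ^ (p + q - 1) * Real.exp (-((t + 1) * u))) := by
    intro t ht
    have ht : 0 < t := ht
    rw [lintegral_const_mul _ (by fun_prop), lintegral_rpow_mul_exp (by linarith)
      (by linarith : 0 < t + 1), ← ENNReal.ofReal_mul hG.le, ← ENNReal.ofReal_mul (by positivity)]
    congr 1; ring
  have e2 : ∀ u ∈ Ioi (0 : ℝ), ∫⁻ t in Ioi (0 : ℝ), ENNReal.ofReal (t ^ (p - 1)) *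
        ENNReal.ofReal (u ^ (p + q - 1) * Real.exp (-((t + 1) * u)))
      = ENNReal.ofReal (Real.Gamma p) * ENNReal.ofReal (u ^ (q - 1) * Real.exp (-(1 * u))) := by
    intro u hu
    have hu : 0 < u := hu
    have e3 : ∀ t ∈ Ioi (0 : ℝ), ENNReal.ofReal (t ^ (p - 1)) *
        ENNReal.ofReal (u ^ (p + q - 1) * Real.exp (-((t + 1) * u)))
        = ENNReal.ofReal (u ^ (p + q - 1) * Real.exp (-u)) *
          ENNReal.ofReal (t ^ (p - 1) * Real.exp (-(u * t))) := by
      intro t ht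
      have ht : 0 < t := ht
      rw [← ENNReal.ofReal_mul (by positivity), ← ENNReal.ofReal_mul (by positivity)]
      have : Real.exp (-((t + 1) * u)) = Real.exp (-u) * Real.exp (-(u * t)) := by
        rw [← Real.exp_add]; congr 1; ring
      rw [this]; congr 1; ring
    rw [setLIntegral_congr_fun measurableSet_Ioi e3, lintegral_const_mul _ (by fun_prop),
      lintegral_rpow_mul_exp hp hu, ← ENNReal.ofReal_mul (by positivity),
      ← ENNReal.ofReal_mul hGp.le]
    have : u ^ (q - 1) = u ^ (p + q - 1) * u ^ (-p) := by
      rw [← Real.rpow_add hu]; congr 1; ring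
    rw [this, one_mul]; congr 1; ring
  rw [setLIntegral_congr_fun measurableSet_Ioi e1, lintegral_lintegral_swap (by fun_prop),
    setLIntegral_congr_fun measurableSet_Ioi e2, lintegral_const_mul _ (by fun_prop),
    lintegral_rpow_mul_exp hq one_pos, ← ENNReal.ofReal_mul hGp.le, Real.one_rpow, one_mul]

/-- Obtained from `1 - exp (-k r²) = ∫₀^k r² exp (-u r²) du` and Tonelli's theorem. -/
theorem lintegral_one_sub_gauss (hs0 : 0 < s) (hs1 : s < 1) {k : ℝ} (hk : 0 < k) :
    ∫⁻ r in Ioi (0 : ℝ), ENNReal.ofReal ((1 - Real.exp (-(k * r ^ 2))) * r ^ (-1 - 2 * s))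
      = ENNReal.ofReal (k ^ s * (Real.Gamma (1 - s) / (2 * s))) := by
  have hG : 0 < Real.Gamma (1 - s) := Real.Gamma_pos_of_pos (by linarith)
  have e1 : ∀ r ∈ Ioi (0 : ℝ), ENNReal.ofReal ((1 - Real.exp (-(k * r ^ 2))) * r ^ (-1 - 2 * s))
      = ∫⁻ u in Ioc (0 : ℝ) k, ENNReal.ofReal (r ^ (2 - 2 * s - 1) * Real.exp (-(u * r ^ 2))) := by
    intro r hr
    have hr : 0 < r := hr
    have hc : Continuous fun u : ℝ => r ^ (2 - 2 * s - 1) * Real.exp (-(u * r ^ 2)) := by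
      fun_prop
    rw [setLIntegral_ofReal measurableSet_Ioc (hc.integrableOn_Ioc)
      (fun u _ => by positivity), ← intervalIntegral.integral_of_le hk.le]
    congr 1
    have hd : ∀ u ∈ uIcc 0 k, HasDerivAt
        (fun u : ℝ => -(r ^ (-1 - 2 * s) * Real.exp (-(u * r ^ 2))))
        (r ^ (2 - 2 * s - 1) * Real.exp (-(u * r ^ 2))) u := by
      intro u _
      have h1 : HasDerivAt (fun u : ℝ => -(u * r ^ 2)) (-(1 * r ^ 2)) u :=
        ((hasDerivAt_id u).mul_const (r ^ 2)).neg
      have h2 := ((h1.exp).const_mul (r ^ (-1 - 2 * s))).neg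
      refine HasDerivAt.congr_deriv h2 ?_
      have : r ^ (2 - 2 * s - 1) = r ^ (-1 - 2 * s) * r ^ 2 := by
        rw [← Real.rpow_natCast, ← Real.rpow_add hr]; congr 1; push_cast; ring
      rw [this]; ring
    rw [intervalIntegral.integral_eq_sub_of_hasDerivAt hd (hc.intervalIntegrable _ _)]
    simp; ring
  have e2 : ∀ u ∈ Ioc (0 : ℝ) k, ∫⁻ r in Ioi (0 : ℝ),
      ENNReal.ofReal (r ^ (2 - 2 * s - 1) * Real.exp (-(u * r ^ 2)))
      = ENNReal.ofReal (u ^ (s - 1) * (Real.Gamma (1 - s) / 2)) := by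
    intro u hu
    rw [setLIntegral_ofReal measurableSet_Ioi (integrableOn_rpow_mul_gauss (by linarith) hu.1),
      integral_rpow_mul_gauss (by linarith) hu.1]
    · congr 3 <;> ring_nf
    · intro r hr
      have hr : 0 < r := hr
      positivity
  rw [setLIntegral_congr_fun measurableSet_Ioi e1, lintegral_lintegral_swap (by fun_prop),
    setLIntegral_congr_fun measurableSet_Ioc e2, setLIntegral_ofReal measurableSet_Ioc,
    ← intervalIntegral.integral_of_le hk.le, intervalIntegral.integral_mul_const,
    integral_rpow (Or.inl (by linarith)), sub_add_cancel, Real.zero_rpow hs0.ne', sub_zero]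
  · congr 1; field_simp
  · exact ((intervalIntegral.intervalIntegrable_rpow' (by linarith : -1 < s - 1)).mul_const _).1
  · intro u hu
    have hu : 0 < u := hu.1
    positivity

/-! ### The energy of a pair of Gaussians -/

theorem integral_gauss_norm {b : ℝ} (hb : 0 < b) :
    ∫ x : E N, Real.exp (-(b * ‖x‖ ^ 2)) = (Real.pi / b) ^ ((N : ℝ) / 2) := by
  have h := GaussianFourier.integral_rexp_neg_mul_sq_norm (V := E N) hb
  simpa [neg_mul] using h

theorem integrable_gauss_norm {b : ℝ} (hb : 0 < b) :
    Integrable fun x : E N => Real.exp (-(b * ‖x‖ ^ 2)) := by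
  refine Integrable.of_integral_ne_zero ?_
  rw [integral_gauss_norm hb]
  have := Real.pi_pos
  positivity

/-- Completion of the square in the product of two shifted Gaussians. -/
theorem gauss_mul_gauss_shift {t : ℝ} (ht : 0 < t) (x h : E N) :
    Real.exp (-(t * ‖x‖ ^ 2)) * Real.exp (-‖x + h‖ ^ 2)
      = Real.exp (-(t / (t + 1) * ‖h‖ ^ 2))
        * Real.exp (-((t + 1) * ‖x + (t + 1)⁻¹ • h‖ ^ 2)) := by
  rw [← Real.exp_add, ← Real.exp_add]
  congr 1
  rw [norm_add_sq_real, norm_add_sq_real, norm_smul, inner_smul_right, mul_pow, norm_inv,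
    Real.norm_of_nonneg (by linarith : 0 ≤ t + 1)]
  have : t + 1 ≠ 0 := by positivity
  field_simp
  ring

theorem integrable_gauss_mul_shift {t : ℝ} (ht : 0 < t) (h : E N) :
    Integrable fun x : E N => Real.exp (-(t * ‖x‖ ^ 2)) * Real.exp (-‖x + h‖ ^ 2) := by
  simp_rw [gauss_mul_gauss_shift ht]
  exact ((integrable_gauss_norm (by linarith : 0 < t + 1)).comp_add_right _).const_mul _

theorem integral_gauss_mul_shift {t : ℝ} (ht : 0 < t) (h : E N) :
    ∫ x : E N, Real.exp (-(t * ‖x‖ ^ 2)) * Real.exp (-‖x + h‖ ^ 2)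
      = Real.exp (-(t / (t + 1) * ‖h‖ ^ 2)) * (Real.pi / (t + 1)) ^ ((N : ℝ) / 2) := by
  simp_rw [gauss_mul_gauss_shift ht]
  rw [integral_const_mul, integral_add_right_eq_self (μ := volume)
    (fun x : E N => Real.exp (-((t + 1) * ‖x‖ ^ 2))), integral_gauss_norm (by linarith)]

/-- Gaussians of different widths are monotone functions of each other. -/
theorem gauss_sub_mul_nonneg {t : ℝ} (ht : 0 < t) (x z : E N) :
    0 ≤ (Real.exp (-(t * ‖x‖ ^ 2)) - Real.exp (-(t * ‖z‖ ^ 2)))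
      * (Real.exp (-‖x‖ ^ 2) - Real.exp (-‖z‖ ^ 2)) := by
  rcases le_total (‖x‖ ^ 2) (‖z‖ ^ 2) with h | h
  · exact mul_nonneg (sub_nonneg.2 (Real.exp_le_exp.2 (by nlinarith)))
      (sub_nonneg.2 (Real.exp_le_exp.2 (by linarith)))
  · exact mul_nonneg_of_nonpos_of_nonpos (sub_nonpos.2 (Real.exp_le_exp.2 (by nlinarith)))
      (sub_nonpos.2 (Real.exp_le_exp.2 (by linarith)))

theorem lintegral_gauss_shift {t : ℝ} (ht : 0 < t) (h : E N) :
    ∫⁻ x : E N, ENNReal.ofReal ((Real.exp (-(t * ‖x‖ ^ 2)) - Real.exp (-(t * ‖x + h‖ ^ 2)))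
      * (Real.exp (-‖x‖ ^ 2) - Real.exp (-‖x + h‖ ^ 2)))
      = ENNReal.ofReal (2 * (Real.pi / (t + 1)) ^ ((N : ℝ) / 2)
        * (1 - Real.exp (-(t / (t + 1) * ‖h‖ ^ 2)))) := by
  set G : E N → E N → ℝ := fun h x => Real.exp (-(t * ‖x‖ ^ 2)) * Real.exp (-‖x + h‖ ^ 2)
  have i0 : Integrable (G 0) := integrable_gauss_mul_shift ht 0
  have ih : Integrable (G h) := integrable_gauss_mul_shift ht h
  have i0' : Integrable fun x => G 0 (x + h) := i0.comp_add_right h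
  have ih' : Integrable fun x => G (-h) (x + h) :=
    (integrable_gauss_mul_shift ht (-h)).comp_add_right h
  have hexp : (fun x : E N => (Real.exp (-(t * ‖x‖ ^ 2)) - Real.exp (-(t * ‖x + h‖ ^ 2)))
      * (Real.exp (-‖x‖ ^ 2) - Real.exp (-‖x + h‖ ^ 2)))
      = fun x => (G 0 x - G h x) + (G 0 (x + h) - G (-h) (x + h)) := by
    funext x
    simp only [G, add_zero, add_neg_cancel_right]
    ring
  rw [← ofReal_integral_eq_lintegral_ofReal]
  · rw [hexp, integral_add (f := fun x => G 0 x - G h x)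
      (g := fun x => G 0 (x + h) - G (-h) (x + h)) (i0.sub ih) (i0'.sub ih'), integral_sub i0 ih, integral_sub i0' ih',
      integral_add_right_eq_self (G 0), integral_add_right_eq_self (G (-h))]
    simp only [G, integral_gauss_mul_shift ht]
    congr 1
    simp
    ring
  · rw [hexp]; exact (i0.sub ih).add (i0'.sub ih')
  · exact Eventually.of_forall fun x => gauss_sub_mul_nonneg ht x (x + h)

theorem lintegral_one_sub_gauss_norm [NeZero N] (hs0 : 0 < s) (hs1 : s < 1) {k : ℝ} (hk : 0 < k) :
    ∫⁻ h : E N, ENNReal.ofReal ((1 - Real.exp (-(k * ‖h‖ ^ 2))) / ‖h‖ ^ ((N : ℝ) + 2 * s))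
      = ENNReal.ofReal (sphereArea N * (k ^ s * (Real.Gamma (1 - s) / (2 * s)))) := by
  have hN : 1 ≤ N := NeZero.one_le
  rw [lintegral_polar (by fun_prop)]
  have e : ∀ θ : Metric.sphere (0 : E N) 1, ∫⁻ r, ENNReal.ofReal
      ((1 - Real.exp (-(k * ‖r • (θ : E N)‖ ^ 2))) / ‖r • (θ : E N)‖ ^ ((N : ℝ) + 2 * s))
        ∂powMeasure (N - 1) = ENNReal.ofReal (k ^ s * (Real.Gamma (1 - s) / (2 * s))) := by
    intro θ
    rw [lintegral_powMeasure _ (by fun_prop), ← lintegral_one_sub_gauss hs0 hs1 hk]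
    refine setLIntegral_congr_fun measurableSet_Ioi fun r hr => ?_
    have hr : 0 < r := hr
    have hn : ‖r • (θ : E N)‖ = r := by simp [norm_smul, abs_of_pos hr]
    rw [hn, ← ENNReal.ofReal_mul (by positivity)]
    congr 1
    have : r ^ (-1 - 2 * s) = r ^ (N - 1) / r ^ ((N : ℝ) + 2 * s) := by
      rw [← Real.rpow_natCast, ← Real.rpow_sub hr, Nat.cast_sub hN]; congr 1; push_cast; ring
    rw [this]; ring
  simp_rw [e]
  rw [lintegral_const, sphereArea, ENNReal.ofReal_mul measureReal_nonneg, mul_comm, Measure.real,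
    ENNReal.ofReal_toReal (measure_ne_top _ _)]

/-- The energy of `exp (-t|x|²)` against `exp (-|x|²)` in closed form: in the variables `x` and
`h = z - x` the integral over `x` is Gaussian. -/
theorem energy_gauss [NeZero N] (hs0 : 0 < s) (hs1 : s < 1) {t : ℝ} (ht : 0 < t) :
    ∫⁻ x : E N, ∫⁻ z : E N, ENNReal.ofReal
      ((Real.exp (-(t * ‖x‖ ^ 2)) - Real.exp (-(t * ‖z‖ ^ 2)))
      * (Real.exp (-‖x‖ ^ 2) - Real.exp (-‖z‖ ^ 2)) / ‖x - z‖ ^ ((N : ℝ) + 2 * s))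
      = ENNReal.ofReal (sphereArea N * Real.pi ^ ((N : ℝ) / 2) * (Real.Gamma (1 - s) / s)
        * (t ^ s * (t + 1) ^ (-(s + (N : ℝ) / 2)))) := by
  have hpi := Real.pi_pos
  have e1 : ∀ x : E N, ∫⁻ z : E N, ENNReal.ofReal
      ((Real.exp (-(t * ‖x‖ ^ 2)) - Real.exp (-(t * ‖z‖ ^ 2)))
      * (Real.exp (-‖x‖ ^ 2) - Real.exp (-‖z‖ ^ 2)) / ‖x - z‖ ^ ((N : ℝ) + 2 * s))
      = ∫⁻ h : E N, ENNReal.ofReal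
      ((Real.exp (-(t * ‖x‖ ^ 2)) - Real.exp (-(t * ‖x + h‖ ^ 2)))
      * (Real.exp (-‖x‖ ^ 2) - Real.exp (-‖x + h‖ ^ 2)) / ‖h‖ ^ ((N : ℝ) + 2 * s)) := by
    intro x
    rw [← lintegral_add_left_eq_self (μ := (volume : Measure (E N))) _ x]
    refine lintegral_congr fun h => ?_
    rw [sub_add_cancel_left, norm_neg]
  simp_rw [e1]
  rw [lintegral_lintegral_swap (by fun_prop)]
  have e2 : ∀ h : E N, ∫⁻ x : E N, ENNReal.ofReal
      ((Real.exp (-(t * ‖x‖ ^ 2)) - Real.exp (-(t * ‖x + h‖ ^ 2)))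
      * (Real.exp (-‖x‖ ^ 2) - Real.exp (-‖x + h‖ ^ 2)) / ‖h‖ ^ ((N : ℝ) + 2 * s))
      = ENNReal.ofReal (2 * (Real.pi / (t + 1)) ^ ((N : ℝ) / 2)) *
        ENNReal.ofReal ((1 - Real.exp (-(t / (t + 1) * ‖h‖ ^ 2))) / ‖h‖ ^ ((N : ℝ) + 2 * s)) := by
    intro h
    simp_rw [div_eq_mul_inv _ (‖h‖ ^ ((N : ℝ) + 2 * s)),
      fun x : E N => ENNReal.ofReal_mul (q := (‖h‖ ^ ((N : ℝ) + 2 * s))⁻¹)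
        (gauss_sub_mul_nonneg ht x (x + h))]
    rw [lintegral_mul_const _ (by fun_prop), lintegral_gauss_shift ht,
      ← ENNReal.ofReal_mul' (by positivity), ← ENNReal.ofReal_mul (by positivity)]
    congr 1; ring
  simp_rw [e2]
  rw [lintegral_const_mul _ (by fun_prop), lintegral_one_sub_gauss_norm hs0 hs1 (by positivity),
    ← ENNReal.ofReal_mul (by positivity)]
  congr 1
  have h1 : 0 < t + 1 := by linarith
  rw [Real.div_rpow hpi.le h1.le, Real.div_rpow ht.le h1.le, neg_add, Real.rpow_add h1,
    Real.rpow_neg h1.le, Real.rpow_neg h1.le]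
  field_simp

end FracHardy

namespace FracHardy

open scoped ENNReal

variable {N : ℕ} {s : ℝ}

/-! ### The value of the coefficient at the critical exponent -/

/-- The power `|x|^(-2a)` is a superposition of Gaussians, `Γ(a) |x|^(-2a) = ∫₀^∞ t^(a-1) exp (-t|x|²) dt`. -/
theorem lintegral_subordination {a : ℝ} (ha : 0 < a) {κ : ℝ} {x z : E N} (hx : x ≠ 0)
    (hz : z ≠ 0) :
    ∫⁻ t in Ioi (0 : ℝ), ENNReal.ofReal (t ^ (a - 1)) * ENNReal.ofReal
        ((Real.exp (-(t * ‖x‖ ^ 2)) - Real.exp (-(t * ‖z‖ ^ 2)))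
          * (Real.exp (-‖x‖ ^ 2) - Real.exp (-‖z‖ ^ 2)) / ‖x - z‖ ^ κ)
      = ENNReal.ofReal (Real.Gamma a) * ENNReal.ofReal ((‖x‖ ^ (-(2 * a)) - ‖z‖ ^ (-(2 * a)))
          * (Real.exp (-‖x‖ ^ 2) - Real.exp (-‖z‖ ^ 2)) / ‖x - z‖ ^ κ) := by
  have hx0 : 0 < ‖x‖ := norm_pos_iff.2 hx
  have hz0 : 0 < ‖z‖ := norm_pos_iff.2 hz
  have hG := Real.Gamma_pos_of_pos ha
  set c := (Real.exp (-‖x‖ ^ 2) - Real.exp (-‖z‖ ^ 2)) / ‖x - z‖ ^ κ with hc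
  have ix := integrableOn_rpow_mul_exp ha (pow_pos hx0 2)
  have iz := integrableOn_rpow_mul_exp ha (pow_pos hz0 2)
  have e : ∀ t ∈ Ioi (0 : ℝ), ENNReal.ofReal (t ^ (a - 1)) * ENNReal.ofReal
        ((Real.exp (-(t * ‖x‖ ^ 2)) - Real.exp (-(t * ‖z‖ ^ 2)))
          * (Real.exp (-‖x‖ ^ 2) - Real.exp (-‖z‖ ^ 2)) / ‖x - z‖ ^ κ)
      = ENNReal.ofReal ((t ^ (a - 1) * Real.exp (-(‖x‖ ^ 2 * t))
          - t ^ (a - 1) * Real.exp (-(‖z‖ ^ 2 * t))) * c) := by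
    intro t ht
    have ht : 0 < t := ht
    rw [← ENNReal.ofReal_mul (by positivity), hc, mul_comm t, mul_comm t]
    congr 1; ring
  rw [setLIntegral_congr_fun measurableSet_Ioi e, setLIntegral_ofReal measurableSet_Ioi
    (f := fun t => (t ^ (a - 1) * Real.exp (-(‖x‖ ^ 2 * t))
          - t ^ (a - 1) * Real.exp (-(‖z‖ ^ 2 * t))) * c) ((ix.sub iz).mul_const c), integral_mul_const, integral_sub ix iz,
    Real.integral_rpow_mul_exp_neg_mul_Ioi ha (pow_pos hx0 2),
    Real.integral_rpow_mul_exp_neg_mul_Ioi ha (pow_pos hz0 2), ← ENNReal.ofReal_mul hG.le]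
  · have hp : ∀ r : ℝ, 0 < r → (1 / r ^ 2) ^ a = r ^ (-(2 * a)) := by
      intro r hr
      rw [one_div, Real.inv_rpow (by positivity), Real.rpow_neg hr.le, Real.rpow_mul hr.le,
        Real.rpow_two]
    rw [hp _ hx0, hp _ hz0, hc]
    congr 1; ring
  · intro t ht
    have ht : 0 < t := ht
    have h := gauss_sub_mul_nonneg ht x z
    rw [← mul_sub, hc, mul_assoc, mul_div_assoc', mul_comm (‖x‖ ^ 2), mul_comm (‖z‖ ^ 2)]
    exact mul_nonneg (by positivity) (div_nonneg h (by positivity))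

/-- The energy of the pair `|x|^(-2a)`, `exp (-|x|²)`, by subordination to Gaussians. -/
theorem energy_subordination [NeZero N] (hs0 : 0 < s) (hs1 : s < 1)
    (hsN : 2 * s < N) :
    ENNReal.ofReal (Real.Gamma (((N : ℝ) + 2 * s) / 2)) *
      (ENNReal.ofReal (Real.Gamma (((N : ℝ) - 2 * s) / 4)) * ∫⁻ x : E N, ∫⁻ z : E N,
        ENNReal.ofReal ((‖x‖ ^ ((2 * s - N) / 2) - ‖z‖ ^ ((2 * s - N) / 2))
          * (Real.exp (-‖x‖ ^ 2) - Real.exp (-‖z‖ ^ 2)) / ‖x - z‖ ^ ((N : ℝ) + 2 * s)))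
      = ENNReal.ofReal (sphereArea N * Real.pi ^ ((N : ℝ) / 2) * (Real.Gamma (1 - s) / s)
          * Real.Gamma (((N : ℝ) + 2 * s) / 4) ^ 2) := by
  have ha : 0 < ((N : ℝ) - 2 * s) / 4 := by linarith
  have hG1 : 0 < Real.Gamma (1 - s) := Real.Gamma_pos_of_pos (by linarith)
  have hpi := Real.pi_pos
  have hω : 0 ≤ sphereArea N := measureReal_nonneg
  set a := ((N : ℝ) - 2 * s) / 4 with hadef
  have hexp : (2 * s - (N : ℝ)) / 2 = -(2 * a) := by rw [hadef]; ring
  have h1 : ENNReal.ofReal (Real.Gamma a) * ∫⁻ x : E N, ∫⁻ z : E N,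
        ENNReal.ofReal ((‖x‖ ^ ((2 * s - N) / 2) - ‖z‖ ^ ((2 * s - N) / 2))
          * (Real.exp (-‖x‖ ^ 2) - Real.exp (-‖z‖ ^ 2)) / ‖x - z‖ ^ ((N : ℝ) + 2 * s))
      = ∫⁻ x : E N, ∫⁻ z : E N, ∫⁻ t in Ioi (0 : ℝ), ENNReal.ofReal (t ^ (a - 1)) *
        ENNReal.ofReal ((Real.exp (-(t * ‖x‖ ^ 2)) - Real.exp (-(t * ‖z‖ ^ 2)))
          * (Real.exp (-‖x‖ ^ 2) - Real.exp (-‖z‖ ^ 2)) / ‖x - z‖ ^ ((N : ℝ) + 2 * s)) := by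
    rw [← lintegral_const_mul _ (by fun_prop)]
    refine lintegral_congr_ae ?_
    filter_upwards [ae_ne_zero (N := N)] with x hx
    rw [← lintegral_const_mul _ (by fun_prop)]
    refine lintegral_congr_ae ?_
    filter_upwards [ae_ne_zero (N := N)] with z hz
    rw [lintegral_subordination ha hx hz, hexp]
  have h2 : ∫⁻ x : E N, ∫⁻ z : E N, ∫⁻ t in Ioi (0 : ℝ), ENNReal.ofReal (t ^ (a - 1)) *
        ENNReal.ofReal ((Real.exp (-(t * ‖x‖ ^ 2)) - Real.exp (-(t * ‖z‖ ^ 2)))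
          * (Real.exp (-‖x‖ ^ 2) - Real.exp (-‖z‖ ^ 2)) / ‖x - z‖ ^ ((N : ℝ) + 2 * s))
      = ∫⁻ t in Ioi (0 : ℝ), ∫⁻ x : E N, ∫⁻ z : E N, ENNReal.ofReal (t ^ (a - 1)) *
        ENNReal.ofReal ((Real.exp (-(t * ‖x‖ ^ 2)) - Real.exp (-(t * ‖z‖ ^ 2)))
          * (Real.exp (-‖x‖ ^ 2) - Real.exp (-‖z‖ ^ 2)) / ‖x - z‖ ^ ((N : ℝ) + 2 * s)) := by
    rw [lintegral_congr fun x => lintegral_lintegral_swap (by fun_prop),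
      lintegral_lintegral_swap (by fun_prop)]
  have h3 : ∀ t ∈ Ioi (0 : ℝ), ∫⁻ x : E N, ∫⁻ z : E N, ENNReal.ofReal (t ^ (a - 1)) *
        ENNReal.ofReal ((Real.exp (-(t * ‖x‖ ^ 2)) - Real.exp (-(t * ‖z‖ ^ 2)))
          * (Real.exp (-‖x‖ ^ 2) - Real.exp (-‖z‖ ^ 2)) / ‖x - z‖ ^ ((N : ℝ) + 2 * s))
      = ENNReal.ofReal (sphereArea N * Real.pi ^ ((N : ℝ) / 2) * (Real.Gamma (1 - s) / s)) *
        ENNReal.ofReal (t ^ (((N : ℝ) + 2 * s) / 4 - 1)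
          * (t + 1) ^ (-(((N : ℝ) + 2 * s) / 4 + ((N : ℝ) + 2 * s) / 4))) := by
    intro t ht
    have ht : 0 < t := ht
    simp_rw [lintegral_const_mul' (ENNReal.ofReal (t ^ (a - 1))) _ ENNReal.ofReal_ne_top]
    rw [energy_gauss hs0 hs1 ht, ← ENNReal.ofReal_mul (by positivity),
      ← ENNReal.ofReal_mul (by positivity)]
    have e1 : t ^ (((N : ℝ) + 2 * s) / 4 - 1) = t ^ (a - 1) * t ^ s := by
      rw [← Real.rpow_add ht, hadef]; congr 1; ring
    have e2 : -(((N : ℝ) + 2 * s) / 4 + ((N : ℝ) + 2 * s) / 4) = -(s + (N : ℝ) / 2) := by ring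
    rw [e1, e2]
    congr 1; ring
  have hq : 0 < ((N : ℝ) + 2 * s) / 4 := by positivity
  have hb := lintegral_beta hq hq
  have e3 : ((N : ℝ) + 2 * s) / 4 + ((N : ℝ) + 2 * s) / 4 = ((N : ℝ) + 2 * s) / 2 := by ring
  rw [h1, h2, setLIntegral_congr_fun measurableSet_Ioi h3, lintegral_const_mul _ (by fun_prop),
    mul_left_comm, ← e3, hb, ← ENNReal.ofReal_mul (by positivity), sq]

/-- The radial integral of the energy in polar pair coordinates: it turns the Gaussian factor into the
second factor `1 - |y|^((2s-N)/2)`, whence the square. -/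
theorem inner_polar_energy [NeZero N] (hsN : 2 * s < N) {θ y : E N} (hθ : ‖θ‖ = 1) (hy : y ≠ 0) :
    ∫⁻ r in Ioi (0 : ℝ), ENNReal.ofReal (r ^ (2 * N - 1)) *
        ENNReal.ofReal ((‖r • θ‖ ^ ((2 * s - N) / 2) - ‖r • y‖ ^ ((2 * s - N) / 2))
          * (Real.exp (-‖r • θ‖ ^ 2) - Real.exp (-‖r • y‖ ^ 2))
            / ‖r • θ - r • y‖ ^ ((N : ℝ) + 2 * s))
      = ENNReal.ofReal (Real.Gamma (((N : ℝ) - 2 * s) / 4) / 2) * ENNReal.ofReal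
        ((1 - ‖y‖ ^ ((2 * s - N) / 2)) ^ 2 / ‖θ - y‖ ^ ((N : ℝ) + 2 * s)) := by
  have hN : 1 ≤ N := NeZero.one_le
  have hσ : 0 < ‖y‖ := norm_pos_iff.2 hy
  set σ := ‖y‖ with hσd
  have hm : 0 < ((N : ℝ) - 2 * s) / 2 := by linarith
  have hG : 0 < Real.Gamma (((N : ℝ) - 2 * s) / 4) := Real.Gamma_pos_of_pos (by linarith)
  set c := (1 - σ ^ ((2 * s - (N : ℝ)) / 2)) / ‖θ - y‖ ^ ((N : ℝ) + 2 * s) with hc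
  have i1 := integrableOn_rpow_mul_gauss hm one_pos
  have i2 := integrableOn_rpow_mul_gauss hm (pow_pos hσ 2)
  have e : ∀ r ∈ Ioi (0 : ℝ), ENNReal.ofReal (r ^ (2 * N - 1)) *
        ENNReal.ofReal ((‖r • θ‖ ^ ((2 * s - N) / 2) - ‖r • y‖ ^ ((2 * s - N) / 2))
          * (Real.exp (-‖r • θ‖ ^ 2) - Real.exp (-‖r • y‖ ^ 2))
            / ‖r • θ - r • y‖ ^ ((N : ℝ) + 2 * s))
      = ENNReal.ofReal ((r ^ (((N : ℝ) - 2 * s) / 2 - 1) * Real.exp (-(1 * r ^ 2))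
          - r ^ (((N : ℝ) - 2 * s) / 2 - 1) * Real.exp (-(σ ^ 2 * r ^ 2))) * c) := by
    intro r hr
    have hr : 0 < r := hr
    rw [← ENNReal.ofReal_mul (by positivity), ← smul_sub, norm_smul, norm_smul, norm_smul, hθ,
      Real.norm_of_nonneg hr.le, mul_one, ← hσd, Real.mul_rpow hr.le hσ.le,
      Real.mul_rpow hr.le (norm_nonneg _), hc]
    have e1 : r ^ (((N : ℝ) - 2 * s) / 2 - 1)
        = r ^ (2 * N - 1) * r ^ ((2 * s - (N : ℝ)) / 2) / r ^ ((N : ℝ) + 2 * s) := by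
      rw [← Real.rpow_natCast, ← Real.rpow_add hr, ← Real.rpow_sub hr,
        Nat.cast_sub (by omega)]
      congr 1; push_cast; ring
    rw [e1, one_mul, mul_pow, mul_comm (r ^ 2)]
    congr 1
    simp only [div_eq_mul_inv, mul_inv]
    ring
  have hpow : (σ ^ 2) ^ (-(((N : ℝ) - 2 * s) / 2 / 2)) = σ ^ ((2 * s - (N : ℝ)) / 2) := by
    rw [← Real.rpow_two, ← Real.rpow_mul hσ.le]; congr 1; ring
  have hval : ∫ r in Ioi (0 : ℝ), (r ^ (((N : ℝ) - 2 * s) / 2 - 1) * Real.exp (-(1 * r ^ 2))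
          - r ^ (((N : ℝ) - 2 * s) / 2 - 1) * Real.exp (-(σ ^ 2 * r ^ 2))) * c
      = Real.Gamma (((N : ℝ) - 2 * s) / 4) / 2 *
        ((1 - σ ^ ((2 * s - N) / 2)) ^ 2 / ‖θ - y‖ ^ ((N : ℝ) + 2 * s)) := by
    rw [integral_mul_const, integral_sub i1 i2, integral_rpow_mul_gauss hm one_pos,
      integral_rpow_mul_gauss hm (pow_pos hσ 2), hpow, Real.one_rpow, hc,
      show ((N : ℝ) - 2 * s) / 2 / 2 = ((N : ℝ) - 2 * s) / 4 by ring]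
    ring
  rw [setLIntegral_congr_fun measurableSet_Ioi e, setLIntegral_ofReal measurableSet_Ioi
    (f := fun r => (r ^ (((N : ℝ) - 2 * s) / 2 - 1) * Real.exp (-(1 * r ^ 2))
          - r ^ (((N : ℝ) - 2 * s) / 2 - 1) * Real.exp (-(σ ^ 2 * r ^ 2))) * c)
    ((i1.sub i2).mul_const c), hval, ← ENNReal.ofReal_mul (by positivity)]
  intro r hr
  have hr : 0 < r := hr
  rw [← mul_sub, hc, mul_assoc, mul_div_assoc']
  refine mul_nonneg (by positivity) (div_nonneg ?_ (by positivity))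
  rcases le_total σ 1 with h | h
  · refine mul_nonneg_of_nonpos_of_nonpos (sub_nonpos.2 (Real.exp_le_exp.2 ?_))
      (sub_nonpos.2 (Real.one_le_rpow_of_pos_of_le_one_of_nonpos hσ h (by linarith)))
    have : σ ^ 2 ≤ 1 := pow_le_one₀ hσ.le h
    nlinarith [sq_nonneg r]
  · refine mul_nonneg (sub_nonneg.2 (Real.exp_le_exp.2 ?_))
      (sub_nonneg.2 (Real.rpow_le_one_of_one_le_of_nonpos h (by linarith)))
    have : 1 ≤ σ ^ 2 := one_le_pow₀ h
    nlinarith [sq_nonneg r]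

theorem lintegral_split_unit [NeZero N] (f : E N → ℝ≥0∞) :
    ∫⁻ y, f y = (∫⁻ y in punctured N, f y) + ∫⁻ y in {y | 1 < ‖y‖}, f y := by
  have hm : MeasurableSet {y : E N | 1 < ‖y‖} := measurableSet_lt measurable_const measurable_norm
  have hd : Disjoint (punctured N) {z : E N | 1 < ‖z‖} := by
    rw [Set.disjoint_left]
    intro z hz hz'
    exact absurd hz.2 (not_lt.2 (le_of_lt hz'))
  rw [← lintegral_union hm hd, ← setLIntegral_univ]
  refine setLIntegral_congr ?_
  filter_upwards [ae_norm_ne_one (N := N), ae_ne_zero (N := N)] with z h1 h0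
  have h0 : 0 < ‖z‖ := norm_pos_iff.2 h0
  apply propext
  refine ⟨fun _ => ?_, fun _ => trivial⟩
  rcases lt_or_gt_of_ne h1 with h | h
  · exact Or.inl ⟨h0, h⟩
  · exact Or.inr h

theorem lintegral_critical_square [NeZero N] (hs0 : 0 < s) (hs1 : s < 1) :
    ∫⁻ y : E N, ENNReal.ofReal
        ((1 - ‖y‖ ^ ((2 * s - N) / 2)) ^ 2 / ‖e1 N - y‖ ^ ((N : ℝ) + 2 * s))
      = ENNReal.ofReal (2 * (powCoeff N s ((2 * s - N) / 2) / fracConst N s)) := by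
  have hN : (1 : ℝ) ≤ N := by exact_mod_cast NeZero.one_le
  have hC := fracConst_pos (N := N) hs0 hs1
  have hi := integrableOn_powCoeff (N := N) (τ := (2 * s - N) / 2) hs0 hs1 (by linarith)
    (by linarith)
  have hb : 2 * s - (N : ℝ) - (2 * s - N) / 2 = (2 * s - N) / 2 := by ring
  have hP : powCoeff N s ((2 * s - N) / 2) / fracConst N s = ∫ y in punctured N,
      (1 - ‖y‖ ^ ((2 * s - N) / 2)) ^ 2 / ‖e1 N - y‖ ^ ((N : ℝ) + 2 * s) := by
    rw [powCoeff, mul_div_cancel_left₀ _ hC.ne']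
    simp_rw [hb, ← sq]
  simp_rw [hb, ← sq] at hi
  have h1 : ∫⁻ y in punctured N, ENNReal.ofReal
        ((1 - ‖y‖ ^ ((2 * s - N) / 2)) ^ 2 / ‖e1 N - y‖ ^ ((N : ℝ) + 2 * s))
      = ENNReal.ofReal (powCoeff N s ((2 * s - N) / 2) / fracConst N s) := by
    rw [setLIntegral_ofReal measurableSet_punctured hi (fun y _ => by positivity), hP]
  have hP0 : 0 ≤ powCoeff N s ((2 * s - N) / 2) / fracConst N s := by
    rw [hP]
    exact setIntegral_nonneg measurableSet_punctured fun y _ => by positivity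
  rw [lintegral_split_unit, lintegral_outside, two_mul (powCoeff N s ((2 * s - N) / 2) / fracConst N s), ENNReal.ofReal_add hP0 hP0, h1]
  congr 1
  rw [← h1]
  refine setLIntegral_congr_fun measurableSet_punctured fun y hy => ?_
  have hy0 : 0 < ‖y‖ := hy.1
  rw [← ENNReal.ofReal_mul (by positivity), inversion_weight (norm_pos_iff.1 hy0), norm_inv0]
  congr 2
  have e1 : ‖y‖ ^ (2 * s - (N : ℝ)) = (‖y‖ ^ ((2 * s - (N : ℝ)) / 2)) ^ 2 := by
    rw [← Real.rpow_natCast, ← Real.rpow_mul hy0.le]; congr 1; push_cast; ring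
  have e2 : ‖y‖ ^ ((2 * s - (N : ℝ)) / 2) ≠ 0 := by positivity
  rw [e1, Real.inv_rpow hy0.le]
  field_simp
  ring

/-- The same energy in the coordinates of `map_polarPair`: it is a multiple of the coefficient
at the critical exponent. -/
theorem energy_polar [NeZero N] (hs0 : 0 < s) (hs1 : s < 1) (hsN : 2 * s < N) :
    ∫⁻ x : E N, ∫⁻ z : E N,
        ENNReal.ofReal ((‖x‖ ^ ((2 * s - N) / 2) - ‖z‖ ^ ((2 * s - N) / 2))
          * (Real.exp (-‖x‖ ^ 2) - Real.exp (-‖z‖ ^ 2)) / ‖x - z‖ ^ ((N : ℝ) + 2 * s))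
      = ENNReal.ofReal (sphereArea N * (Real.Gamma (((N : ℝ) - 2 * s) / 4)
        * (powCoeff N s ((2 * s - N) / 2) / fracConst N s))) := by
  have hG : 0 < Real.Gamma (((N : ℝ) - 2 * s) / 4) := Real.Gamma_pos_of_pos (by linarith)
  rw [lintegral_polarPair (by fun_prop)]
  have e : ∀ θ : Metric.sphere (0 : E N) 1, ∫⁻ y : E N, ∫⁻ r in Ioi (0 : ℝ),
      ENNReal.ofReal (r ^ (2 * N - 1)) *
        ENNReal.ofReal ((‖r • (θ : E N)‖ ^ ((2 * s - N) / 2) - ‖r • y‖ ^ ((2 * s - N) / 2))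
          * (Real.exp (-‖r • (θ : E N)‖ ^ 2) - Real.exp (-‖r • y‖ ^ 2))
            / ‖r • (θ : E N) - r • y‖ ^ ((N : ℝ) + 2 * s))
      = ENNReal.ofReal (Real.Gamma (((N : ℝ) - 2 * s) / 4)
        * (powCoeff N s ((2 * s - N) / 2) / fracConst N s)) := by
    intro θ
    have hθ : ‖(θ : E N)‖ = 1 := by simp
    have e1 : ∀ᵐ y : E N, ∫⁻ r in Ioi (0 : ℝ),
      ENNReal.ofReal (r ^ (2 * N - 1)) *
        ENNReal.ofReal ((‖r • (θ : E N)‖ ^ ((2 * s - N) / 2) - ‖r • y‖ ^ ((2 * s - N) / 2))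
          * (Real.exp (-‖r • (θ : E N)‖ ^ 2) - Real.exp (-‖r • y‖ ^ 2))
            / ‖r • (θ : E N) - r • y‖ ^ ((N : ℝ) + 2 * s))
      = ENNReal.ofReal (Real.Gamma (((N : ℝ) - 2 * s) / 4) / 2) * ENNReal.ofReal
        ((1 - ‖y‖ ^ ((2 * s - N) / 2)) ^ 2 / ‖(θ : E N) - y‖ ^ ((N : ℝ) + 2 * s)) := by
      filter_upwards [ae_ne_zero (N := N)] with y hy
      exact inner_polar_energy hsN hθ hy
    rw [lintegral_congr_ae e1, lintegral_const_mul _ (by fun_prop),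
      lintegral_rotate (fun a b => ENNReal.ofReal
        ((1 - a ^ ((2 * s - N) / 2)) ^ 2 / b ^ ((N : ℝ) + 2 * s))) hθ,
      lintegral_critical_square hs0 hs1, ← ENNReal.ofReal_mul (by positivity)]
    congr 1; ring
  simp_rw [e]
  rw [lintegral_const, sphereArea, ENNReal.ofReal_mul measureReal_nonneg, mul_comm, Measure.real,
    ENNReal.ofReal_toReal (measure_ne_top _ _)]

theorem sphereArea_pos [NeZero N] : 0 < sphereArea N := by
  have hN : 0 < N := Nat.pos_of_ne_zero (NeZero.ne N)
  rw [sphereArea, Measure.toSphere_real_apply_univ]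
  have hVpos : 0 < volume.real (Metric.ball (0 : E N) 1) := ENNReal.toReal_pos
    (Metric.isOpen_ball.measure_pos volume ⟨0, by simp⟩).ne' measure_ball_lt_top.ne
  simp only [finrank_euclideanSpace, Fintype.card_fin]
  positivity

/-- Comparison of the two evaluations of the energy of `|x|^((2s-N)/2)` against `exp (-|x|²)`
identifies the Hardy constant. -/
theorem powCoeff_critical [NeZero N] (hs0 : 0 < s) (hs1 : s < 1) (hsN : 2 * s < N) :
    powCoeff N s ((2 * s - N) / 2) = -mu0 N s := by
  have hC := fracConst_pos (N := N) hs0 hs1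
  have hω := sphereArea_pos (N := N)
  have hG : 0 < Real.Gamma (((N : ℝ) - 2 * s) / 4) := Real.Gamma_pos_of_pos (by linarith)
  have hG2 : 0 < Real.Gamma (((N : ℝ) + 2 * s) / 2) := Real.Gamma_pos_of_pos (by positivity)
  have hG3 : 0 < Real.Gamma (1 - s) := Real.Gamma_pos_of_pos (by linarith)
  have hG4 : 0 < Real.Gamma (((N : ℝ) + 2 * s) / 4) := Real.Gamma_pos_of_pos (by positivity)
  have hpi := Real.pi_pos
  have h := energy_subordination (N := N) hs0 hs1 hsN
  rw [energy_polar hs0 hs1 hsN, ← ENNReal.ofReal_mul hG.le, ← ENNReal.ofReal_mul hG2.le] at h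
  have hP0 : 0 ≤ powCoeff N s ((2 * s - N) / 2) / fracConst N s := by
    refine div_nonneg (mul_nonneg hC.le ?_) hC.le
    refine setIntegral_nonneg measurableSet_punctured fun y _ => ?_
    have hb : 2 * s - (N : ℝ) - (2 * s - N) / 2 = (2 * s - N) / 2 := by ring
    rw [hb, ← sq]
    positivity
  rw [ENNReal.ofReal_eq_ofReal_iff (by positivity) (by positivity)] at h
  have h2 : powCoeff N s ((2 * s - N) / 2) = fracConst N s * (Real.pi ^ ((N : ℝ) / 2)
      * (Real.Gamma (1 - s) / s) * Real.Gamma (((N : ℝ) + 2 * s) / 4) ^ 2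
      / (Real.Gamma (((N : ℝ) + 2 * s) / 2) * Real.Gamma (((N : ℝ) - 2 * s) / 4) ^ 2)) := by
    field_simp at h ⊢
    linarith
  rw [h2, mu0, neg_neg, fracConst, Real.rpow_neg hpi.le]
  field_simp

end FracHardy

namespace FracHardy

variable {N : ℕ} {s : ℝ}

/-! ### The exponents -/

theorem contDiffOn_rpow_norm (τ : ℝ) : ContDiffOn ℝ ∞ (fun x : E N => ‖x‖ ^ τ) {0}ᶜ :=
  fun _ hx => ((contDiffAt_norm ℝ hx).rpow_const_of_ne (norm_ne_zero_iff.2 hx)).contDiffWithinAt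

theorem contDiffOn_rpow_norm_log (τ : ℝ) :
    ContDiffOn ℝ ∞ (fun x : E N => ‖x‖ ^ τ * Real.log ‖x‖) {0}ᶜ :=
  (contDiffOn_rpow_norm τ).mul fun _ hx =>
    ((contDiffAt_norm ℝ hx).log (norm_ne_zero_iff.2 hx)).contDiffWithinAt

theorem one_add_rpow_le {κ r : ℝ} (hκ : 0 ≤ κ) (hr : 0 ≤ r) :
    (1 + r) ^ κ ≤ 2 ^ κ * (1 + r ^ κ) := by
  have h2 : 0 ≤ r ^ κ := by positivity
  rcases le_total r 1 with h | h
  · calc (1 + r) ^ κ ≤ 2 ^ κ := by gcongr; linarith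
      _ ≤ 2 ^ κ * (1 + r ^ κ) := le_mul_of_one_le_right (by positivity) (by linarith)
  · calc (1 + r) ^ κ ≤ (2 * r) ^ κ := by gcongr; linarith
      _ = 2 ^ κ * r ^ κ := Real.mul_rpow two_pos.le hr
      _ ≤ 2 ^ κ * (1 + r ^ κ) := by gcongr; linarith

theorem RadialProfile.integrable_div [NeZero N] {g : ℝ → ℝ} (hg : RadialProfile N s g)
    (hs0 : 0 < s) :
    Integrable fun x : E N => g ‖x‖ / (1 + ‖x‖ ^ ((N : ℝ) + 2 * s)) := by
  obtain ⟨D, p, q, hp, hp', hq, hq', hD⟩ := hg.growth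
  have hm := hg.measurable
  have hκ := kappa_pos (N := N) hs0
  have h1 := integrable_rpow_norm_mul_one_add (N := N) (q := -(N + 2 * s)) hp (by linarith)
    (by linarith)
  have h2 := integrable_rpow_norm_mul_one_add (N := N) (q := -(N + 2 * s)) hq (by linarith)
    (by linarith)
  refine Integrable.mono' ((h1.add h2).const_mul (D * 2 ^ ((N : ℝ) + 2 * s)))
    (by fun_prop : Measurable _).aestronglyMeasurable ?_
  filter_upwards [ae_ne_zero (N := N)] with x hx
  have h := hD ‖x‖ (norm_pos_iff.2 hx)
  have hpos : 0 < 1 + ‖x‖ ^ ((N : ℝ) + 2 * s) := by positivity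
  have h3 : 0 < 1 + ‖x‖ := by positivity
  rw [norm_div, Real.norm_of_nonneg hpos.le, Pi.add_apply, ← add_mul, Real.rpow_neg h3.le]
  have h4 := one_add_rpow_le (by linarith : 0 ≤ (N : ℝ) + 2 * s) (norm_nonneg x)
  rw [div_le_iff₀ hpos]
  have h5 : 1 ≤ 2 ^ ((N : ℝ) + 2 * s) * ((1 + ‖x‖) ^ ((N : ℝ) + 2 * s))⁻¹
      * (1 + ‖x‖ ^ ((N : ℝ) + 2 * s)) := by
    rw [mul_right_comm, ← div_eq_mul_inv, one_le_div (by positivity)]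
    exact h4
  calc ‖g ‖x‖‖ ≤ D * (‖x‖ ^ p + ‖x‖ ^ q) := h
    _ ≤ D * (‖x‖ ^ p + ‖x‖ ^ q) * (2 ^ ((N : ℝ) + 2 * s) * ((1 + ‖x‖) ^ ((N : ℝ) + 2 * s))⁻¹
      * (1 + ‖x‖ ^ ((N : ℝ) + 2 * s))) :=
        le_mul_of_one_le_right ((abs_nonneg _).trans h) h5
    _ = _ := by ring

theorem isHardySolution_rpow_iff [NeZero N] (hs0 : 0 < s) (hs1 : s < 1) {μ τ : ℝ}
    (h1 : -(N : ℝ) < τ) (h2 : τ < 2 * s) :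
    IsHardySolution s μ (fun x : E N => ‖x‖ ^ τ) ↔ powCoeff N s τ = -μ := by
  constructor
  · intro h
    have h3 := (h.2.2 (e1 N) e1_ne_zero).unique (hasFracLap_rpow_e1 hs0 hs1 h1 h2)
    simpa [norm_e1] using h3.symm
  · intro h
    refine ⟨contDiffOn_rpow_norm τ, (radialProfile_rpow h1 h2).integrable_div hs0, fun x hx => ?_⟩
    have h3 := hasFracLap_rpow hs0 hs1 h1 h2 hx
    have hx0 : 0 < ‖x‖ := norm_pos_iff.2 hx
    rw [h, Real.rpow_sub hx0] at h3
    convert h3 using 1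
    ring

theorem isHardySolution_log [NeZero N] (hs0 : 0 < s) (hs1 : s < 1) {μ τ : ℝ}
    (h1 : -(N : ℝ) < τ) (h2 : τ < 2 * s) (hp : powCoeff N s τ = -μ) (hl : logCoeff N s τ = 0) :
    IsHardySolution s μ (fun x : E N => -(‖x‖ ^ τ * Real.log ‖x‖)) := by
  refine ⟨(contDiffOn_rpow_norm_log τ).neg, ?_, fun x hx => ?_⟩
  · refine ((radialProfile_rpow_log h1 h2).integrable_div hs0).neg.congr
      (Eventually.of_forall fun x => ?_)
    simp only [Pi.neg_apply, neg_div]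
  · have h3 := (hasFracLap_rpow_log hs0 hs1 h1 h2 hx).const_mul (-1)
    have hx0 : 0 < ‖x‖ := norm_pos_iff.2 hx
    rw [hp, hl, Real.rpow_sub hx0] at h3
    simp only [neg_mul, one_mul] at h3
    convert h3 using 1
    ring

theorem logCoeff_eq_zero_of_isHardySolution [NeZero N] (hs0 : 0 < s) (hs1 : s < 1) {μ τ : ℝ}
    (h1 : -(N : ℝ) < τ) (h2 : τ < 2 * s)
    (h : IsHardySolution s μ (fun x : E N => -(‖x‖ ^ τ * Real.log ‖x‖))) :
    logCoeff N s τ = 0 := by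
  have h3 := (hasFracLap_rpow_log_e1 (N := N) hs0 hs1 h1 h2).const_mul (-1)
  simp only [neg_mul, one_mul] at h3
  have h4 := (h.2.2 (e1 N) e1_ne_zero).unique h3
  simpa [norm_e1] using h4

/-- Both exponents are determined by one root `τ` of `powCoeff N s τ = -μ` in
`(-N, (2s-N)/2]`. -/
theorem exists_exponents (hN : 2 ≤ N) (hs0 : 0 < s) (hs1 : s < 1) {μ : ℝ} (hμ : mu0 N s ≤ μ) :
    ∃ τ : ℝ, -(N : ℝ) < τ ∧ τ ≤ (2 * s - N) / 2 ∧ (μ = mu0 N s ↔ τ = (2 * s - N) / 2) ∧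
      (∀ t, IsTauMinus N s μ t ↔ t = τ) ∧ (∀ t, IsTauPlus N s μ t ↔ t = 2 * s - N - τ) := by
  have : NeZero N := ⟨by omega⟩
  have hN' : (2 : ℝ) ≤ N := by exact_mod_cast hN
  have hcrit := powCoeff_critical (N := N) hs0 hs1 (by linarith)
  obtain ⟨τ, h1, h2, h3⟩ := exists_powCoeff_eq (N := N) (M := -μ) hs0 hs1 (by linarith)
  have hiff : μ = mu0 N s ↔ τ = (2 * s - N) / 2 := by
    constructor
    · intro h
      exact powCoeff_injOn hs0 hs1 h1 (by linarith) h2 le_rfl (by rw [h3, hcrit, h])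
    · intro h
      rw [h, hcrit] at h3
      linarith
  refine ⟨τ, h1, h2, hiff, fun t => ?_, fun t => ?_⟩
  · constructor
    · rintro ⟨⟨ht1, ht2⟩, ht3⟩
      by_cases hμ0 : μ = mu0 N s
      · have e : PhiOf N s μ t = fun x : E N => -(‖x‖ ^ t * Real.log ‖x‖) := by
          funext x; simp [PhiOf, hμ0]
        rw [e] at ht3
        have hl := logCoeff_eq_zero_of_isHardySolution hs0 hs1 ht1 (by linarith) ht3
        rw [hiff.1 hμ0]
        by_contra hne
        exact (logCoeff_pos hs0 hs1 ht1 (lt_of_le_of_ne ht2 hne)).ne' hl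
      · have e : PhiOf N s μ t = fun x : E N => ‖x‖ ^ t := by
          funext x; simp [PhiOf, hμ0]
        rw [e, isHardySolution_rpow_iff hs0 hs1 ht1 (by linarith)] at ht3
        exact powCoeff_injOn hs0 hs1 ht1 h1 ht2 h2 (ht3.trans h3.symm)
    · rintro rfl
      refine ⟨⟨h1, h2⟩, ?_⟩
      by_cases hμ0 : μ = mu0 N s
      · have e : PhiOf N s μ t = fun x : E N => -(‖x‖ ^ t * Real.log ‖x‖) := by
          funext x; simp [PhiOf, hμ0]
        rw [e]
        refine isHardySolution_log hs0 hs1 h1 (by linarith) h3 ?_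
        rw [hiff.1 hμ0, logCoeff_critical]
      · have e : PhiOf N s μ t = fun x : E N => ‖x‖ ^ t := by
          funext x; simp [PhiOf, hμ0]
        rw [e, isHardySolution_rpow_iff hs0 hs1 h1 (by linarith)]
        exact h3
  · constructor
    · rintro ⟨⟨ht1, ht2⟩, ht3⟩
      have e : GammaOf N t = fun x : E N => ‖x‖ ^ t := rfl
      rw [e, isHardySolution_rpow_iff hs0 hs1 (by linarith) ht2, ← powCoeff_symm] at ht3
      have := powCoeff_injOn hs0 hs1 (by linarith) h1 (by linarith) h2 (ht3.trans h3.symm)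
      linarith
    · rintro rfl
      refine ⟨⟨by linarith, by linarith⟩, ?_⟩
      have e : GammaOf N (2 * s - N - τ) = fun x : E N => ‖x‖ ^ (2 * s - N - τ) := rfl
      rw [e, isHardySolution_rpow_iff hs0 hs1 (by linarith) (by linarith), powCoeff_symm]
      exact h3

end FracHardy

namespace FracHardy

variable {N : ℕ} {s : ℝ}

/-! ### The pair of fundamental solutions and its Wronskian -/

/-- The radial profile `σ ↦ φ(1) γ(σ) - φ(σ) γ(1)`, where `γ(σ) = σ^(2s-N-τ)` is the profile of the
weight. -/
noncomputable def wronskian (N : ℕ) (s τ : ℝ) (φ : ℝ → ℝ) (σ : ℝ) : ℝ :=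
  φ 1 * σ ^ (2 * s - N - τ) - φ σ

/-- The properties of the profile `φ` of `Φ_μ` that the distributional identity depends on. The
weight has the profile `σ ^ (2s - N - τ)`; the field `homogeneous` says that the antisymmetric
combination `Φ(x) Γ(z) - Φ(z) Γ(x)` is homogeneous of degree `2s - N`. -/
structure FundamentalProfile (N : ℕ) (s τ : ℝ) (φ : ℝ → ℝ) : Prop where
  neg_lt : -(N : ℝ) < τ
  le_critical : τ ≤ (2 * s - N) / 2
  measurable : Measurable φ
  homogeneous : ∀ r σ : ℝ, 0 < r → 0 < σ →
    φ r * (r * σ) ^ (2 * s - N - τ) - φ (r * σ) * r ^ (2 * s - N - τ)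
      = r ^ (2 * s - N) * wronskian N s τ φ σ
  lipschitz : ∃ D : ℝ, 0 ≤ D ∧ ∀ σ ∈ Icc (1 / 2 : ℝ) 2, |wronskian N s τ φ σ| ≤ D * |1 - σ|
  growth : ∀ δ : ℝ, 0 < δ → ∃ D : ℝ, 0 ≤ D ∧
    ∀ σ : ℝ, 0 < σ → |φ σ| ≤ D * (σ ^ (τ - δ) + σ ^ (τ + δ))
  neg : ∀ σ : ℝ, 0 < σ → σ < 1 → wronskian N s τ φ σ < 0

theorem rpow_le_add {σ p e q : ℝ} (hσ : 0 < σ) (h1 : p ≤ e) (h2 : e ≤ q) :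
    σ ^ e ≤ σ ^ p + σ ^ q := by
  have hp : 0 < σ ^ p := by positivity
  have hq : 0 < σ ^ q := by positivity
  rcases le_total σ 1 with h | h
  · have := Real.rpow_le_rpow_of_exponent_ge hσ h h1; linarith
  · have := Real.rpow_le_rpow_of_exponent_le h h2; linarith

theorem fundamentalProfile_rpow {τ : ℝ} (h1 : -(N : ℝ) < τ) (h2 : τ < (2 * s - N) / 2) :
    FundamentalProfile N s τ (fun r => r ^ τ) where
  neg_lt := h1
  le_critical := h2.le
  measurable := by fun_prop
  homogeneous r σ hr hσ := by
    have e : r ^ (2 * s - (N : ℝ)) = r ^ τ * r ^ (2 * s - N - τ) := by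
      rw [← Real.rpow_add hr]; congr 1; ring
    rw [wronskian, Real.one_rpow, Real.mul_rpow hr.le hσ.le, Real.mul_rpow hr.le hσ.le, e]
    ring
  lipschitz := by
    obtain ⟨D, hD0, hD⟩ := exists_rpow_lipschitz τ
    obtain ⟨D', hD0', hD'⟩ := exists_rpow_lipschitz (2 * s - N - τ)
    refine ⟨D + D', by positivity, fun σ hσ => ?_⟩
    have e1 := hD 1 (by norm_num) σ hσ
    have e2 := hD' 1 (by norm_num) σ hσ
    rw [Real.one_rpow] at e1 e2
    have : wronskian N s τ (fun r => r ^ τ) σ = (1 - σ ^ τ) - (1 - σ ^ (2 * s - N - τ)) := by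
      rw [wronskian, Real.one_rpow]; ring
    rw [this, add_mul]
    exact (abs_sub _ _).trans (add_le_add e1 e2)
  growth δ hδ := by
    refine ⟨1, zero_le_one, fun σ hσ => ?_⟩
    rw [abs_of_pos (by positivity), one_mul]
    exact rpow_le_add hσ (by linarith) (by linarith)
  neg σ h0 h3 := by
    rw [wronskian, Real.one_rpow, one_mul, sub_neg]
    exact Real.rpow_lt_rpow_of_exponent_gt h0 h3 (by linarith)

theorem fundamentalProfile_log (h1 : -(N : ℝ) < (2 * s - N) / 2) :
    FundamentalProfile N s ((2 * s - N) / 2) (fun r => -(r ^ ((2 * s - N) / 2) * Real.log r)) where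
  neg_lt := h1
  le_critical := le_rfl
  measurable := by fun_prop
  homogeneous r σ hr hσ := by
    have e : r ^ (2 * s - (N : ℝ)) = r ^ ((2 * s - (N : ℝ)) / 2) * r ^ ((2 * s - (N : ℝ)) / 2) := by
      rw [← Real.rpow_add hr]; congr 1; ring
    have e2 : 2 * s - (N : ℝ) - (2 * s - N) / 2 = (2 * s - N) / 2 := by ring
    rw [wronskian, e2, Real.log_one, Real.mul_rpow hr.le hσ.le, Real.log_mul hr.ne' hσ.ne', e]
    ring
  lipschitz := by
    obtain ⟨D, hD0, hD⟩ := exists_rpow_lipschitz ((2 * s - N) / 2)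
    refine ⟨(1 + D) * 2, by positivity, fun σ hσ => ?_⟩
    have e1 := hD σ hσ 1 (by norm_num)
    have e2 := abs_log_le_two_mul hσ
    have e3 : |σ - 1| ≤ 1 := by rw [abs_le]; constructor <;> linarith [hσ.1, hσ.2]
    have e4 : |σ ^ ((2 * s - (N : ℝ)) / 2)| ≤ 1 + D := by
      have h5 := abs_sub_abs_le_abs_sub (σ ^ ((2 * s - (N : ℝ)) / 2))
        (1 ^ ((2 * s - (N : ℝ)) / 2))
      rw [Real.one_rpow, abs_one] at h5
      rw [Real.one_rpow] at e1
      nlinarith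
    rw [wronskian, Real.log_one, mul_zero, neg_zero, zero_mul, zero_sub, neg_neg, abs_mul]
    calc _ ≤ (1 + D) * (2 * |1 - σ|) := by gcongr
      _ = _ := by ring
  growth δ hδ := by
    refine ⟨δ⁻¹, by positivity, fun σ hσ => ?_⟩
    rw [abs_neg, abs_mul, abs_of_pos (Real.rpow_pos_of_pos hσ _), Real.rpow_add hσ,
      sub_eq_add_neg _ δ, Real.rpow_add hσ, ← mul_add, mul_left_comm, add_comm (σ ^ (-δ))]
    exact mul_le_mul_of_nonneg_left (abs_log_le_rpow_add_rpow hδ hσ)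
      (Real.rpow_pos_of_pos hσ _).le
  neg σ h0 h3 := by
    rw [wronskian, Real.log_one, mul_zero, neg_zero, zero_mul, zero_sub, neg_neg]
    exact mul_neg_of_pos_of_neg (by positivity) (Real.log_neg h0 h3)

/-- A radial numerator of moderate growth is integrable against the kernel away from `e₁`. -/
theorem integrableOn_growth_compl_ball [NeZero N] (hs0 : 0 < s) {F : ℝ → ℝ} (hF : Measurable F)
    {D p q : ℝ} (hp : -(N : ℝ) < p) (hpq : p ≤ q) (hq : q < 2 * s)
    (hD : ∀ σ : ℝ, 0 < σ → |F σ| ≤ D * (σ ^ p + σ ^ q)) {ε : ℝ} (hε : 0 < ε) (x : E N) :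
    IntegrableOn (fun y : E N => F ‖y‖ / ‖x - y‖ ^ ((N : ℝ) + 2 * s))
      (Metric.ball x ε)ᶜ := by
  have hκ := kappa_pos (N := N) hs0
  have h1 := integrableOn_rpow_norm_div (κ := N + 2 * s) hp (by linarith) (by linarith) x hε
  have h2 := integrableOn_rpow_norm_div (κ := N + 2 * s) (p := q) (by linarith) (by linarith)
    (by linarith) x hε
  refine Integrable.mono' ((h1.add h2).const_mul D)
    (by fun_prop : Measurable _).aestronglyMeasurable ?_
  filter_upwards [ae_restrict_of_ae ae_ne_zero] with y hy
  rw [norm_div, Real.norm_of_nonneg (by positivity : 0 ≤ ‖x - y‖ ^ ((N : ℝ) + 2 * s)),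
    Pi.add_apply, ← add_div, mul_div_assoc']
  gcongr
  exact hD _ (norm_pos_iff.2 hy)

/-- A radial numerator of moderate growth that vanishes quadratically at the unit sphere is
integrable against the kernel. -/
theorem integrable_growth [NeZero N] (hs0 : 0 < s) (hs1 : s < 1) {F : ℝ → ℝ} (hF : Measurable F)
    {D p q : ℝ} (hp : -(N : ℝ) < p) (hpq : p ≤ q) (hq : q < 2 * s)
    (hD : ∀ σ : ℝ, 0 < σ → |F σ| ≤ D * (σ ^ p + σ ^ q)) {D' : ℝ} (hD0' : 0 ≤ D')
    (hD' : ∀ σ ∈ Icc (1 / 2 : ℝ) 2, |F σ| ≤ D' * (1 - σ) ^ 2) :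
    Integrable fun y : E N => F ‖y‖ / ‖e1 N - y‖ ^ ((N : ℝ) + 2 * s) := by
  rw [← integrableOn_univ, ← union_compl_self (Metric.ball (e1 N) (1 / 2)), integrableOn_union]
  refine ⟨?_, integrableOn_growth_compl_ball hs0 hF hp hpq hq hD (by norm_num) _⟩
  have h := (integrableOn_ball_rpow_norm_sub (N := N) (p := 2 - ((N : ℝ) + 2 * s))
      (by linarith) (e1 N) (1 / 2)).const_mul D'
  refine Integrable.mono' h (by fun_prop : Measurable _).aestronglyMeasurable ?_
  filter_upwards [ae_restrict_mem measurableSet_ball, ae_restrict_of_ae (ae_norm_ne_one (N := N))]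
    with y hy hy1
  have hyn : ‖e1 N - y‖ < 1 / 2 := by
    rwa [Metric.mem_ball, dist_eq_norm, norm_sub_rev] at hy
  have h1 := one_sub_norm_le y
  have h2 := abs_le.1 (h1.trans hyn.le)
  have hpos : 0 < ‖e1 N - y‖ := lt_of_lt_of_le (abs_pos.2 (sub_ne_zero.2 hy1.symm)) h1
  rw [Real.rpow_sub hpos, norm_div,
    Real.norm_of_nonneg (by positivity : 0 ≤ ‖e1 N - y‖ ^ ((N : ℝ) + 2 * s)), mul_div_assoc']
  gcongr
  refine (hD' _ ⟨by linarith, by linarith⟩).trans ?_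
  rw [Real.rpow_two, ← sq_abs (1 - ‖y‖)]
  gcongr

namespace FundamentalProfile

variable {τ : ℝ} {φ : ℝ → ℝ}

theorem measurable_wronskian (h : FundamentalProfile N s τ φ) :
    Measurable (wronskian N s τ φ) := by
  have := h.measurable
  unfold wronskian
  fun_prop

/-- The Wronskian is antisymmetric under inversion, up to its homogeneity. -/
theorem wronskian_inv (h : FundamentalProfile N s τ φ) {σ : ℝ} (hσ : 0 < σ) :
    σ ^ (2 * s - (N : ℝ)) * wronskian N s τ φ σ⁻¹ = -wronskian N s τ φ σ := by
  rw [← h.homogeneous σ σ⁻¹ hσ (inv_pos.2 hσ), mul_inv_cancel₀ hσ.ne', Real.one_rpow, wronskian]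
  ring

theorem wronskian_growth (h : FundamentalProfile N s τ φ) {δ : ℝ} (hδ : 0 < δ) :
    ∃ D : ℝ, 0 ≤ D ∧ ∀ σ : ℝ, 0 < σ →
      |wronskian N s τ φ σ| ≤ D * (σ ^ (τ - δ) + σ ^ (2 * s - N - τ + δ)) := by
  obtain ⟨D, hD0, hD⟩ := h.growth δ hδ
  have hc := h.le_critical
  refine ⟨|φ 1| + 2 * D, by positivity, fun σ hσ => ?_⟩
  have e1 := rpow_le_add (p := τ - δ) (e := 2 * s - N - τ) (q := 2 * s - N - τ + δ) hσ
    (by linarith) (by linarith)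
  have e2 := rpow_le_add (p := τ - δ) (e := τ + δ) (q := 2 * s - N - τ + δ) hσ
    (by linarith) (by linarith)
  have e3 : 0 < σ ^ (2 * s - N - τ + δ) := by positivity
  have e4 := hD σ hσ
  have e5 : 0 < σ ^ (2 * s - N - τ) := by positivity
  rw [wronskian]
  refine (abs_sub _ _).trans ?_
  rw [abs_mul, abs_of_pos e5]
  have e6 := mul_le_mul_of_nonneg_left e1 (abs_nonneg (φ 1))
  have e7 : D * (σ ^ (τ - δ) + σ ^ (τ + δ))
      ≤ D * (2 * (σ ^ (τ - δ) + σ ^ (2 * s - N - τ + δ))) := by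
    gcongr; linarith
  nlinarith

variable [NeZero N]

/-- The integrand of the normalization constant after integration in `t`. -/
theorem integrable_log_wronskian (h : FundamentalProfile N s τ φ) (hs0 : 0 < s) (hs1 : s < 1) :
    Integrable fun y : E N =>
      Real.log ‖y‖ * wronskian N s τ φ ‖y‖ / ‖e1 N - y‖ ^ ((N : ℝ) + 2 * s) := by
  have hτ := h.neg_lt
  have hc := h.le_critical
  set δ := (τ + N) / 4 with hδ
  have hδ0 : 0 < δ := by linarith
  obtain ⟨D, hD0, hD⟩ := h.wronskian_growth hδ0
  obtain ⟨D', hD0', hD'⟩ := h.lipschitz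
  have hm := h.measurable_wronskian
  refine integrable_growth (F := fun σ => Real.log σ * wronskian N s τ φ σ) hs0 hs1 (by fun_prop)
    (p := τ - 2 * δ) (q := 2 * s - N - τ + 2 * δ) (D := δ⁻¹ * D * 4) (D' := 2 * D')
    (by linarith) (by linarith) (by linarith) (fun σ hσ => ?_) (by positivity) (fun σ hσ => ?_)
  · rw [abs_mul]
    have e1 := abs_log_le_rpow_add_rpow hδ0 hσ
    have e2 := hD σ hσ
    have key : ∀ e : ℝ, τ - 2 * δ ≤ e → e ≤ 2 * s - N - τ + 2 * δ →
        σ ^ e ≤ σ ^ (τ - 2 * δ) + σ ^ (2 * s - N - τ + 2 * δ) := fun e he1 he2 =>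
      rpow_le_add hσ he1 he2
    calc _ ≤ (δ⁻¹ * (σ ^ δ + σ ^ (-δ))) * (D * (σ ^ (τ - δ) + σ ^ (2 * s - N - τ + δ))) := by
          gcongr
      _ = δ⁻¹ * D * (σ ^ (δ + (τ - δ)) + σ ^ (δ + (2 * s - N - τ + δ)) + σ ^ (-δ + (τ - δ))
            + σ ^ (-δ + (2 * s - N - τ + δ))) := by
          simp only [Real.rpow_add hσ, Real.rpow_sub hσ]; ring
      _ ≤ δ⁻¹ * D * (4 * (σ ^ (τ - 2 * δ) + σ ^ (2 * s - N - τ + 2 * δ))) := by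
          have k1 := key (δ + (τ - δ)) (by linarith) (by linarith)
          have k2 := key (δ + (2 * s - N - τ + δ)) (by linarith) (by linarith)
          have k3 := key (-δ + (τ - δ)) (by linarith) (by linarith)
          have k4 := key (-δ + (2 * s - N - τ + δ)) (by linarith) (by linarith)
          gcongr
          linarith
      _ = _ := by ring
  · rw [abs_mul, ← sq_abs (1 - σ)]
    calc _ ≤ (2 * |1 - σ|) * (D' * |1 - σ|) := by
          gcongr
          · exact abs_log_le_two_mul hσ
          · exact hD' σ hσ
      _ = _ := by ring

/-- The normalization constant as a single integral over the unit ball, without the constant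
factors. -/
noncomputable def normIntegral (N : ℕ) (s τ : ℝ) (φ : ℝ → ℝ) : ℝ :=
  ∫ y in punctured N,
    Real.log ‖y‖ * wronskian N s τ φ ‖y‖ / ‖e1 N - y‖ ^ ((N : ℝ) + 2 * s)

theorem normIntegral_pos (h : FundamentalProfile N s τ φ) (hs0 : 0 < s) (hs1 : s < 1) :
    0 < normIntegral N s τ φ := by
  refine setIntegral_pos_of_pos_on measurableSet_punctured volume_punctured_ne_zero
    (h.integrable_log_wronskian hs0 hs1).integrableOn fun y hy => ?_
  have := norm_e1_sub_pos hy
  exact div_pos (mul_pos_of_neg_of_neg (Real.log_neg hy.1 hy.2) (h.neg _ hy.1 hy.2))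
    (by positivity)

theorem integrableOn_ball (h : FundamentalProfile N s τ φ) (hs0 : 0 < s) {t : ℝ} (ht : t < 1) :
    IntegrableOn (fun y : E N => -wronskian N s τ φ ‖y‖ / ‖e1 N - y‖ ^ ((N : ℝ) + 2 * s))
      (Metric.ball 0 t) := by
  have hτ := h.neg_lt
  have hc := h.le_critical
  obtain ⟨D, hD0, hD⟩ := h.wronskian_growth (by linarith : 0 < (τ + N) / 4)
  refine (integrableOn_growth_compl_ball (F := fun σ => -wronskian N s τ φ σ) hs0
    h.measurable_wronskian.neg (p := τ - (τ + N) / 4) (q := 2 * s - N - τ + (τ + N) / 4) (D := D)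
    (by linarith) (by linarith) (by linarith) (fun σ hσ => by rw [abs_neg]; exact hD σ hσ)
    (sub_pos.2 ht) (e1 N)).mono_set fun y hy => ?_
  rw [mem_compl_ball_e1]
  have h1 := (abs_le.1 (one_sub_norm_le y)).2
  have h2 : ‖y‖ < t := by simpa using hy
  linarith

theorem integral_inv_Ioc {a : ℝ} (h0 : 0 < a) (h1 : a < 1) :
    ∫ t in Ioc (0 : ℝ) 1, (Ioi a).indicator (fun t => 1 / t) t = -Real.log a := by
  rw [setIntegral_indicator measurableSet_Ioi]
  have : Ioc (0 : ℝ) 1 ∩ Ioi a = Ioc a 1 := by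
    ext t
    simp only [mem_inter_iff, mem_Ioc, mem_Ioi]
    constructor
    · rintro ⟨⟨_, h⟩, h'⟩; exact ⟨h', h⟩
    · rintro ⟨h, h'⟩; exact ⟨⟨h0.trans h, h'⟩, h⟩
  rw [this, ← intervalIntegral.integral_of_le h1.le, integral_one_div_of_pos h0 one_pos,
    one_div, Real.log_inv]

/-- Interchange of the `t`-integral with the integral over the ball `B_t`. -/
theorem integrable_and_integral_inner (h : FundamentalProfile N s τ φ) (hs0 : 0 < s)
    (hs1 : s < 1) :
    IntegrableOn (fun t : ℝ => 1 / t * ∫ y in Metric.ball (0 : E N) t,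
        -wronskian N s τ φ ‖y‖ / ‖e1 N - y‖ ^ ((N : ℝ) + 2 * s)) (Ioc 0 1) ∧
      ∫ t in Ioc (0 : ℝ) 1, 1 / t * ∫ y in Metric.ball (0 : E N) t,
        -wronskian N s τ φ ‖y‖ / ‖e1 N - y‖ ^ ((N : ℝ) + 2 * s) = normIntegral N s τ φ := by
  have hm := h.measurable_wronskian
  set q : E N → ℝ := fun y => -wronskian N s τ φ ‖y‖ / ‖e1 N - y‖ ^ ((N : ℝ) + 2 * s) with hq
  have hqm : Measurable q := by fun_prop
  have hq0 : ∀ y ∈ punctured N, 0 ≤ q y := fun y hy =>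
    div_nonneg (neg_nonneg.2 (h.neg _ hy.1 hy.2).le) (by positivity)
  set H : ℝ × E N → ℝ := fun p => {p : ℝ × E N | ‖p.2‖ < p.1}.indicator
    (fun p => 1 / p.1 * q p.2) p with hH
  have hHm : Measurable H := by
    refine Measurable.indicator (by fun_prop) (measurableSet_lt (by fun_prop) (by fun_prop))
  have hHy : ∀ (t : ℝ) (y : E N), H (t, y) = (Ioi ‖y‖).indicator (fun t => 1 / t) t * q y := by
    intro t y
    by_cases hty : ‖y‖ < t <;> simp [hH, indicator, hty]
  have hind : ∀ y ∈ punctured N, IntegrableOn ((Ioi ‖y‖).indicator fun t : ℝ => 1 / t) (Ioc 0 1) := by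
    intro y hy
    refine Integrable.of_integral_ne_zero ?_
    rw [integral_inv_Ioc hy.1 hy.2]
    exact (neg_pos.2 (Real.log_neg hy.1 hy.2)).ne'
  have hint : Integrable H ((volume.restrict (Ioc (0 : ℝ) 1)).prod
      (volume.restrict (punctured N))) := by
    rw [integrable_prod_iff' hHm.aestronglyMeasurable]
    constructor
    · filter_upwards [ae_restrict_mem measurableSet_punctured] with y hy
      simp_rw [hHy]
      exact (hind y hy).mul_const _
    · refine (h.integrable_log_wronskian hs0 hs1).integrableOn.congr_fun (fun y hy => ?_)
        measurableSet_punctured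
      have e : ∀ t ∈ Ioc (0 : ℝ) 1, ‖H (t, y)‖ = (Ioi ‖y‖).indicator (fun t => 1 / t) t * q y := by
        intro t ht
        rw [hHy, Real.norm_of_nonneg]
        exact mul_nonneg (indicator_nonneg (fun t (ht' : ‖y‖ < t) => by
          have : 0 < t := hy.1.trans ht'
          positivity) t) (hq0 y hy)
      rw [setIntegral_congr_fun measurableSet_Ioc e, integral_mul_const,
        integral_inv_Ioc hy.1 hy.2, hq]
      ring
  have hinner : ∀ t ∈ Ioc (0 : ℝ) 1, ∫ y in punctured N, H (t, y)
      = 1 / t * ∫ y in Metric.ball (0 : E N) t, q y := by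
    intro t ht
    rw [setIntegral_congr_set punctured_ae_eq, ← integral_const_mul]
    have e : (fun y => H (t, y)) = (Metric.ball (0 : E N) t).indicator fun y => 1 / t * q y := by
      funext y
      simp [hH, indicator]
    rw [e, setIntegral_indicator measurableSet_ball,
      inter_eq_right.2 (Metric.ball_subset_ball ht.2)]
  constructor
  · exact IntegrableOn.congr_fun hint.integral_prod_left hinner measurableSet_Ioc
  · rw [← setIntegral_congr_fun measurableSet_Ioc hinner, integral_integral_swap hint,
      normIntegral]
    refine setIntegral_congr_fun measurableSet_punctured fun y hy => ?_
    simp_rw [hHy]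
    rw [integral_mul_const, integral_inv_Ioc hy.1 hy.2, hq]
    ring

end FundamentalProfile

end FracHardy

namespace FracHardy

open scoped ENNReal

variable {N : ℕ} {s : ℝ}

/-! ### Test functions and absolute convergence of the double integrals -/

/-- The quantitative properties of a test function `ξ ∈ C²_c` that the estimates use. -/
structure TestBounds (ξ : E N → ℝ) (L R : ℝ) : Prop where
  continuous : Continuous ξ
  nonneg : 0 ≤ L
  pos : 0 < R
  bounded : ∀ x z, |ξ x - ξ z| ≤ L
  lipschitz : ∀ x z, |ξ x - ξ z| ≤ L * ‖x - z‖
  second_difference : ∀ x h, |2 * ξ x - ξ (x + h) - ξ (x - h)| ≤ L * ‖h‖ ^ 2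
  support : ∀ x, R ≤ ‖x‖ → ξ x = 0

theorem exists_testBounds {ξ : E N → ℝ} (hξ : ContDiff ℝ 2 ξ) (hc : HasCompactSupport ξ) :
    ∃ L R : ℝ, TestBounds ξ L R := by
  obtain ⟨K1, hK1⟩ := ContDiff.lipschitzWith_of_hasCompactSupport hc hξ (by norm_num)
  have hfd : ContDiff ℝ 1 (fderiv ℝ ξ) := hξ.fderiv_right (by norm_num)
  obtain ⟨K2, hK2⟩ := ContDiff.lipschitzWith_of_hasCompactSupport (hc.fderiv (𝕜 := ℝ)) hfd
    (by norm_num)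
  obtain ⟨M, hM⟩ := hξ.continuous.bounded_above_of_compact_support hc
  obtain ⟨R, hR⟩ := hc.isCompact.isBounded.subset_ball (0 : E N)
  have hM0 : 0 ≤ M := (norm_nonneg _).trans (hM 0)
  have hdiff : Differentiable ℝ ξ := hξ.differentiable (by norm_num)
  refine ⟨2 * M + K1 + K2, max R 1, hξ.continuous, by positivity, by positivity,
    fun x z => ?_, fun x z => ?_, fun x h => ?_, fun x hx => ?_⟩
  · have h1 := (abs_sub (ξ x) (ξ z)).trans (add_le_add (hM x) (hM z))
    have h2 := K1.2
    have h3 := K2.2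
    linarith
  · have h1 := hK1.dist_le_mul x z
    rw [Real.dist_eq, dist_eq_norm] at h1
    refine h1.trans ?_
    gcongr
    linarith [K2.2]
  -- Second differences are first differences of `y ↦ ξ(y + h) - ξ(y)`, whose derivative is at most
  -- `K2 |h|`.
  · have hF : ∀ y ∈ (univ : Set (E N)), HasFDerivWithinAt (fun y => ξ (y + h) - ξ y)
        (fderiv ℝ ξ (y + h) - fderiv ℝ ξ y) univ y := by
      intro y _
      refine HasFDerivAt.hasFDerivWithinAt ?_
      exact ((hasFDerivAt_comp_add_right h).2 (hdiff (y + h)).hasFDerivAt).sub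
        (hdiff y).hasFDerivAt
    have hb : ∀ y ∈ (univ : Set (E N)), ‖fderiv ℝ ξ (y + h) - fderiv ℝ ξ y‖ ≤ K2 * ‖h‖ := by
      intro y _
      have := hK2.dist_le_mul (y + h) y
      rwa [dist_eq_norm, dist_eq_norm, add_sub_cancel_left] at this
    have h1 := convex_univ.norm_image_sub_le_of_norm_hasFDerivWithin_le hF hb
      (mem_univ (x - h)) (mem_univ x)
    rw [sub_add_cancel, sub_sub_cancel, Real.norm_eq_abs] at h1
    have h2 : 2 * ξ x - ξ (x + h) - ξ (x - h) = -(ξ (x + h) - ξ x - (ξ x - ξ (x - h))) := by ring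
    rw [h2, abs_neg]
    refine h1.trans ?_
    have h3 : (0 : ℝ) ≤ K1 := K1.2
    calc (K2 : ℝ) * ‖h‖ * ‖h‖ = K2 * ‖h‖ ^ 2 := by ring
      _ ≤ _ := by gcongr; linarith
  · by_contra hne
    have h1 : x ∈ tsupport ξ := subset_tsupport ξ hne
    have h2 := hR h1
    rw [Metric.mem_ball, dist_zero_right] at h2
    exact absurd (h2.trans_le (le_max_left R 1)) (not_lt.2 hx)

theorem TestBounds.holder {ξ : E N → ℝ} {L R : ℝ} (hξ : TestBounds ξ L R) {β : ℝ} (h0 : 0 ≤ β)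
    (h1 : β ≤ 1) (x z : E N) : |ξ x - ξ z| ≤ L * ‖x - z‖ ^ β := by
  rcases le_total ‖x - z‖ 1 with h | h
  · refine (hξ.lipschitz x z).trans (mul_le_mul_of_nonneg_left ?_ hξ.nonneg)
    rcases (norm_nonneg (x - z)).eq_or_lt with h2 | h2
    · rw [← h2]; positivity
    · have := Real.rpow_le_rpow_of_exponent_ge h2 h h1
      rwa [Real.rpow_one] at this
  · refine (hξ.bounded x z).trans (le_mul_of_one_le_right hξ.nonneg ?_)
    exact Real.one_le_rpow h h0

theorem TestBounds.eq_zero {ξ : E N → ℝ} {L R : ℝ} (hξ : TestBounds ξ L R) {x z : E N}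
    (h : ¬(‖x‖ < R ∨ ‖z‖ < R)) : ξ x - ξ z = 0 := by
  push Not at h
  rw [hξ.support x h.1, hξ.support z h.2, sub_zero]

/-- The pairs that are separated on the scale of `|x|` and of which one point lies in the ball of
radius `R`. -/
def farSet (N : ℕ) (c R : ℝ) : Set (E N × E N) :=
  {p | ‖p.1‖ ≤ c * ‖p.1 - p.2‖ ∧ (‖p.1‖ < R ∨ ‖p.2‖ < R)}

theorem measurableSet_farSet (c R : ℝ) : MeasurableSet (farSet N c R) := by
  have h1 : MeasurableSet {p : E N × E N | ‖p.1‖ ≤ c * ‖p.1 - p.2‖} :=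
    measurableSet_le (by fun_prop) (by fun_prop)
  have h2 : MeasurableSet {p : E N × E N | ‖p.1‖ < R} :=
    measurableSet_lt (by fun_prop) (by fun_prop)
  have h3 : MeasurableSet {p : E N × E N | ‖p.2‖ < R} :=
    measurableSet_lt (by fun_prop) (by fun_prop)
  exact h1.inter (h2.union h3)

theorem lintegral_Ioo_rpow {e ρ : ℝ} (he : 0 < e) (hρ : 0 < ρ) :
    ∫⁻ r in Ioo (0 : ℝ) ρ, ENNReal.ofReal (r ^ (e - 1)) = ENNReal.ofReal (ρ ^ e / e) := by
  rw [setLIntegral_ofReal measurableSet_Ioo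
    ((intervalIntegral.integrableOn_Ioo_rpow_iff hρ).2 (by linarith)),
    ← integral_Ioc_eq_integral_Ioo, ← intervalIntegral.integral_of_le hρ.le,
    integral_rpow (Or.inl (by linarith)), sub_add_cancel, Real.zero_rpow he.ne', sub_zero]
  intro r hr
  have := hr.1
  positivity

/-- Homogeneity reduces the integral over far pairs to `∫ r^(e-1) dr` over `0 < r < R max(1, 1/|y|)`,
where `e > 0` is the excess of homogeneity. -/
theorem inner_far_le [NeZero N] {α γ κ e c R : ℝ} (he : 0 < e)
    (hexp : 2 * N - 1 + α + γ - κ = e - 1) (hc : 0 < c) (hR : 0 < R) {θ y : E N} (hθ : ‖θ‖ = 1)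
    (hy : y ≠ 0) :
    ∫⁻ r in Ioi (0 : ℝ), ENNReal.ofReal (r ^ (2 * N - 1)) *
      (farSet N c R).indicator
        (fun p => ENNReal.ofReal (‖p.1‖ ^ α * ‖p.2‖ ^ γ / ‖p.1 - p.2‖ ^ κ)) (r • θ, r • y)
      ≤ if ‖θ - y‖ < c⁻¹ then 0 else
        ENNReal.ofReal (R ^ e / e * (‖y‖ ^ γ / ‖θ - y‖ ^ κ + ‖y‖ ^ (γ - e) / ‖θ - y‖ ^ κ)) := by
  have hN : 1 ≤ N := NeZero.one_le
  have hσ : 0 < ‖y‖ := norm_pos_iff.2 hy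
  split_ifs with hnear
  · refine le_of_eq (setLIntegral_eq_zero measurableSet_Ioi fun r hr => ?_)
    have hr : 0 < r := hr
    have : (r • θ, r • y) ∉ farSet N c R := by
      rintro ⟨h1, -⟩
      simp only at h1
      rw [← smul_sub, norm_smul, norm_smul, hθ, Real.norm_of_nonneg hr.le, mul_one] at h1
      have h2 : c * ‖θ - y‖ < 1 := by
        have := mul_lt_mul_of_pos_left hnear hc
        rwa [mul_inv_cancel₀ hc.ne'] at this
      nlinarith
    simp [indicator_of_notMem this]
  · set ρ := R * max 1 ‖y‖⁻¹ with hρ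
    have hmax : 0 < max 1 ‖y‖⁻¹ := lt_max_of_lt_left one_pos
    have hρ0 : 0 < ρ := by positivity
    have step : ∀ r ∈ Ioi (0 : ℝ), ENNReal.ofReal (r ^ (2 * N - 1)) *
      (farSet N c R).indicator
        (fun p => ENNReal.ofReal (‖p.1‖ ^ α * ‖p.2‖ ^ γ / ‖p.1 - p.2‖ ^ κ)) (r • θ, r • y)
        ≤ (Ioo 0 ρ).indicator (fun r => ENNReal.ofReal (r ^ (e - 1))) r *
          ENNReal.ofReal (‖y‖ ^ γ / ‖θ - y‖ ^ κ) := by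
      intro r hr
      have hr : 0 < r := hr
      by_cases hmem : (r • θ, r • y) ∈ farSet N c R
      · have hrρ : r ∈ Ioo 0 ρ := by
          refine ⟨hr, ?_⟩
          have h2 := hmem.2
          simp only at h2
          rw [norm_smul, norm_smul, hθ, Real.norm_of_nonneg hr.le, mul_one] at h2
          rcases h2 with h2 | h2
          · calc r < R * 1 := by linarith
              _ ≤ ρ := by rw [hρ]; gcongr; exact le_max_left _ _
          · calc r < R * ‖y‖⁻¹ := by rwa [← div_eq_mul_inv, lt_div_iff₀ hσ]
              _ ≤ ρ := by rw [hρ]; gcongr; exact le_max_right _ _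
        rw [indicator_of_mem hmem, indicator_of_mem hrρ, ← ENNReal.ofReal_mul (by positivity),
          ← ENNReal.ofReal_mul (by positivity)]
        refine le_of_eq ?_
        congr 1
        rw [← smul_sub, norm_smul, norm_smul, norm_smul, hθ, Real.norm_of_nonneg hr.le, mul_one,
          Real.mul_rpow hr.le hσ.le, Real.mul_rpow hr.le (norm_nonneg _)]
        have e1 : r ^ (e - 1) = r ^ (2 * N - 1) * r ^ α * r ^ γ / r ^ κ := by
          rw [← Real.rpow_natCast, ← Real.rpow_add hr, ← Real.rpow_add hr, ← Real.rpow_sub hr,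
            Nat.cast_sub (by omega), ← hexp]
          congr 1; push_cast; ring
        rw [e1]
        simp only [div_eq_mul_inv, mul_inv]
        ring
      · rw [indicator_of_notMem hmem, mul_zero]; exact zero_le
    refine (setLIntegral_mono' measurableSet_Ioi step).trans ?_
    rw [lintegral_mul_const _ (Measurable.indicator (by fun_prop) measurableSet_Ioo),
      setLIntegral_indicator measurableSet_Ioo,
      inter_eq_left.2 (Ioo_subset_Ioi_self : Ioo 0 ρ ⊆ Ioi 0), lintegral_Ioo_rpow he hρ0,
      ← ENNReal.ofReal_mul (by positivity)]
    refine ENNReal.ofReal_le_ofReal ?_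
    have h1 : ρ ^ e ≤ R ^ e * (1 + ‖y‖ ^ (-e)) := by
      rw [hρ, Real.mul_rpow hR.le hmax.le]
      gcongr
      rcases le_total 1 ‖y‖⁻¹ with h | h
      · rw [max_eq_right h, Real.inv_rpow hσ.le, ← Real.rpow_neg hσ.le]
        linarith
      · rw [max_eq_left h, Real.one_rpow]
        have : 0 < ‖y‖ ^ (-e) := by positivity
        linarith
    have h2 : ‖y‖ ^ (γ - e) = ‖y‖ ^ γ * ‖y‖ ^ (-e) := by
      rw [← Real.rpow_add hσ, sub_eq_add_neg]
    calc ρ ^ e / e * (‖y‖ ^ γ / ‖θ - y‖ ^ κ)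
        ≤ R ^ e * (1 + ‖y‖ ^ (-e)) / e * (‖y‖ ^ γ / ‖θ - y‖ ^ κ) := by gcongr
      _ = _ := by rw [h2]; ring

/-- A kernel with a positive excess `e` of homogeneity is integrable over far pairs near the origin,
provided that `γ - e` and `γ` are admissible powers in `z`. -/
theorem lintegral_far_lt_top [NeZero N] {α γ κ e c R : ℝ} (he : 0 < e)
    (hexp : 2 * N - 1 + α + γ - κ = e - 1) (hγ : -(N : ℝ) < γ - e) (hγκ : γ + N < κ)
    (hκ : 0 ≤ κ) (hc : 0 < c) (hR : 0 < R) :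
    ∫⁻ x : E N, ∫⁻ z : E N, (farSet N c R).indicator
        (fun p => ENNReal.ofReal (‖p.1‖ ^ α * ‖p.2‖ ^ γ / ‖p.1 - p.2‖ ^ κ)) (x, z) < ⊤ := by
  rw [lintegral_polarPair (F := fun x z => (farSet N c R).indicator
        (fun p => ENNReal.ofReal (‖p.1‖ ^ α * ‖p.2‖ ^ γ / ‖p.1 - p.2‖ ^ κ)) (x, z))
    (Measurable.indicator (by fun_prop) (measurableSet_farSet c R))]
  set B : ℝ → ℝ → ℝ≥0∞ := fun a b => if b < c⁻¹ then 0 else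
    ENNReal.ofReal (R ^ e / e * (a ^ γ / b ^ κ + a ^ (γ - e) / b ^ κ)) with hB
  have hfin : ∫⁻ y : E N, B ‖y‖ ‖e1 N - y‖ < ⊤ := by
    have hi := ((integrableOn_rpow_norm_div (N := N) (p := γ) (by linarith) hγκ hκ (e1 N)
      (inv_pos.2 hc)).add (integrableOn_rpow_norm_div (N := N) (p := γ - e) hγ (by linarith) hκ
      (e1 N) (inv_pos.2 hc))).const_mul (R ^ e / e)
    refine lt_of_le_of_lt ?_ hi.lintegral_lt_top
    rw [← lintegral_indicator measurableSet_ball.compl]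
    refine lintegral_mono fun y => ?_
    by_cases h : ‖e1 N - y‖ < c⁻¹
    · simp [hB, h]
    · rw [indicator_of_mem (mem_compl_ball_e1.2 (not_lt.1 h))]
      simp [hB, h]
  have hle : ∀ θ : Metric.sphere (0 : E N) 1, ∫⁻ y : E N, ∫⁻ r in Ioi (0 : ℝ),
      ENNReal.ofReal (r ^ (2 * N - 1)) * (farSet N c R).indicator
        (fun p => ENNReal.ofReal (‖p.1‖ ^ α * ‖p.2‖ ^ γ / ‖p.1 - p.2‖ ^ κ))
          (r • (θ : E N), r • y) ≤ ∫⁻ y : E N, B ‖y‖ ‖e1 N - y‖ := by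
    intro θ
    have hθ : ‖(θ : E N)‖ = 1 := by simp
    rw [← lintegral_rotate B hθ]
    refine lintegral_mono_ae ?_
    filter_upwards [ae_ne_zero (N := N)] with y hy
    exact inner_far_le he hexp hc hR hθ hy
  refine (lintegral_mono hle).trans_lt ?_
  rw [lintegral_const]
  exact ENNReal.mul_lt_top hfin (measure_lt_top _ _)

end FracHardy

namespace FracHardy

open scoped ENNReal

variable {N : ℕ} {s : ℝ}

/-! ### The double integral and its symmetrization -/

/-- The integrand of the double integral `∫∫ Φ(x) (ξ(x) - ξ(z)) |x - z|^(-N-2s) Γ(z) dz dx`. -/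
noncomputable def pairKernel (N : ℕ) (s τ : ℝ) (φ : ℝ → ℝ) (ξ : E N → ℝ) (p : E N × E N) : ℝ :=
  φ ‖p.1‖ * fracKernel s (GammaOf N (2 * s - N - τ)) ξ p.1 p.2

/-- The symmetrization of `pairKernel` in its two variables. -/
noncomputable def symKernel (N : ℕ) (s τ : ℝ) (φ : ℝ → ℝ) (ξ : E N → ℝ) (p : E N × E N) : ℝ :=
  pairKernel N s τ φ ξ p + pairKernel N s τ φ ξ p.swap

theorem symKernel_eq (τ : ℝ) (φ : ℝ → ℝ) (ξ : E N → ℝ) (x z : E N) :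
    symKernel N s τ φ ξ (x, z) = (ξ x - ξ z) / ‖x - z‖ ^ ((N : ℝ) + 2 * s) *
      (φ ‖x‖ * ‖z‖ ^ (2 * s - N - τ) - φ ‖z‖ * ‖x‖ ^ (2 * s - N - τ)) := by
  simp only [symKernel, pairKernel, fracKernel, GammaOf, Prod.swap_prod_mk, norm_sub_rev z x]
  ring

theorem ae_prod_ne_zero [NeZero N] : ∀ᵐ p : E N × E N, p.1 ≠ 0 ∧ p.2 ≠ 0 := by
  have h1 := Measure.quasiMeasurePreserving_fst (μ := (volume : Measure (E N)))
    (ν := (volume : Measure (E N))) |>.ae ae_ne_zero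
  have h2 := Measure.quasiMeasurePreserving_snd (μ := (volume : Measure (E N)))
    (ν := (volume : Measure (E N))) |>.ae ae_ne_zero
  exact h1.and h2

section

variable {τ : ℝ} {φ : ℝ → ℝ} {ξ : E N → ℝ} {L R : ℝ}

theorem measurable_pairKernel (hφ : Measurable φ) (hξ : Continuous ξ) :
    Measurable (pairKernel N s τ φ ξ) := by
  have := hξ.measurable
  unfold pairKernel fracKernel GammaOf
  fun_prop

theorem measurable_symKernel (hφ : Measurable φ) (hξ : Continuous ξ) :
    Measurable (symKernel N s τ φ ξ) :=
  (measurable_pairKernel hφ hξ).add ((measurable_pairKernel hφ hξ).comp measurable_swap)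

theorem integrable_far [NeZero N] {α γ κ e c R : ℝ} (he : 0 < e)
    (hexp : 2 * N - 1 + α + γ - κ = e - 1) (hγ : -(N : ℝ) < γ - e) (hγκ : γ + N < κ)
    (hκ : 0 ≤ κ) (hc : 0 < c) (hR : 0 < R) :
    Integrable ((farSet N c R).indicator
        (fun p => ‖p.1‖ ^ α * ‖p.2‖ ^ γ / ‖p.1 - p.2‖ ^ κ)) := by
  have hm : Measurable ((farSet N c R).indicator
      (fun p => ‖p.1‖ ^ α * ‖p.2‖ ^ γ / ‖p.1 - p.2‖ ^ κ)) :=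
    Measurable.indicator (by fun_prop) (measurableSet_farSet c R)
  refine ⟨hm.aestronglyMeasurable, ?_⟩
  have h := lintegral_far_lt_top he hexp hγ hγκ hκ hc hR
  rw [hasFiniteIntegral_iff_enorm, Measure.volume_eq_prod, lintegral_prod _ (by fun_prop)]
  refine lt_of_le_of_lt (lintegral_mono fun x => lintegral_mono fun z => ?_) h
  by_cases hp : (x, z) ∈ farSet N c R
  · rw [indicator_of_mem hp, indicator_of_mem hp, Real.enorm_of_nonneg (by positivity)]
  · rw [indicator_of_notMem hp, enorm_zero]; exact zero_le

/-- The double integral converges absolutely away from the diagonal. Near the origin this uses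
that `ξ` is Hölder continuous: the integrand then gains a positive power of the distance of the
pair `(x, z)` to the origin, which compensates the logarithmic divergence of the homogeneous
kernel. -/
theorem FundamentalProfile.integrableOn_pairKernel [NeZero N] (h : FundamentalProfile N s τ φ)
    (hξ : TestBounds ξ L R) {S : Set (E N × E N)} (hS : MeasurableSet S) {c : ℝ}
    (hc : 0 < c)
    (hSc : ∀ p ∈ S, (‖p.1‖ < R ∨ ‖p.2‖ < R) → ‖p.1‖ ≤ c * ‖p.1 - p.2‖) :
    IntegrableOn (pairKernel N s τ φ ξ) S := by
  have hτ := h.neg_lt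
  have hcr := h.le_critical
  have hN : (1 : ℝ) ≤ N := by exact_mod_cast NeZero.one_le
  -- The Hölder exponent `2 δ` of `ξ` absorbs the loss `± δ` in the growth of `φ`: the two terms
  -- of the bound have excess of homogeneity `δ` and `3 δ`.
  set δ := min 1 (τ + N) / 8 with hδ
  have hmin : 0 < min 1 (τ + N) := lt_min one_pos (by linarith)
  have hδ0 : 0 < δ := by positivity
  have hδ1 : 8 * δ ≤ 1 := by
    have := min_le_left 1 (τ + N)
    rw [hδ]; linarith
  have hδ2 : 8 * δ ≤ τ + N := by
    have := min_le_right 1 (τ + N)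
    rw [hδ]; linarith
  obtain ⟨D, hD0, hD⟩ := h.growth δ hδ0
  have i1 := integrable_far (N := N) (α := τ - δ) (γ := 2 * s - N - τ) (κ := N + 2 * s - 2 * δ)
    (e := δ) hδ0 (by ring) (by linarith) (by linarith) (by linarith) hc hξ.pos
  have i2 := integrable_far (N := N) (α := τ + δ) (γ := 2 * s - N - τ) (κ := N + 2 * s - 2 * δ)
    (e := 3 * δ) (by linarith) (by ring) (by linarith) (by linarith) (by linarith) hc hξ.pos
  refine Integrable.mono' ((i1.add i2).const_mul (D * L)).integrableOn
    (measurable_pairKernel h.measurable hξ.continuous).aestronglyMeasurable ?_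
  filter_upwards [ae_restrict_mem hS, ae_restrict_of_ae (ae_prod_ne_zero (N := N))]
    with ⟨x, z⟩ hp hxz
  by_cases hR : ‖x‖ < R ∨ ‖z‖ < R
  · have hfar := hSc _ hp hR
    have hmem : (x, z) ∈ farSet N c R := ⟨hfar, hR⟩
    have hx : 0 < ‖x‖ := norm_pos_iff.2 hxz.1
    have hxz : 0 < ‖x - z‖ := pos_of_mul_pos_right (hx.trans_le hfar) hc.le
    rw [Pi.add_apply, indicator_of_mem hmem, indicator_of_mem hmem, pairKernel, fracKernel,
      GammaOf, norm_mul, norm_mul, norm_div, Real.norm_of_nonneg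
      (by positivity : 0 ≤ ‖x - z‖ ^ ((N : ℝ) + 2 * s)), Real.norm_of_nonneg
      (by positivity : 0 ≤ ‖z‖ ^ (2 * s - N - τ))]
    have e1 : |ξ x - ξ z| / ‖x - z‖ ^ ((N : ℝ) + 2 * s)
        ≤ L / ‖x - z‖ ^ ((N : ℝ) + 2 * s - 2 * δ) := by
      rw [Real.rpow_sub hxz, div_div_eq_mul_div]
      gcongr
      exact hξ.holder (by linarith) (by linarith) x z
    calc _ ≤ (D * (‖x‖ ^ (τ - δ) + ‖x‖ ^ (τ + δ))) *
          (L / ‖x - z‖ ^ ((N : ℝ) + 2 * s - 2 * δ) * ‖z‖ ^ (2 * s - N - τ)) := by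
          exact mul_le_mul (hD _ hx) (mul_le_mul_of_nonneg_right e1 (by positivity))
            (by positivity) (by positivity)
      _ = _ := by simp only; ring
  · have : pairKernel N s τ φ ξ (x, z) = 0 := by
      simp [pairKernel, fracKernel, hξ.eq_zero hR]
    rw [this, norm_zero, Pi.add_apply]
    have := hξ.nonneg
    have hi : ∀ f : E N × E N → ℝ, (∀ p, 0 ≤ f p) → 0 ≤ (farSet N c R).indicator f (x, z) :=
      fun f hf => indicator_nonneg (fun p _ => hf p) _
    refine mul_nonneg (by positivity) (add_nonneg (hi _ fun p => ?_) (hi _ fun p => ?_)) <;>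
      positivity

/-- The symmetrized kernel in the coordinates `x = r θ`, `z = r y`. -/
theorem FundamentalProfile.symKernel_polar [NeZero N] (h : FundamentalProfile N s τ φ)
    (ξ : E N → ℝ) {θ y : E N} (hθ : ‖θ‖ = 1) (hy : y ≠ 0) {r : ℝ} (hr : 0 < r) :
    r ^ (2 * N - 1) * symKernel N s τ φ ξ (r • θ, r • y)
      = r⁻¹ * (ξ (r • θ) - ξ (r • y)) *
        (wronskian N s τ φ ‖y‖ / ‖θ - y‖ ^ ((N : ℝ) + 2 * s)) := by
  have hN : 1 ≤ N := NeZero.one_le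
  rw [symKernel_eq, ← smul_sub, norm_smul, norm_smul, norm_smul, hθ, Real.norm_of_nonneg hr.le,
    mul_one, h.homogeneous r ‖y‖ hr (norm_pos_iff.2 hy), Real.mul_rpow hr.le (norm_nonneg _)]
  have e : r⁻¹ = r ^ (2 * N - 1) * r ^ (2 * s - (N : ℝ)) / r ^ ((N : ℝ) + 2 * s) := by
    rw [← Real.rpow_natCast, ← Real.rpow_add hr, ← Real.rpow_sub hr, Nat.cast_sub (by omega),
      ← Real.rpow_neg_one]
    congr 1; push_cast; ring
  rw [e]
  simp only [div_eq_mul_inv, mul_inv]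
  ring

theorem FundamentalProfile.integrableOn_symKernel_near [NeZero N]
    (h : FundamentalProfile N s τ φ) (hs1 : s < 1) (hξ : TestBounds ξ L R) :
    IntegrableOn (symKernel N s τ φ ξ) {p | 4 * ‖p.1 - p.2‖ < ‖p.1‖} := by
  have hS : MeasurableSet {p : E N × E N | 4 * ‖p.1 - p.2‖ < ‖p.1‖} :=
    measurableSet_lt (by fun_prop) (by fun_prop)
  have hm := measurable_symKernel (s := s) (τ := τ) h.measurable hξ.continuous
  obtain ⟨D, hD0, hD⟩ := h.lipschitz
  have hL := hξ.nonneg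
  have hR := hξ.pos
  rw [← integrable_indicator_iff hS]
  refine ⟨(hm.indicator hS).aestronglyMeasurable, ?_⟩
  rw [hasFiniteIntegral_iff_enorm, Measure.volume_eq_prod,
    lintegral_prod _ (hm.indicator hS).enorm.aemeasurable,
    lintegral_polarPair (F := fun x z => ‖({p : E N × E N | 4 * ‖p.1 - p.2‖ < ‖p.1‖}.indicator
      (symKernel N s τ φ ξ)) (x, z)‖ₑ) (hm.indicator hS).enorm]
  set B : ℝ → ℝ → ℝ≥0∞ := fun a b => if b < 1 / 4 then
    ENNReal.ofReal (L * D * b ^ (2 - ((N : ℝ) + 2 * s))) else 0 with hB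
  have hfin : ∫⁻ y : E N, B ‖y‖ ‖e1 N - y‖ < ⊤ := by
    have hi := (integrableOn_ball_rpow_norm_sub (N := N) (p := 2 - ((N : ℝ) + 2 * s))
      (by linarith) (e1 N) (1 / 4)).const_mul (L * D)
    refine lt_of_le_of_lt ?_ hi.lintegral_lt_top
    rw [← lintegral_indicator measurableSet_ball]
    refine lintegral_mono fun y => ?_
    by_cases hb : ‖e1 N - y‖ < 1 / 4
    · rw [indicator_of_mem (by rwa [Metric.mem_ball, dist_eq_norm, norm_sub_rev])]
      simp only [hB, if_pos hb]; exact le_rfl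
    · simp only [hB, if_neg hb]; exact zero_le
  have hle : ∀ θ : Metric.sphere (0 : E N) 1, ∫⁻ y : E N, ∫⁻ r in Ioi (0 : ℝ),
      ENNReal.ofReal (r ^ (2 * N - 1)) *
        ‖({p : E N × E N | 4 * ‖p.1 - p.2‖ < ‖p.1‖}.indicator
          (symKernel N s τ φ ξ)) (r • (θ : E N), r • y)‖ₑ
      ≤ ∫⁻ y : E N, ENNReal.ofReal (2 * R) * B ‖y‖ ‖e1 N - y‖ := by
    intro θ
    have hθ : ‖(θ : E N)‖ = 1 := by simp
    rw [← lintegral_rotate (fun a b => ENNReal.ofReal (2 * R) * B a b) hθ]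
    refine lintegral_mono_ae ?_
    filter_upwards [ae_ne_zero (N := N)] with y hy
    have hy0 : 0 < ‖y‖ := norm_pos_iff.2 hy
    have step : ∀ r ∈ Ioi (0 : ℝ), ENNReal.ofReal (r ^ (2 * N - 1)) *
        ‖({p : E N × E N | 4 * ‖p.1 - p.2‖ < ‖p.1‖}.indicator
          (symKernel N s τ φ ξ)) (r • (θ : E N), r • y)‖ₑ
        ≤ (Ioo 0 (2 * R)).indicator (fun _ => B ‖y‖ ‖(θ : E N) - y‖) r := by
      intro r hr
      have hr : 0 < r := hr
      have hiff : (r • (θ : E N), r • y) ∈ {p : E N × E N | 4 * ‖p.1 - p.2‖ < ‖p.1‖} ↔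
          ‖(θ : E N) - y‖ < 1 / 4 := by
        simp only [mem_ofPred_eq]
        rw [← smul_sub, norm_smul, norm_smul, hθ, Real.norm_of_nonneg hr.le]
        constructor
        · intro h5; by_contra h6; nlinarith
        · intro h5; nlinarith
      by_cases hnear : ‖(θ : E N) - y‖ < 1 / 4
      · rw [indicator_of_mem (hiff.2 hnear)]
        have hyb : ‖y‖ ∈ Icc (3 / 4 : ℝ) 2 := by
          have h7 := norm_sub_norm_le (θ : E N) y
          have h8 := norm_sub_norm_le y (θ : E N)
          rw [norm_sub_rev] at h8
          rw [hθ] at h7 h8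
          constructor <;> linarith
        have hyd : |1 - ‖y‖| ≤ ‖(θ : E N) - y‖ := by
          have := abs_norm_sub_norm_le (θ : E N) y
          rwa [hθ] at this
        rw [← Real.enorm_of_nonneg (pow_nonneg hr.le _), ← enorm_mul,
          h.symKernel_polar ξ hθ hy hr]
        by_cases hrR : r < 2 * R
        · rw [indicator_of_mem (show r ∈ Ioo 0 (2 * R) from ⟨hr, hrR⟩)]
          simp only [hB, if_pos hnear]
          rw [Real.enorm_eq_ofReal_abs]
          refine ENNReal.ofReal_le_ofReal ?_
          rcases (norm_nonneg ((θ : E N) - y)).eq_or_lt with h0 | h0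
          · rw [sub_eq_zero.1 (norm_eq_zero.1 h0.symm)]
            simp only [sub_self, mul_zero, zero_mul, abs_zero]
            positivity
          rw [abs_mul, abs_mul, abs_of_pos (inv_pos.2 hr), abs_div,
            abs_of_nonneg (by positivity : 0 ≤ ‖(θ : E N) - y‖ ^ ((N : ℝ) + 2 * s)),
            Real.rpow_sub h0, Real.rpow_two]
          have h3 := hξ.lipschitz (r • (θ : E N)) (r • y)
          rw [← smul_sub, norm_smul, Real.norm_of_nonneg hr.le] at h3
          calc _ ≤ r⁻¹ * (L * (r * ‖(θ : E N) - y‖)) * (D * ‖(θ : E N) - y‖ /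
                ‖(θ : E N) - y‖ ^ ((N : ℝ) + 2 * s)) := by
                gcongr
                exact (hD _ ⟨by linarith [hyb.1], hyb.2⟩).trans (by gcongr)
            _ = _ := by field_simp
        · rw [hξ.eq_zero]
          · simp
          · rw [norm_smul, norm_smul, hθ, Real.norm_of_nonneg hr.le]
            push Not at hrR ⊢
            constructor
            · linarith
            · nlinarith [hyb.1]
      · rw [indicator_of_notMem (fun h5 => hnear (hiff.1 h5)), enorm_zero, mul_zero]
        exact zero_le
    refine (setLIntegral_mono' measurableSet_Ioi step).trans ?_
    rw [setLIntegral_indicator measurableSet_Ioo,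
      inter_eq_left.2 (Ioo_subset_Ioi_self : Ioo 0 (2 * R) ⊆ Ioi 0), setLIntegral_const,
      Real.volume_Ioo, sub_zero, mul_comm]
  refine (lintegral_mono hle).trans_lt ?_
  rw [lintegral_const, lintegral_const_mul' _ _ ENNReal.ofReal_ne_top]
  exact ENNReal.mul_lt_top (ENNReal.mul_lt_top ENNReal.ofReal_lt_top hfin) (measure_lt_top _ _)

/-- The symmetrization converges absolutely across the diagonal as well: both its factors vanish
there to first order. -/
theorem FundamentalProfile.integrable_symKernel [NeZero N] (h : FundamentalProfile N s τ φ)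
    (hs1 : s < 1) (hξ : TestBounds ξ L R) :
    Integrable (symKernel N s τ φ ξ) := by
  have hS : MeasurableSet {p : E N × E N | 4 * ‖p.1 - p.2‖ < ‖p.1‖} :=
    measurableSet_lt (by fun_prop) (by fun_prop)
  have hS5 : MeasurableSet {p : E N × E N | ‖p.1‖ ≤ 5 * ‖p.1 - p.2‖} :=
    measurableSet_le (by fun_prop) (by fun_prop)
  rw [← integrableOn_univ, ← union_compl_self {p : E N × E N | 4 * ‖p.1 - p.2‖ < ‖p.1‖},
    integrableOn_union]
  refine ⟨h.integrableOn_symKernel_near hs1 hξ, ?_⟩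
  refine (h.integrableOn_pairKernel hξ hS.compl (c := 4) (by norm_num)
    fun p hp _ => not_lt.1 hp).add ?_
  have h5 := h.integrableOn_pairKernel hξ hS5 (c := 5) (by norm_num) fun p hp _ => hp
  have hmp : MeasurePreserving (Prod.swap : E N × E N → E N × E N) volume volume :=
    Measure.measurePreserving_swap
  have := (hmp.integrableOn_comp_preimage MeasurableEquiv.prodComm.measurableEmbedding).2 h5
  refine this.mono_set fun p hp => ?_
  have hp : ¬ 4 * ‖p.1 - p.2‖ < ‖p.1‖ := hp
  simp only [mem_preimage, mem_ofPred_eq, Prod.fst_swap, Prod.snd_swap]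
  have := norm_sub_norm_le p.2 p.1
  rw [norm_sub_rev] at this
  rw [norm_sub_rev p.2 p.1]
  linarith

end

end FracHardy

namespace FracHardy

variable {N : ℕ} {s : ℝ}

/-! ### The weighted fractional Laplacian of a test function -/

/-- Truncations of an absolutely convergent integral converge to it. -/
theorem tendsto_setIntegral_le {α : Type*} [MeasurableSpace α] {μ : Measure α} {F d : α → ℝ}
    (hF : Integrable F μ) (hd : Measurable d) (h0 : ∀ p, F p ≠ 0 → 0 < d p) :
    Tendsto (fun ε => ∫ p in {p | ε ≤ d p}, F p ∂μ) (𝓝[>] 0) (𝓝 (∫ p, F p ∂μ)) := by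
  have hm : ∀ ε : ℝ, MeasurableSet {p | ε ≤ d p} := fun ε => measurableSet_le measurable_const hd
  have e : (fun ε : ℝ => ∫ p in {p | ε ≤ d p}, F p ∂μ)
      = fun ε : ℝ => ∫ p, {p | ε ≤ d p}.indicator F p ∂μ := by
    funext ε; rw [integral_indicator (hm ε)]
  rw [e]
  refine tendsto_integral_filter_of_dominated_convergence (fun p => ‖F p‖)
    (Eventually.of_forall fun ε => hF.1.indicator (hm ε))
    (Eventually.of_forall fun ε => Eventually.of_forall fun p => norm_indicator_le_norm_self _ _)
    hF.norm (Eventually.of_forall fun p => ?_)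
  by_cases hp : F p = 0
  · have : ∀ ε : ℝ, {p | ε ≤ d p}.indicator F p = 0 := fun ε => by
      by_cases h : p ∈ {p | ε ≤ d p}
      · rw [indicator_of_mem h, hp]
      · rw [indicator_of_notMem h]
    simp_rw [this, hp]
    exact tendsto_const_nhds
  · refine tendsto_const_nhds.congr' ?_
    filter_upwards [Ioo_mem_nhdsGT (h0 p hp)] with ε hε
    exact (indicator_of_mem (show p ∈ {p | ε ≤ d p} from hε.2.le) F).symm

/-- The kernel of the fractional Laplacian at `x` as a function of `h = z - x`, made even
in `h`. For smooth functions the singularity at `h = 0` becomes integrable. -/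
noncomputable def evenKernel (s : ℝ) (w v : E N → ℝ) (x h : E N) : ℝ :=
  (fracKernel s w v x (x + h) + fracKernel s w v x (x - h)) / 2

theorem evenKernel_zero (s : ℝ) (w v : E N → ℝ) (x : E N) : evenKernel s w v x 0 = 0 := by
  simp [evenKernel, fracKernel]

/-- Truncation is symmetric about `x`, so the truncated integrals do not see the odd part. -/
theorem setIntegral_evenKernel {w v : E N → ℝ} {x : E N} {ε : ℝ}
    (hf : IntegrableOn (fracKernel s w v x) (Metric.ball x ε)ᶜ) :
    IntegrableOn (evenKernel s w v x) {h | ε ≤ ‖h‖} ∧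
      ∫ h in {h | ε ≤ ‖h‖}, evenKernel s w v x h
        = ∫ z in (Metric.ball x ε)ᶜ, fracKernel s w v x z := by
  have hm : MeasurableSet {h : E N | ε ≤ ‖h‖} :=
    measurableSet_le measurable_const measurable_norm
  have hg := (integrable_indicator_iff measurableSet_ball.compl).2 hf
  set g := (Metric.ball x ε)ᶜ.indicator (fracKernel s w v x) with hgdef
  have e : {h : E N | ε ≤ ‖h‖}.indicator (evenKernel s w v x)
      = fun h => (g (x + h) + g (x - h)) / 2 := by
    funext h
    have m1 : x + h ∈ (Metric.ball x ε)ᶜ ↔ ε ≤ ‖h‖ := by simp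
    have m2 : x - h ∈ (Metric.ball x ε)ᶜ ↔ ε ≤ ‖h‖ := by simp
    by_cases h1 : ε ≤ ‖h‖
    · rw [indicator_of_mem (show h ∈ {h : E N | ε ≤ ‖h‖} from h1), hgdef,
        indicator_of_mem (m1.2 h1), indicator_of_mem (m2.2 h1), evenKernel]
    · rw [indicator_of_notMem (show h ∉ {h : E N | ε ≤ ‖h‖} from h1), hgdef,
        indicator_of_notMem (fun h2 => h1 (m1.1 h2)), indicator_of_notMem (fun h2 => h1 (m2.1 h2)),
        add_zero, zero_div]
  have i1 := hg.comp_add_left x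
  have i2 := hg.comp_sub_left x
  refine ⟨?_, ?_⟩
  · rw [← integrable_indicator_iff hm, e]
    exact (i1.add i2).div_const 2
  · rw [← integral_indicator hm, e, integral_div, integral_add i1 i2,
      integral_add_left_eq_self g x, integral_sub_left_eq_self g _ x,
      ← integral_indicator measurableSet_ball.compl]
    ring

/-- If the even kernel is integrable, the principal value is its integral. -/
theorem hasFracLap_of_integrable_evenKernel {w v : E N → ℝ} {x : E N}
    (hf : ∀ ε : ℝ, 0 < ε → IntegrableOn (fracKernel s w v x) (Metric.ball x ε)ᶜ)
    (hQ : Integrable (evenKernel s w v x)) :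
    HasFracLap s w v x (fracConst N s * ∫ h, evenKernel s w v x h) := by
  refine ⟨hf, ?_⟩
  have h := (tendsto_setIntegral_le hQ measurable_norm fun h hh => norm_pos_iff.2 fun h0 =>
    hh (by rw [h0, evenKernel_zero])).const_mul (fracConst N s)
  refine h.congr' ?_
  filter_upwards [self_mem_nhdsWithin] with ε hε
  rw [fracTrunc, (setIntegral_evenKernel (hf ε hε)).2]

theorem exists_rpow_norm_lipschitz (γ : ℝ) :
    ∃ D : ℝ, 0 ≤ D ∧ ∀ x h : E N, x ≠ 0 → 4 * ‖h‖ < ‖x‖ →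
      |‖x + h‖ ^ γ - ‖x‖ ^ γ| ≤ D * (‖x‖ ^ (γ - 1) * ‖h‖) := by
  obtain ⟨D, hD0, hD⟩ := exists_rpow_lipschitz γ
  refine ⟨D, hD0, fun x h hx hh => ?_⟩
  have hx0 : 0 < ‖x‖ := norm_pos_iff.2 hx
  have h1 : |‖x + h‖ - ‖x‖| ≤ ‖h‖ := by
    have := abs_norm_sub_norm_le (x + h) x
    rwa [add_sub_cancel_left] at this
  have h2 := abs_le.1 h1
  have e : ‖x + h‖ = ‖x‖ * (‖x + h‖ / ‖x‖) := by field_simp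
  have hd := hD (‖x + h‖ / ‖x‖)
    ⟨by rw [le_div_iff₀ hx0]; linarith, by rw [div_le_iff₀ hx0]; linarith⟩ 1 (by norm_num)
  rw [Real.one_rpow] at hd
  have h3 : |‖x + h‖ / ‖x‖ - 1| ≤ ‖h‖ / ‖x‖ := by
    rw [div_sub_one hx0.ne', abs_div, abs_of_pos hx0]
    gcongr
  calc |‖x + h‖ ^ γ - ‖x‖ ^ γ|
      = ‖x‖ ^ γ * |(‖x + h‖ / ‖x‖) ^ γ - 1| := by
        conv_lhs => rw [e]
        rw [Real.mul_rpow hx0.le (by positivity), ← mul_sub_one, abs_mul,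
          abs_of_pos (by positivity)]
    _ ≤ ‖x‖ ^ γ * (D * (‖h‖ / ‖x‖)) := by
        gcongr
        exact hd.trans (by gcongr)
    _ = _ := by rw [Real.rpow_sub_one hx0.ne']; ring

variable {ξ : E N → ℝ} {L R : ℝ}

/-- Near the diagonal the even kernel gains two powers of `|h|`; it vanishes for large `x`. -/
theorem TestBounds.exists_evenKernel_le (hξ : TestBounds ξ L R) (s γ : ℝ) :
    ∃ M : ℝ, 0 ≤ M ∧ ∀ x h : E N, x ≠ 0 → 4 * ‖h‖ < ‖x‖ →
      |evenKernel s (GammaOf N γ) ξ x h|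
        ≤ (Metric.ball 0 (2 * R)).indicator (fun x => M * ‖x‖ ^ (γ - 1)) x *
          ‖h‖ ^ (2 - ((N : ℝ) + 2 * s)) := by
  obtain ⟨D, hD0, hD⟩ := exists_rpow_norm_lipschitz (N := N) γ
  have hL := hξ.nonneg
  have hR := hξ.pos
  refine ⟨L * (R + D), by positivity, fun x h hx hh => ?_⟩
  have hx0 : 0 < ‖x‖ := norm_pos_iff.2 hx
  by_cases hxR : ‖x‖ < 2 * R
  · rw [indicator_of_mem (by simpa using hxR)]
    rcases eq_or_ne h 0 with rfl | hh0
    · rw [evenKernel_zero, abs_zero]; positivity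
    have hh1 : 0 < ‖h‖ := norm_pos_iff.2 hh0
    have e : evenKernel s (GammaOf N γ) ξ x h =
        ((2 * ξ x - ξ (x + h) - ξ (x - h)) * ‖x‖ ^ γ
          + (ξ x - ξ (x + h)) * (‖x + h‖ ^ γ - ‖x‖ ^ γ)
          + (ξ x - ξ (x - h)) * (‖x + -h‖ ^ γ - ‖x‖ ^ γ)) / 2 / ‖h‖ ^ ((N : ℝ) + 2 * s) := by
      rw [evenKernel, fracKernel, fracKernel, GammaOf, GammaOf, sub_sub_cancel, ← sub_eq_add_neg,
        show x - (x + h) = -h by abel, norm_neg]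
      ring
    have b1 := hξ.second_difference x h
    have b2 := hξ.lipschitz x (x + h)
    have b3 := hξ.lipschitz x (x - h)
    rw [show x - (x + h) = -h by abel, norm_neg] at b2
    rw [sub_sub_cancel] at b3
    have b4 := hD x h hx hh
    have b5 := hD x (-h) hx (by rwa [norm_neg])
    rw [norm_neg] at b5
    have b6 : ‖x‖ ^ γ ≤ 2 * R * ‖x‖ ^ (γ - 1) := by
      rw [Real.rpow_sub_one hx0.ne', mul_div_assoc', le_div_iff₀ hx0, mul_comm]
      gcongr
    rw [e, abs_div, abs_div, abs_two,
      abs_of_nonneg (by positivity : 0 ≤ ‖h‖ ^ ((N : ℝ) + 2 * s)), Real.rpow_sub hh1,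
      Real.rpow_two, mul_div_assoc']
    gcongr
    rw [div_le_iff₀ two_pos]
    refine (abs_add_three _ _ _).trans ?_
    rw [abs_mul, abs_mul, abs_mul, abs_of_pos (by positivity : 0 < ‖x‖ ^ γ)]
    calc _ ≤ L * ‖h‖ ^ 2 * (2 * R * ‖x‖ ^ (γ - 1)) + L * ‖h‖ * (D * (‖x‖ ^ (γ - 1) * ‖h‖))
          + L * ‖h‖ * (D * (‖x‖ ^ (γ - 1) * ‖h‖)) := by gcongr
      _ = _ := by ring
  · have hxR := not_lt.1 hxR
    have h1 : ξ x = 0 := hξ.support x (by linarith)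
    have h2 : ξ (x + h) = 0 := hξ.support _ (by
      have := norm_sub_le_norm_add x h
      linarith)
    have h3 : ξ (x - h) = 0 := hξ.support _ (by
      have := norm_sub_norm_le x h
      linarith)
    rw [indicator_of_notMem (by simpa using hxR), zero_mul]
    simp [evenKernel, fracKernel, h1, h2, h3]

theorem measurable_evenKernel (hξ : Continuous ξ) (γ : ℝ) :
    Measurable fun p : E N × E N => evenKernel s (GammaOf N γ) ξ p.1 p.2 := by
  have := hξ.measurable
  unfold evenKernel fracKernel GammaOf
  fun_prop

theorem HasFracLap.fracLap_eq {w v : E N → ℝ} {x : E N} {l : ℝ} (h : HasFracLap s w v x l) :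
    fracLap s w v x = l :=
  h.2.limUnder_eq

variable [NeZero N]

theorem TestBounds.integrableOn_fracKernel (hξ : TestBounds ξ L R) {γ : ℝ} (hγ : -(N : ℝ) < γ)
    (hγs : γ < 2 * s) (x : E N) {ε : ℝ} (hε : 0 < ε) :
    IntegrableOn (fracKernel s (GammaOf N γ) ξ x) (Metric.ball x ε)ᶜ := by
  have hi := (integrableOn_rpow_norm_div (κ := N + 2 * s) hγ (by linarith) (by linarith) x
    hε).const_mul L
  have hm := hξ.continuous.measurable
  refine Integrable.mono' hi (Measurable.aestronglyMeasurable ?_) (Eventually.of_forall fun z => ?_)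
  · unfold fracKernel GammaOf
    fun_prop
  · rw [fracKernel, GammaOf, norm_mul, norm_div, Real.norm_of_nonneg
      (by positivity : 0 ≤ ‖x - z‖ ^ ((N : ℝ) + 2 * s)), Real.norm_of_nonneg
      (by positivity : 0 ≤ ‖z‖ ^ γ), div_mul_eq_mul_div, mul_div_assoc]
    exact mul_le_mul_of_nonneg_right (hξ.bounded x z) (by positivity)

theorem TestBounds.integrable_evenKernel (hξ : TestBounds ξ L R) (hs1 : s < 1) {γ : ℝ}
    (hγ : -(N : ℝ) < γ) (hγs : γ < 2 * s) {x : E N} (hx : x ≠ 0) :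
    Integrable (evenKernel s (GammaOf N γ) ξ x) := by
  have hx0 : 0 < ‖x‖ := norm_pos_iff.2 hx
  obtain ⟨M, hM0, hM⟩ := hξ.exists_evenKernel_le s γ
  rw [← integrableOn_univ, ← union_compl_self (Metric.ball (0 : E N) (‖x‖ / 4)),
    integrableOn_union]
  constructor
  · refine Integrable.mono' ((integrableOn_ball_rpow_norm (N := N) (p := 2 - ((N : ℝ) + 2 * s))
      (by linarith) (‖x‖ / 4)).const_mul
        ((Metric.ball 0 (2 * R)).indicator (fun x => M * ‖x‖ ^ (γ - 1)) x))
      ((measurable_evenKernel hξ.continuous γ).comp measurable_prodMk_left).aestronglyMeasurable ?_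
    filter_upwards [ae_restrict_mem measurableSet_ball] with h hh
    refine hM x h hx ?_
    rw [Metric.mem_ball, dist_zero_right] at hh
    linarith
  · have e : (Metric.ball (0 : E N) (‖x‖ / 4))ᶜ = {h | ‖x‖ / 4 ≤ ‖h‖} := by
      ext h; simp
    rw [e]
    exact (setIntegral_evenKernel (hξ.integrableOn_fracKernel hγ hγs x (by positivity))).1

/-- The weighted fractional Laplacian of a test function is defined away from the origin, where the
weight is smooth. -/
theorem TestBounds.hasFracLap (hξ : TestBounds ξ L R) (hs1 : s < 1) {γ : ℝ}
    (hγ : -(N : ℝ) < γ) (hγs : γ < 2 * s) {x : E N} (hx : x ≠ 0) :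
    HasFracLap s (GammaOf N γ) ξ x (fracConst N s * ∫ h, evenKernel s (GammaOf N γ) ξ x h) :=
  hasFracLap_of_integrable_evenKernel (fun _ hε => hξ.integrableOn_fracKernel hγ hγs x hε)
    (hξ.integrable_evenKernel hs1 hγ hγs hx)

end FracHardy

namespace FracHardy

variable {N : ℕ} {s τ : ℝ} {φ : ℝ → ℝ} {ξ : E N → ℝ} {L R : ℝ}

/-! ### The pairing as a symmetric double integral -/

/-- The double integral in the coordinates `(x, z - x)`, made even in the second variable. -/
noncomputable def evenPair (N : ℕ) (s τ : ℝ) (φ : ℝ → ℝ) (ξ : E N → ℝ) (p : E N × E N) : ℝ :=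
  φ ‖p.1‖ * evenKernel s (GammaOf N (2 * s - N - τ)) ξ p.1 p.2

theorem measurable_evenPair (hφ : Measurable φ) (hξ : Continuous ξ) :
    Measurable (evenPair N s τ φ ξ) :=
  (hφ.comp (by fun_prop)).mul (measurable_evenKernel hξ _)

/-- The change of variables `z = x ± h` on regions described by `|x|` and `|x - z| = |h|`. -/
theorem setIntegral_evenPair (hφ : Measurable φ) (hξ : Continuous ξ) {A : Set (ℝ × ℝ)}
    (hA : MeasurableSet A)
    (hf : IntegrableOn (pairKernel N s τ φ ξ) {p | (‖p.1‖, ‖p.1 - p.2‖) ∈ A}) :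
    IntegrableOn (evenPair N s τ φ ξ) {p | (‖p.1‖, ‖p.2‖) ∈ A} ∧
      ∫ p in {p | (‖p.1‖, ‖p.2‖) ∈ A}, evenPair N s τ φ ξ p
        = ∫ p in {p | (‖p.1‖, ‖p.1 - p.2‖) ∈ A}, pairKernel N s τ φ ξ p := by
  have hm : MeasurableSet {p : E N × E N | (‖p.1‖, ‖p.2‖) ∈ A} :=
    (by fun_prop : Measurable fun p : E N × E N => (‖p.1‖, ‖p.2‖)) hA
  have hm' : MeasurableSet {p : E N × E N | (‖p.1‖, ‖p.1 - p.2‖) ∈ A} :=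
    (by fun_prop : Measurable fun p : E N × E N => (‖p.1‖, ‖p.1 - p.2‖)) hA
  have hg := (integrable_indicator_iff hm').2 hf
  set g := {p : E N × E N | (‖p.1‖, ‖p.1 - p.2‖) ∈ A}.indicator (pairKernel N s τ φ ξ) with hgdef
  have e : {p : E N × E N | (‖p.1‖, ‖p.2‖) ∈ A}.indicator (evenPair N s τ φ ξ)
      = fun p => (g (p.1, p.1 + p.2) + g (p.1, p.1 + -p.2)) / 2 := by
    funext ⟨x, h⟩
    have m1 : (x, x + h) ∈ {p : E N × E N | (‖p.1‖, ‖p.1 - p.2‖) ∈ A} ↔ (‖x‖, ‖h‖) ∈ A := by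
      simp
    have m2 : (x, x + -h) ∈ {p : E N × E N | (‖p.1‖, ‖p.1 - p.2‖) ∈ A} ↔ (‖x‖, ‖h‖) ∈ A := by
      simp
    by_cases h1 : (‖x‖, ‖h‖) ∈ A
    · rw [indicator_of_mem (show (x, h) ∈ {p : E N × E N | (‖p.1‖, ‖p.2‖) ∈ A} from h1), hgdef]
      simp only
      rw [indicator_of_mem (m1.2 h1), indicator_of_mem (m2.2 h1), evenPair, evenKernel,
        pairKernel, pairKernel, ← sub_eq_add_neg]
      ring
    · rw [indicator_of_notMem (show (x, h) ∉ {p : E N × E N | (‖p.1‖, ‖p.2‖) ∈ A} from h1), hgdef]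
      simp only
      rw [indicator_of_notMem (fun h2 => h1 (m1.1 h2)), indicator_of_notMem (fun h2 => h1 (m2.1 h2)),
        add_zero, zero_div]
  have p1 : MeasurePreserving (fun p : E N × E N => (p.1, p.1 + p.2)) volume volume :=
    measurePreserving_prod_add volume volume
  have p2 : MeasurePreserving (fun p : E N × E N => (p.1, p.1 + -p.2)) volume volume :=
    p1.comp ((MeasurePreserving.id volume).prod (Measure.measurePreserving_neg volume))
  have hgm : ∀ μ : Measure (E N × E N), AEStronglyMeasurable g μ := fun μ =>
    ((measurable_pairKernel hφ hξ).indicator hm').aestronglyMeasurable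
  have i1 : Integrable fun p : E N × E N => g (p.1, p.1 + p.2) :=
    p1.integrable_comp_of_integrable hg
  have i2 : Integrable fun p : E N × E N => g (p.1, p.1 + -p.2) :=
    p2.integrable_comp_of_integrable hg
  have e1 : ∫ p : E N × E N, g (p.1, p.1 + p.2) = ∫ p, g p := by
    conv_rhs => rw [← p1.map_eq]
    rw [integral_map p1.measurable.aemeasurable (hgm _)]
  have e2 : ∫ p : E N × E N, g (p.1, p.1 + -p.2) = ∫ p, g p := by
    conv_rhs => rw [← p2.map_eq]
    rw [integral_map p2.measurable.aemeasurable (hgm _)]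
  refine ⟨?_, ?_⟩
  · rw [← integrable_indicator_iff hm, e]
    exact (i1.add i2).div_const 2
  · rw [← integral_indicator hm, e, integral_div, integral_add i1 i2, e1, e2,
      ← integral_indicator hm']
    ring

/-- The region `|x - z| ≥ ε` is invariant under exchange of the variables. -/
theorem setIntegral_pairKernel_eq_symKernel {ε : ℝ}
    (hf : IntegrableOn (pairKernel N s τ φ ξ) {p | ε ≤ ‖p.1 - p.2‖}) :
    ∫ p in {p | ε ≤ ‖p.1 - p.2‖}, pairKernel N s τ φ ξ p
      = 1 / 2 * ∫ p in {p | ε ≤ ‖p.1 - p.2‖}, symKernel N s τ φ ξ p := by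
  have hmp : MeasurePreserving (Prod.swap : E N × E N → E N × E N) volume volume :=
    Measure.measurePreserving_swap
  have hpre : Prod.swap ⁻¹' {p : E N × E N | ε ≤ ‖p.1 - p.2‖} = {p | ε ≤ ‖p.1 - p.2‖} := by
    ext p
    simp [norm_sub_rev]
  have hemb : MeasurableEmbedding (Prod.swap : E N × E N → E N × E N) :=
    MeasurableEquiv.prodComm.measurableEmbedding
  have i2 := (hmp.integrableOn_comp_preimage hemb).2 hf
  have e2 := hmp.setIntegral_preimage_emb hemb (pairKernel N s τ φ ξ)
    {p : E N × E N | ε ≤ ‖p.1 - p.2‖}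
  rw [hpre] at i2 e2
  have : ∫ p in {p | ε ≤ ‖p.1 - p.2‖}, symKernel N s τ φ ξ p
      = (∫ p in {p | ε ≤ ‖p.1 - p.2‖}, pairKernel N s τ φ ξ p)
        + ∫ p : E N × E N in {p | ε ≤ ‖p.1 - p.2‖}, pairKernel N s τ φ ξ p.swap :=
    integral_add hf i2
  rw [this, e2]
  ring

variable [NeZero N]

/-- Absolute convergence of the double integral, with the kernel made even. -/
theorem FundamentalProfile.integrable_evenPair (h : FundamentalProfile N s τ φ) (hs0 : 0 < s)
    (hs1 : s < 1) (hξ : TestBounds ξ L R) : Integrable (evenPair N s τ φ ξ) := by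
  have hS : MeasurableSet {p : E N × E N | 4 * ‖p.2‖ < ‖p.1‖} :=
    measurableSet_lt (by fun_prop) (by fun_prop)
  have hm := measurable_evenPair (s := s) (τ := τ) h.measurable hξ.continuous
  rw [← integrableOn_univ, ← union_compl_self {p : E N × E N | 4 * ‖p.2‖ < ‖p.1‖},
    integrableOn_union]
  constructor
  -- For `4|h| < |x|` the factor `|h|^(2-N-2s)` is at most `|h|^(1-s-N) |x|^(1-s)`, which separates
  -- the variables and leaves integrable powers of both.
  · obtain ⟨D, hD0, hD⟩ := h.growth (s / 2) (by linarith)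
    obtain ⟨M, hM0, hM⟩ := hξ.exists_evenKernel_le s (2 * s - N - τ)
    have j1 := integrableOn_ball_rpow_norm (N := N) (p := s - N - s / 2) (by linarith) (2 * R)
    have j2 := integrableOn_ball_rpow_norm (N := N) (p := s - N + s / 2) (by linarith) (2 * R)
    have j3 := integrableOn_ball_rpow_norm (N := N) (p := 1 - s - N) (by linarith) R
    have J := ((integrable_indicator_iff measurableSet_ball).2
      ((j1.add j2).const_mul (D * M))).mul_prod
        ((integrable_indicator_iff measurableSet_ball).2 j3)
    refine Integrable.mono' J.integrableOn hm.aestronglyMeasurable ?_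
    filter_upwards [ae_restrict_mem hS, ae_restrict_of_ae (ae_prod_ne_zero (N := N))]
      with ⟨x, k⟩ hp hxk
    have hx : 0 < ‖x‖ := norm_pos_iff.2 hxk.1
    have hk : 0 < ‖k‖ := norm_pos_iff.2 hxk.2
    have hp : 4 * ‖k‖ < ‖x‖ := hp
    have hb := hM x k hxk.1 hp
    rw [evenPair, norm_mul]
    by_cases hxR : ‖x‖ < 2 * R
    · have hkR : ‖k‖ < R := by linarith
      simp only
      rw [indicator_of_mem (by simpa using hxR)] at hb
      rw [indicator_of_mem (by simpa using hxR), indicator_of_mem (by simpa using hkR),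
        Pi.add_apply]
      have hkx : ‖k‖ ^ (1 - s) ≤ ‖x‖ ^ (1 - s) :=
        Real.rpow_le_rpow hk.le (by linarith) (by linarith)
      have ek : ‖k‖ ^ (2 - ((N : ℝ) + 2 * s)) = ‖k‖ ^ (1 - s - N) * ‖k‖ ^ (1 - s) := by
        rw [← Real.rpow_add hk]; congr 1; ring
      have ex : ∀ e : ℝ, ‖x‖ ^ (τ + e) * ‖x‖ ^ (2 * s - N - τ - 1) * ‖x‖ ^ (1 - s)
          = ‖x‖ ^ (s - N + e) := fun e => by
        rw [← Real.rpow_add hx, ← Real.rpow_add hx]; congr 1; ring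
      calc ‖φ ‖x‖‖ * ‖evenKernel s (GammaOf N (2 * s - N - τ)) ξ x k‖
          ≤ (D * (‖x‖ ^ (τ - s / 2) + ‖x‖ ^ (τ + s / 2))) *
            (M * ‖x‖ ^ (2 * s - N - τ - 1) * ‖k‖ ^ (2 - ((N : ℝ) + 2 * s))) :=
            mul_le_mul (hD _ hx) hb (norm_nonneg _) (by positivity)
        _ ≤ (D * (‖x‖ ^ (τ - s / 2) + ‖x‖ ^ (τ + s / 2))) *
            (M * ‖x‖ ^ (2 * s - N - τ - 1) * (‖k‖ ^ (1 - s - N) * ‖x‖ ^ (1 - s))) := by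
            rw [ek]; gcongr
        _ = D * M * (‖x‖ ^ (τ + -(s / 2)) * ‖x‖ ^ (2 * s - N - τ - 1) * ‖x‖ ^ (1 - s)
            + ‖x‖ ^ (τ + s / 2) * ‖x‖ ^ (2 * s - N - τ - 1) * ‖x‖ ^ (1 - s))
            * ‖k‖ ^ (1 - s - N) := by
            rw [← sub_eq_add_neg]; ring
        _ = _ := by rw [ex, ex, ← sub_eq_add_neg]
    · rw [indicator_of_notMem (by simpa using hxR), zero_mul] at hb
      have h0 : ‖evenKernel s (GammaOf N (2 * s - N - τ)) ξ x k‖ = 0 :=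
        le_antisymm hb (norm_nonneg _)
      simp only
      rw [h0, mul_zero, indicator_of_notMem (by simpa using hxR), zero_mul]
  · have hA0 : MeasurableSet {q : ℝ × ℝ | 4 * q.2 < q.1} :=
      measurableSet_lt (by fun_prop) (by fun_prop)
    have hA : MeasurableSet {q : ℝ × ℝ | ¬ 4 * q.2 < q.1} := hA0.compl
    have hA' : MeasurableSet {p : E N × E N | (‖p.1‖, ‖p.1 - p.2‖) ∈
        {q : ℝ × ℝ | ¬ 4 * q.2 < q.1}} :=
      (by fun_prop : Measurable fun p : E N × E N => (‖p.1‖, ‖p.1 - p.2‖)) hA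
    exact (setIntegral_evenPair h.measurable hξ.continuous hA
      (h.integrableOn_pairKernel hξ hA' (c := 4) (by norm_num) fun p hp _ => not_lt.1 hp)).1

/-- The double integral is half the integral of the symmetrized kernel: this holds after cutting
off `|x - z| < ε`, where the symmetrization is a change of variables, and both sides converge
as `ε → 0`. -/
theorem FundamentalProfile.integral_evenPair (h : FundamentalProfile N s τ φ) (hs0 : 0 < s)
    (hs1 : s < 1) (hξ : TestBounds ξ L R) :
    ∫ p, evenPair N s τ φ ξ p = 1 / 2 * ∫ p, symKernel N s τ φ ξ p := by
  have hR := hξ.pos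
  have l1 := tendsto_setIntegral_le (h.integrable_evenPair hs0 hs1 hξ)
    (d := fun p => ‖p.2‖) (by fun_prop) (by
      rintro ⟨x, k⟩ hne
      refine norm_pos_iff.2 fun h0 => hne ?_
      have h0 : k = 0 := h0
      simp [evenPair, h0, evenKernel_zero])
  have l2 := (tendsto_setIntegral_le (h.integrable_symKernel hs1 hξ)
    (d := fun p => ‖p.1 - p.2‖) (by fun_prop) (by
      rintro ⟨x, z⟩ hne
      refine norm_pos_iff.2 fun h0 => hne ?_
      have h0 : x = z := sub_eq_zero.1 h0
      simp [symKernel_eq, h0])).const_mul (1 / 2)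
  refine tendsto_nhds_unique l1 (l2.congr' ?_)
  filter_upwards [self_mem_nhdsWithin] with ε hε
  have hε : 0 < ε := hε
  have hA : MeasurableSet {q : ℝ × ℝ | ε ≤ q.2} := measurableSet_le (by fun_prop) (by fun_prop)
  have hS : MeasurableSet {p : E N × E N | ε ≤ ‖p.1 - p.2‖} :=
    measurableSet_le (by fun_prop) (by fun_prop)
  have hi : IntegrableOn (pairKernel N s τ φ ξ) {p | ε ≤ ‖p.1 - p.2‖} := by
    refine h.integrableOn_pairKernel hξ hS (c := R / ε + 1) (by positivity) fun p hp hpR => ?_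
    have hp : ε ≤ ‖p.1 - p.2‖ := hp
    have h1 : R ≤ R / ε * ‖p.1 - p.2‖ := by
      rw [div_mul_eq_mul_div, le_div_iff₀ hε]
      gcongr
    have h2 := norm_sub_norm_le p.1 p.2
    have h3 := norm_nonneg (p.1 - p.2)
    rcases hpR with hpR | hpR <;> linarith
  rw [← setIntegral_pairKernel_eq_symKernel hi]
  exact (setIntegral_evenPair h.measurable hξ.continuous hA hi).2.symm

/-- The pairing of `Φ` with the weighted fractional Laplacian of a test function, as an absolutely
convergent symmetric double integral. -/
theorem FundamentalProfile.integrable_and_integral_fracLap (h : FundamentalProfile N s τ φ)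
    (hs0 : 0 < s) (hs1 : s < 1) (hξ : TestBounds ξ L R) :
    Integrable (fun x : E N => φ ‖x‖ * fracLap s (GammaOf N (2 * s - N - τ)) ξ x) ∧
      ∫ x : E N, φ ‖x‖ * fracLap s (GammaOf N (2 * s - N - τ)) ξ x
        = fracConst N s * (1 / 2 * ∫ p, symKernel N s τ φ ξ p) := by
  have hτ := h.neg_lt
  have hc := h.le_critical
  have hi := h.integrable_evenPair hs0 hs1 hξ
  have e : (fun x : E N => φ ‖x‖ * fracLap s (GammaOf N (2 * s - N - τ)) ξ x)
      =ᵐ[volume] fun x => fracConst N s * ∫ k, evenPair N s τ φ ξ (x, k) := by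
    filter_upwards [ae_ne_zero (N := N)] with x hx
    rw [(hξ.hasFracLap hs1 (by linarith) (by linarith) hx).fracLap_eq]
    simp only [evenPair]
    rw [integral_const_mul]
    ring
  refine ⟨(hi.integral_prod_left.const_mul _).congr e.symm, ?_⟩
  rw [integral_congr_ae e, integral_const_mul, ← h.integral_evenPair hs0 hs1 hξ,
    Measure.volume_eq_prod, integral_prod _ hi]

end FracHardy

namespace FracHardy

open scoped ENNReal

variable {N : ℕ} {s τ : ℝ} {φ : ℝ → ℝ} {ξ : E N → ℝ} {L R : ℝ}

/-! ### Evaluation of the symmetric double integral -/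

/-- The logarithmic integral `∫₀^∞ (ξ(r u) - ξ(r v)) dr / r`. -/
noncomputable def rayIntegral (ξ : E N → ℝ) (u v : E N) : ℝ :=
  ∫ r in Ioi (0 : ℝ), r⁻¹ * (ξ (r • u) - ξ (r • v))

theorem TestBounds.integrableOn_ray (hξ : TestBounds ξ L R) {u v : E N} (hu : u ≠ 0)
    (hv : v ≠ 0) : IntegrableOn (fun r : ℝ => r⁻¹ * (ξ (r • u) - ξ (r • v))) (Ioi 0) := by
  have hL := hξ.nonneg
  have hR := hξ.pos
  have hu0 : 0 < ‖u‖ := norm_pos_iff.2 hu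
  have hv0 : 0 < ‖v‖ := norm_pos_iff.2 hv
  have hξm := hξ.continuous.measurable
  set ρ := R / min ‖u‖ ‖v‖ with hρ
  have hb : Integrable ((Ioo 0 ρ).indicator fun _ : ℝ => L * ‖u - v‖) :=
    (integrable_indicator_iff measurableSet_Ioo).2 (integrableOn_const (by simp))
  refine Integrable.mono' hb.integrableOn (by fun_prop : Measurable _).aestronglyMeasurable ?_
  filter_upwards [ae_restrict_mem measurableSet_Ioi] with r hr
  have hr : 0 < r := hr
  by_cases hrρ : r < ρ
  · rw [indicator_of_mem (show r ∈ Ioo 0 ρ from ⟨hr, hrρ⟩), norm_mul,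
      Real.norm_of_nonneg (inv_pos.2 hr).le]
    have h1 := hξ.lipschitz (r • u) (r • v)
    rw [← smul_sub, norm_smul, Real.norm_of_nonneg hr.le] at h1
    calc r⁻¹ * ‖ξ (r • u) - ξ (r • v)‖ ≤ r⁻¹ * (L * (r * ‖u - v‖)) := by
          gcongr
          exact h1
      _ = L * ‖u - v‖ := by field_simp
  · have h1 : R ≤ r * min ‖u‖ ‖v‖ := by
      rw [not_lt, hρ, div_le_iff₀ (lt_min hu0 hv0)] at hrρ
      exact hrρ
    rw [indicator_of_notMem (fun h => hrρ h.2), hξ.eq_zero, mul_zero, norm_zero]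
    rw [norm_smul, norm_smul, Real.norm_of_nonneg hr.le]
    push Not
    exact ⟨h1.trans (by gcongr; exact min_le_left _ _),
      h1.trans (by gcongr; exact min_le_right _ _)⟩

/-- Frullani's integral for `r ↦ ξ(r u)`, which tends to `ξ(0)` at `0` and vanishes for large `r`. -/
theorem TestBounds.rayIntegral_smul (hξ : TestBounds ξ L R) {u : E N} (hu : u ≠ 0) {ρ : ℝ}
    (hρ : 0 < ρ) : rayIntegral ξ u (ρ • u) = Real.log ρ * ξ 0 := by
  have hu0 : 0 < ‖u‖ := norm_pos_iff.2 hu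
  have hcont : Continuous fun r : ℝ => ξ (r • u) := hξ.continuous.comp (by fun_prop)
  have hint := hξ.integrableOn_ray hu (smul_ne_zero hρ.ne' hu)
  have e : (fun r : ℝ => r⁻¹ • (ξ ((1 * r) • u) - ξ ((ρ * r) • u)))
      = fun r : ℝ => r⁻¹ * (ξ (r • u) - ξ (r • ρ • u)) := by
    funext r
    rw [one_mul, smul_smul, mul_comm r ρ, smul_eq_mul]
  have h := Frullani.integral_Ioi_eq (f := fun r : ℝ => ξ (r • u)) (L := ξ 0) (R := 0)
    (hcont.locallyIntegrable.locallyIntegrableOn _) one_pos hρ ?_ ?_ (by rw [e]; exact hint)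
  · rw [e] at h
    rw [rayIntegral, h, div_one, sub_zero, smul_eq_mul]
  · have := hcont.tendsto 0
    rw [zero_smul] at this
    exact this.mono_left nhdsWithin_le_nhds
  · refine tendsto_const_nhds.congr' ?_
    filter_upwards [eventually_ge_atTop (R / ‖u‖), eventually_ge_atTop 0] with r hr hr0
    refine (hξ.support _ ?_).symm
    rwa [norm_smul, Real.norm_of_nonneg hr0, ← div_le_iff₀ hu0]

/-- After exchange of the two directions only the radial difference of `ξ` remains, and Frullani's
formula evaluates its logarithmic integral. -/
theorem TestBounds.rayIntegral_add (hξ : TestBounds ξ L R) {u v : E N} (hu : u ≠ 0) (hv : v ≠ 0)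
    {ρ : ℝ} (hρ : 0 < ρ) :
    rayIntegral ξ u (ρ • v) + rayIntegral ξ v (ρ • u) = 2 * Real.log ρ * ξ 0 := by
  have hu' := smul_ne_zero hρ.ne' hu
  have hv' := smul_ne_zero hρ.ne' hv
  have h1 := hξ.rayIntegral_smul hu hρ
  have h2 := hξ.rayIntegral_smul hv hρ
  have : rayIntegral ξ u (ρ • v) + rayIntegral ξ v (ρ • u)
      = rayIntegral ξ u (ρ • u) + rayIntegral ξ v (ρ • v) := by
    unfold rayIntegral
    rw [← integral_add (hξ.integrableOn_ray hu hv') (hξ.integrableOn_ray hv hu'),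
      ← integral_add (hξ.integrableOn_ray hu hu') (hξ.integrableOn_ray hv hv')]
    refine integral_congr_ae (Eventually.of_forall fun r => ?_)
    ring
  rw [this, h1, h2]
  ring

/-- The distance from `θ` to `ρ θ'` depends on the two directions symmetrically. -/
theorem norm_sub_smul_comm {θ θ' : E N} (hθ : ‖θ‖ = 1) (hθ' : ‖θ'‖ = 1) (ρ : ℝ) :
    ‖θ - ρ • θ'‖ = ‖θ' - ρ • θ‖ := by
  rw [← sq_eq_sq₀ (norm_nonneg _) (norm_nonneg _), norm_sub_sq_real, norm_sub_sq_real,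
    norm_smul, norm_smul, hθ, hθ', real_inner_smul_right, real_inner_smul_right,
    real_inner_comm θ θ']

/-- The logarithmic kernel on `S^(N-1) × ℝ^N`. -/
noncomputable def logKernel (N : ℕ) (s τ : ℝ) (φ : ℝ → ℝ)
    (p : Metric.sphere (0 : E N) 1 × E N) : ℝ :=
  Real.log ‖p.2‖ * wronskian N s τ φ ‖p.2‖ / ‖(p.1 : E N) - p.2‖ ^ ((N : ℝ) + 2 * s)

theorem FundamentalProfile.measurable_logKernel (h : FundamentalProfile N s τ φ) :
    Measurable (logKernel N s τ φ) := by
  have := h.measurable_wronskian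
  unfold logKernel
  fun_prop

variable [NeZero N]

/-- Polar coordinates in the second factor of `S^(N-1) × ℝ^N`. -/
theorem measurePreserving_polarSnd :
    MeasurePreserving (fun p : (Metric.sphere (0 : E N) 1 × Metric.sphere (0 : E N) 1) × ℝ =>
        (p.1.1, p.2 • (p.1.2 : E N)))
      (((volume : Measure (E N)).toSphere.prod (volume : Measure (E N)).toSphere).prod
        (powMeasure (N - 1)))
      ((volume : Measure (E N)).toSphere.prod volume) := by
  refine ⟨by fun_prop, Measure.ext_of_lintegral _ fun F hF => ?_⟩
  rw [lintegral_map hF (by fun_prop), lintegral_prod _ (by fun_prop),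
    lintegral_prod _ (by fun_prop), lintegral_prod _ (by fun_prop)]
  refine lintegral_congr fun θ => ?_
  rw [lintegral_polar (by fun_prop)]

theorem ae_powMeasure_pos (k : ℕ) : ∀ᵐ r ∂powMeasure k, 0 < r :=
  (withDensity_absolutelyContinuous _ _).ae_le (ae_restrict_mem measurableSet_Ioi)

theorem FundamentalProfile.integrable_logKernel (h : FundamentalProfile N s τ φ) (hs0 : 0 < s)
    (hs1 : s < 1) :
    Integrable (logKernel N s τ φ) ((volume : Measure (E N)).toSphere.prod volume) := by
  have hm := h.measurable_logKernel
  refine ⟨hm.aestronglyMeasurable, ?_⟩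
  rw [hasFiniteIntegral_iff_enorm, lintegral_prod _ (by fun_prop)]
  have e : ∀ θ : Metric.sphere (0 : E N) 1, ∫⁻ y : E N, ‖logKernel N s τ φ (θ, y)‖ₑ
      = ∫⁻ y : E N, ‖Real.log ‖y‖ * wronskian N s τ φ ‖y‖ /
        ‖e1 N - y‖ ^ ((N : ℝ) + 2 * s)‖ₑ := fun θ => by
    simp only [logKernel]
    exact lintegral_rotate
      (fun a b => ‖Real.log a * wronskian N s τ φ a / b ^ ((N : ℝ) + 2 * s)‖ₑ) (by simp)
  simp_rw [e]
  rw [lintegral_const]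
  exact ENNReal.mul_lt_top (h.integrable_log_wronskian hs0 hs1).2 (measure_lt_top _ _)

/-- The logarithm and the Wronskian are both odd under inversion, so the inside and the outside of the
unit ball contribute equally. -/
theorem FundamentalProfile.integral_log_wronskian (h : FundamentalProfile N s τ φ) (hs0 : 0 < s)
    (hs1 : s < 1) :
    ∫ y : E N, Real.log ‖y‖ * wronskian N s τ φ ‖y‖ / ‖e1 N - y‖ ^ ((N : ℝ) + 2 * s)
      = 2 * normIntegral N s τ φ := by
  have hi := h.integrable_log_wronskian hs0 hs1
  have h1 : (({y : E N | 1 < ‖y‖} ∪ punctured N : Set (E N))) =ᵐ[volume] (univ : Set (E N)) := by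
    rw [ae_eq_univ, ← mem_ae_iff]
    filter_upwards [ae_norm_ne_one (N := N), ae_ne_zero (N := N)] with y hy1 hy0
    rcases lt_or_gt_of_ne hy1 with hy | hy
    · exact Or.inr ⟨norm_pos_iff.2 hy0, hy⟩
    · exact Or.inl hy
  have hd : Disjoint {y : E N | 1 < ‖y‖} (punctured N) :=
    disjoint_left.2 fun y (hy : 1 < ‖y‖) hy' => lt_asymm hy hy'.2
  rw [← setIntegral_univ (μ := volume), ← setIntegral_congr_set h1,
    setIntegral_union hd measurableSet_punctured hi.integrableOn hi.integrableOn,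
    integral_outside, normIntegral, two_mul (∫ y in punctured N, _)]
  rw [add_left_inj]
  refine setIntegral_congr_fun measurableSet_punctured fun y hy => ?_
  rw [inversion_weight (norm_pos_iff.1 hy.1), norm_inv0, Real.log_inv, mul_left_comm,
    h.wronskian_inv hy.1]
  ring

/-- The symmetric double integral is a multiple of `ξ(0)`. In the coordinates `x = r θ`, `z = r y`
the kernel is `(ξ(r θ) - ξ(r y)) dr / r` times a function of `|y|` and `|θ - y|`, and the latter is
invariant under exchange of `θ` and the direction of `y`. -/
theorem FundamentalProfile.integral_symKernel (h : FundamentalProfile N s τ φ) (hs0 : 0 < s)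
    (hs1 : s < 1) (hξ : TestBounds ξ L R) :
    ∫ p, symKernel N s τ φ ξ p = 2 * sphereArea N * normIntegral N s τ φ * ξ 0 := by
  have hi := h.integrable_symKernel hs1 hξ
  have hm := measurable_symKernel (s := s) (τ := τ) h.measurable hξ.continuous
  have hP : MeasurePreserving (fun p : (Metric.sphere (0 : E N) 1 × E N) × ℝ =>
        (p.2 • (p.1.1 : E N), p.2 • p.1.2))
      (((volume : Measure (E N)).toSphere.prod volume).prod (powMeasure (2 * N - 1))) volume :=
    ⟨by fun_prop, map_polarPair⟩
  set J : Metric.sphere (0 : E N) 1 × E N → ℝ := fun q =>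
    ∫ r, symKernel N s τ φ ξ (r • (q.1 : E N), r • q.2) ∂powMeasure (2 * N - 1) with hJ
  have hi' := hP.integrable_comp_of_integrable hi
  have hJi : Integrable J ((volume : Measure (E N)).toSphere.prod volume) :=
    Integrable.integral_prod_left (μ := (volume : Measure (E N)).toSphere.prod volume) hi'
  have hIJ : ∫ p, symKernel N s τ φ ξ p
      = ∫ q, J q ∂((volume : Measure (E N)).toSphere.prod volume) := by
    conv_lhs => rw [← hP.map_eq]
    rw [integral_map hP.measurable.aemeasurable hm.aestronglyMeasurable]
    have : SFinite (volume : Measure (E N)).toSphere := inferInstance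
    exact integral_prod _ hi'
  have hJeq : ∀ (θ : Metric.sphere (0 : E N) 1) (y : E N), y ≠ 0 → J (θ, y)
      = rayIntegral ξ θ y * (wronskian N s τ φ ‖y‖ / ‖(θ : E N) - y‖ ^ ((N : ℝ) + 2 * s)) := by
    intro θ y hy
    simp only [hJ]
    rw [integral_powMeasure, rayIntegral, ← integral_mul_const]
    exact setIntegral_congr_fun measurableSet_Ioi fun r hr =>
      h.symKernel_polar ξ (by simp) hy hr
  set M := (((volume : Measure (E N)).toSphere.prod (volume : Measure (E N)).toSphere).prod
        (powMeasure (N - 1))) with hM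
  have hQ := measurePreserving_polarSnd (N := N)
  have hσ : MeasurePreserving (Prod.map Prod.swap id :
      (Metric.sphere (0 : E N) 1 × Metric.sphere (0 : E N) 1) × ℝ → _) M M :=
    Measure.measurePreserving_swap.prod (MeasurePreserving.id _)
  -- The transform of the kernel on `S × S × (0, ∞)` and its image under exchange of the directions
  -- have the same integral, and their sum is the logarithmic kernel.
  have hJQ := hQ.integrable_comp_of_integrable hJi
  have hJQσ := hσ.integrable_comp_of_integrable hJQ
  have hae : ∀ᵐ p ∂M, J (p.1.1, p.2 • (p.1.2 : E N)) + J (p.1.2, p.2 • (p.1.1 : E N))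
      = 2 * ξ 0 * logKernel N s τ φ (p.1.1, p.2 • (p.1.2 : E N)) := by
    have hpos : ∀ᵐ p ∂M, 0 < p.2 :=
      Measure.quasiMeasurePreserving_snd.ae (ae_powMeasure_pos (N - 1))
    filter_upwards [hpos] with ⟨⟨θ, θ'⟩, ρ⟩ hρ
    have hρ : 0 < ρ := hρ
    have hθ : ‖(θ : E N)‖ = 1 := by simp
    have hθ' : ‖(θ' : E N)‖ = 1 := by simp
    have hθ0 : (θ : E N) ≠ 0 := by rw [← norm_ne_zero_iff, hθ]; exact one_ne_zero
    have hθ0' : (θ' : E N) ≠ 0 := by rw [← norm_ne_zero_iff, hθ']; exact one_ne_zero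
    simp only
    rw [hJeq _ _ (smul_ne_zero hρ.ne' hθ0'), hJeq _ _ (smul_ne_zero hρ.ne' hθ0), logKernel,
      norm_sub_smul_comm hθ' hθ, norm_smul, norm_smul, hθ, hθ', Real.norm_of_nonneg hρ.le,
      mul_one, ← add_mul, hξ.rayIntegral_add hθ0 hθ0' hρ]
    ring
  have hIQ : ∫ q, J q ∂((volume : Measure (E N)).toSphere.prod volume)
      = ∫ p, J (p.1.1, p.2 • (p.1.2 : E N)) ∂M := by
    conv_lhs => rw [← hQ.map_eq]
    exact integral_map hQ.measurable.aemeasurable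
      (by rw [hQ.map_eq]; exact hJi.aestronglyMeasurable)
  have hIσ : ∫ p, J (p.1.2, p.2 • (p.1.1 : E N)) ∂M = ∫ p, J (p.1.1, p.2 • (p.1.2 : E N)) ∂M := by
    conv_rhs => rw [← hσ.map_eq]
    exact (integral_map hσ.measurable.aemeasurable
      (by rw [hσ.map_eq]; exact hJQ.aestronglyMeasurable)).symm
  have hIK : ∫ p, logKernel N s τ φ (p.1.1, p.2 • (p.1.2 : E N)) ∂M
      = sphereArea N * (2 * normIntegral N s τ φ) := by
    have hK := h.integrable_logKernel hs0 hs1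
    have e1 : ∫ p, logKernel N s τ φ (p.1.1, p.2 • (p.1.2 : E N)) ∂M
        = ∫ q, logKernel N s τ φ q ∂((volume : Measure (E N)).toSphere.prod volume) := by
      conv_rhs => rw [← hQ.map_eq]
      exact (integral_map hQ.measurable.aemeasurable
        h.measurable_logKernel.aestronglyMeasurable).symm
    have e2 : ∀ θ : Metric.sphere (0 : E N) 1, ∫ y : E N, logKernel N s τ φ (θ, y)
        = 2 * normIntegral N s τ φ := fun θ => by
      rw [← h.integral_log_wronskian hs0 hs1]
      simp only [logKernel]
      exact integral_rotate
        (fun a b => Real.log a * wronskian N s τ φ a / b ^ ((N : ℝ) + 2 * s)) (by simp)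
    rw [e1, integral_prod _ hK]
    simp_rw [e2]
    rw [integral_const, smul_eq_mul, sphereArea]
  have hsum : (∫ p, J (p.1.1, p.2 • (p.1.2 : E N)) ∂M)
      + ∫ p, J (p.1.2, p.2 • (p.1.1 : E N)) ∂M
      = 2 * ξ 0 * (sphereArea N * (2 * normIntegral N s τ φ)) := by
    rw [← hIK, ← integral_const_mul, ← integral_congr_ae hae]
    exact (integral_add hJQ hJQσ).symm
  rw [hIσ] at hsum
  rw [hIJ, hIQ]
  linarith

end FracHardy

namespace FracHardy

variable {N : ℕ} {s : ℝ}

/-! ### The fundamental solutions of the Hardy operator -/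

/-- The cases `μ > μ₀` and `μ = μ₀` are both instances of `FundamentalProfile`. -/
theorem exists_fundamentalProfile (hN : 2 ≤ N) (hs0 : 0 < s) (hs1 : s < 1) {μ : ℝ}
    (hμ : mu0 N s ≤ μ) :
    ∃ (τ : ℝ) (φ : ℝ → ℝ), FundamentalProfile N s τ φ ∧
      (∀ t, IsTauMinus N s μ t ↔ t = τ) ∧ (∀ t, IsTauPlus N s μ t ↔ t = 2 * s - N - τ) ∧
      Phi N s μ = (fun x => φ ‖x‖) ∧ Weight N s μ = GammaOf N (2 * s - N - τ) ∧
      normKernel N s μ = fun z => -wronskian N s τ φ ‖z‖ / ‖e1 N - z‖ ^ ((N : ℝ) + 2 * s) := by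
  obtain ⟨τ, h1, h2, h3, hm, hp⟩ := exists_exponents hN hs0 hs1 hμ
  have em : tauMinus N s μ = τ := (hm _).1 (Classical.epsilon_spec ⟨τ, (hm τ).2 rfl⟩)
  have ep : tauPlus N s μ = 2 * s - N - τ :=
    (hp _).1 (Classical.epsilon_spec ⟨2 * s - N - τ, (hp _).2 rfl⟩)
  by_cases hcrit : μ = mu0 N s
  · have hτ := h3.1 hcrit
    subst hτ
    refine ⟨_, _, fundamentalProfile_log h1, hm, hp, ?_, by rw [Weight, ep], ?_⟩
    · funext x
      rw [Phi, em, PhiOf, if_pos hcrit]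
    · funext z
      rw [normKernel, if_pos hcrit, wronskian, Real.log_one]
      ring
  · have hlt : τ < (2 * s - N) / 2 := lt_of_le_of_ne h2 fun h => hcrit (h3.2 h)
    refine ⟨_, _, fundamentalProfile_rpow h1 hlt, hm, hp, ?_, by rw [Weight, ep], ?_⟩
    · funext x
      rw [Phi, em, PhiOf, if_neg hcrit]
    · funext z
      rw [normKernel, if_neg hcrit, em, ep, wronskian, Real.one_rpow]
      ring

end FracHardy

theorem theorem1p3 (N : ℕ) (hN : 2 ≤ N) (s : ℝ) (hs0 : 0 < s) (hs1 : s < 1)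
    (μ : ℝ) (hμ : FracHardy.mu0 N s ≤ μ) :
    -- the exponents are well defined
    (∃! τ : ℝ, FracHardy.IsTauMinus N s μ τ) ∧
    (∃! τ : ℝ, FracHardy.IsTauPlus N s μ τ) ∧
    -- the integrals that define the constant converge absolutely, and it is positive
    (∀ t ∈ Set.Ioo (0 : ℝ) 1,
      MeasureTheory.IntegrableOn (FracHardy.normKernel N s μ)
        (Metric.ball (0 : FracHardy.E N) t)) ∧
    IntervalIntegrable (FracHardy.normInner N s μ) MeasureTheory.volume 0 1 ∧
    0 < FracHardy.normConst N s μ ∧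
    -- the distributional identity, whose integrals are well defined
    ∀ ξ : FracHardy.E N → ℝ, ContDiff ℝ 2 ξ → HasCompactSupport ξ →
      (∀ x : FracHardy.E N, x ≠ 0 →
        FracHardy.HasFracLap s (FracHardy.Weight N s μ) ξ x
          (FracHardy.fracLap s (FracHardy.Weight N s μ) ξ x)) ∧
      MeasureTheory.Integrable (fun x : FracHardy.E N =>
        FracHardy.Phi N s μ x * FracHardy.fracLap s (FracHardy.Weight N s μ) ξ x) ∧
      ∫ x : FracHardy.E N,
          FracHardy.Phi N s μ x * FracHardy.fracLap s (FracHardy.Weight N s μ) ξ x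
        = FracHardy.normConst N s μ * ξ 0 := by
  have : NeZero N := ⟨by omega⟩
  obtain ⟨τ, φ, h, hm, hp, hΦ, hW, hK⟩ := FracHardy.exists_fundamentalProfile hN hs0 hs1 hμ
  have hτ := h.neg_lt
  have hc := h.le_critical
  have hi := h.integrable_and_integral_inner hs0 hs1
  have hinner : FracHardy.normInner N s μ = fun t => 1 / t * ∫ y in Metric.ball 0 t,
      -FracHardy.wronskian N s τ φ ‖y‖ / ‖FracHardy.e1 N - y‖ ^ ((N : ℝ) + 2 * s) := by
    funext t
    rw [FracHardy.normInner, hK]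
  have hconst : FracHardy.normConst N s μ = FracHardy.fracConst N s * FracHardy.sphereArea N *
      FracHardy.FundamentalProfile.normIntegral N s τ φ := by
    rw [FracHardy.normConst, intervalIntegral.integral_of_le zero_le_one, hinner, hi.2]
  refine ⟨⟨τ, (hm τ).2 rfl, fun t ht => (hm t).1 ht⟩,
    ⟨2 * s - N - τ, (hp _).2 rfl, fun t ht => (hp t).1 ht⟩, fun t ht => ?_, ?_, ?_,
    fun ξ hξ hξc => ?_⟩
  · rw [hK]
    exact h.integrableOn_ball hs0 ht.2
  · rw [intervalIntegrable_iff_integrableOn_Ioc_of_le zero_le_one, hinner]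
    exact hi.1
  · rw [hconst]
    exact mul_pos (mul_pos (FracHardy.fracConst_pos hs0 hs1) FracHardy.sphereArea_pos)
      (h.normIntegral_pos hs0 hs1)
  · obtain ⟨L, R, hb⟩ := FracHardy.exists_testBounds hξ hξc
    have hpair := h.integrable_and_integral_fracLap hs0 hs1 hb
    rw [hΦ, hW, hconst]
    refine ⟨fun x hx => ?_, hpair.1, ?_⟩
    · have hL := hb.hasFracLap hs1 (γ := 2 * s - N - τ) (by linarith) (by linarith) hx
      rwa [hL.fracLap_eq]
    · rw [hpair.2, h.integral_symKernel hs0 hs1 hb]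
      ring
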